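/- Let $\mathcal D$ be a triangulated category, $\Lambda$ a free abelian group of finite rank, and $v\colon K(\mathcal D)\twoheadrightarrow\Lambda$ a surjective homomorphism from the Grothendieck group of $\mathcal D$. Put $\Lambda_{\mathbb R}=\Lambda\otimes\mathbb R$. A pre-stability condition on $\mathcal D$ is a pair $\sigma=(Z,\mathcal P)$ of a homomorphism $Z\colon\Lambda\to\mathbb C$ (the central charge) and a family of strictly full subcategories $\mathcal P(\phi)\subset\mathcal D$, $\phi\in\mathbb R$, containing the zero objects, such that: (i) $\mathcal P(\phi+1)=\mathcal P(\phi)[1]$; (ii) $\mathrm{Hom}(\mathcal P(\phi_1),\mathcal P(\phi_2))=0$ for $\phi_1>\phi_2$; (iii) $Z(v(E))\in\mathbb R_{>0}\,e^{i\pi\phi}$ for $0\ne E\in\mathcal P(\phi)$; (iv) every object $E$ has a Harder–Narasimhan filtration $0=E_0\to E_1\to\dots\to E_m=E$ in which the cone of $E_{i-1}\to E_i$ is a nonzero object $A_i\in\mathcal P(\phi_i)$ and $\phi_1>\dots>\phi_m$. The objects of the $\mathcal P(\phi)$ are called $\sigma$-semistable. For $E\neq0$ write $\phi^+_\sigma(E)=\phi_1$,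 $\phi^-_\sigma(E)=\phi_m$ and $m_\sigma(E)=\sum_i|Z(v(A_i))|$. The pre-stability condition $\sigma$ satisfies the support property with respect to a real quadratic form $Q$ on $\Lambda_{\mathbb R}$ if $Q$ is negative definite on the kernel of the $\mathbb R$-linear extension $\Lambda_{\mathbb R}\to\mathbb C$ of $Z$, and $Q(v(E))\ge0$ for every $\sigma$-semistable object $E$. Let $\mathrm{Stab}_\Lambda(\mathcal D)$ be the set of pre-stability conditions that satisfy the support property with respect to some $Q$, with the topology of the generalized metric $$d(\sigma_1,\sigma_2)=\sup_{0\ne E\in\mathcal D}\max\left\{|\phi^-_{\sigma_2}(E)-\phi^-_{\sigma_1}(E)|,\ |\phi^+_{\sigma_2}(E)-\phi^+_{\sigma_1}(E)|,\ |\log m_{\sigma_2}(E)-\log m_{\sigma_1}(E)|\right\}\in[0,\infty],$$ and let $\mathcal Z\colon\mathrm{Stab}_\Lambda(\mathcal D)\to\mathrm{Hom}(\Lambda,\mathbb C)$, $(Z,\mathcal P)\mapsto Z$. **Proposition.** Assume that $\sigma=(Z,\mathcal P)\in\mathrm{Stab}_\Lambda(\mathcal D)$ satisfies the support property with respect to a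 quadratic form $Q$ on $\Lambda_{\mathbb R}$. The set of central charges in $\mathrm{Hom}(\Lambda,\mathbb C)$ whose kernel (in $\Lambda_{\mathbb R}$) is negative definite with respect to $Q$ is open; let $U$ be its connected component containing $Z$, and let $\mathcal U\subset\mathrm{Stab}_\Lambda(\mathcal D)$ be the connected component of $\mathcal Z^{-1}(U)$ containing $\sigma$. Then: 1. the restriction $\mathcal Z|_{\mathcal U}\colon\mathcal U\to U$ is a (surjective) covering map; 2. every $\sigma'\in\mathcal U$ satisfies the support property with respect to the same quadratic form $Q$. -/

import Mathlib

open CategoryTheory CategoryTheory.Limits CategoryTheory.Pretriangulated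
open scoped TensorProduct ENNReal

noncomputable section

namespace BridgelandStab

universe w u

section Grothendieck

variable (D : Type u) [Category.{w} D] [HasZeroObject D] [HasShift D ℤ] [Preadditive D]
  [∀ n : ℤ, (shiftFunctor D n).Additive] [Pretriangulated D]

/-- The subgroup generated by the elements `[Y] - [X] - [Z]`, one for each distinguished
triangle `X ⟶ Y ⟶ Z ⟶ X⟦1⟧`. -/
def triangleRelations : AddSubgroup (FreeAbelianGroup D) :=
  AddSubgroup.closure
    {x | ∃ T ∈ distTriang D, x = FreeAbelianGroup.of T.obj₂ - FreeAbelianGroup.of T.obj₁ -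
      FreeAbelianGroup.of T.obj₃}

/-- The Grothendieck group `K(D)` of a triangulated category. -/
abbrev K₀ : Type u := FreeAbelianGroup D ⧸ triangleRelations D

variable {D}

/-- The class `[E]` of an object in the Grothendieck group. -/
def K₀.of (E : D) : K₀ D := QuotientAddGroup.mk (FreeAbelianGroup.of E)

/-- A Harder-Narasimhan filtration
`0 = E_0 ⟶ E_1 ⟶ ⋯ ⟶ E_n = E` of `E` with respect to a family `P` of full subcategories: the cone
of `E_i ⟶ E_(i+1)` is a nonzero object `factor i` of `P (phase i)`, and the phases
strictly decrease. -/
structure HNFiltration (P : ℝ → ObjectProperty D) (E : D) where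
  n : ℕ
  obj : Fin (n + 1) → D
  factor : Fin n → D
  phase : Fin n → ℝ
  ι : ∀ i : Fin n, obj i.castSucc ⟶ obj i.succ
  π : ∀ i : Fin n, obj i.succ ⟶ factor i
  δ : ∀ i : Fin n, factor i ⟶ (obj i.castSucc)⟦(1 : ℤ)⟧
  isZero_bot : IsZero (obj 0)
  top : obj (Fin.last n) ≅ E
  distinguished : ∀ i : Fin n, Triangle.mk (ι i) (π i) (δ i) ∈ distTriang D
  factor_mem : ∀ i : Fin n, P (phase i) (factor i)
  factor_ne_zero : ∀ i : Fin n, ¬ IsZero (factor i)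
  phase_strictAnti : StrictAnti phase

theorem HNFiltration.n_pos {P : ℝ → ObjectProperty D} {E : D} (F : HNFiltration P E)
    (hE : ¬ IsZero E) : 0 < F.n := by
  rcases F with ⟨n, obj, factor, phase, ι, π, δ, h0, top, h1, h2, h3, h4⟩
  rcases Nat.eq_zero_or_pos n with h | h
  · subst h
    exact absurd (h0.of_iso top.symm) hE
  · exact h

end Grothendieck

section Charges

variable {Λ : Type*} [AddCommGroup Λ]

/-- The topology on `Hom(Λ, ℂ)` is that of pointwise convergence; for `Λ` of finite rank this is
the usual topology of a finite-dimensional complex vector space. -/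
instance chargeTopology : TopologicalSpace (Λ →ₗ[ℤ] ℂ) :=
  TopologicalSpace.induced (fun Z (x : Λ) => Z x) inferInstance

/-- The kernel, in `Λ_ℝ = ℝ ⊗ Λ`, of the `ℝ`-linear extension of `Z` is negative definite with
respect to `Q`. -/
def KerNegDef (Q : QuadraticForm ℝ (ℝ ⊗[ℤ] Λ)) (Z : Λ →ₗ[ℤ] ℂ) : Prop :=
  ∀ x : ℝ ⊗[ℤ] Λ, Z.liftBaseChange ℝ x = 0 → x ≠ 0 → Q x < 0

/-- The set of central charges whose kernel is negative definite with respect to `Q`. -/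
def negDefCharges (Q : QuadraticForm ℝ (ℝ ⊗[ℤ] Λ)) : Set (Λ →ₗ[ℤ] ℂ) := {Z | KerNegDef Q Z}

end Charges

section Stab

variable {D : Type u} [Category.{w} D] [HasZeroObject D] [HasShift D ℤ] [Preadditive D]
  [∀ n : ℤ, (shiftFunctor D n).Additive] [Pretriangulated D]
  {Λ : Type*} [AddCommGroup Λ]

/-- A pre-stability condition `(Z, P)` with respect to `v : K(D) → Λ`. The subcategories `P φ` are
strictly full and contain the zero objects; closure under finite direct sums
follows from the remaining axioms. -/
structure PreStabilityCondition (v : K₀ D →+ Λ) where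
  Z : Λ →ₗ[ℤ] ℂ
  P : ℝ → ObjectProperty D
  iso_closed : ∀ (φ : ℝ) {E F : D}, (E ≅ F) → P φ E → P φ F
  zero_mem : ∀ (φ : ℝ) {E : D}, IsZero E → P φ E
  shift_iff : ∀ (φ : ℝ) (E : D), P (φ + 1) (E⟦(1 : ℤ)⟧) ↔ P φ E
  hom_eq_zero : ∀ {φ₁ φ₂ : ℝ}, φ₂ < φ₁ → ∀ {E F : D}, P φ₁ E → P φ₂ F → ∀ f : E ⟶ F, f = 0
  charge_mem_ray : ∀ {φ : ℝ} {E : D}, P φ E → ¬ IsZero E →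
    ∃ r : ℝ, 0 < r ∧ Z (v (K₀.of E)) = r * Complex.exp (Complex.I * Real.pi * φ)
  exists_hn : ∀ E : D, Nonempty (HNFiltration P E)

namespace PreStabilityCondition

variable {v : K₀ D →+ Λ}

/-- An object is semistable if it lies in some `P φ`. -/
def IsSemistable (σ : PreStabilityCondition v) (E : D) : Prop := ∃ φ : ℝ, σ.P φ E

/-- The support property with respect to a given quadratic form `Q` on `Λ_ℝ`. -/
def SupportProperty (σ : PreStabilityCondition v) (Q : QuadraticForm ℝ (ℝ ⊗[ℤ] Λ)) : Prop :=
  KerNegDef Q σ.Z ∧ ∀ E : D, σ.IsSemistable E → 0 ≤ Q ((1 : ℝ) ⊗ₜ[ℤ] v (K₀.of E))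

/-- A Harder-Narasimhan filtration of `E`; it is unique up to isomorphism, so that the
phases and the mass below do not depend on the choice. -/
def hn (σ : PreStabilityCondition v) (E : D) : HNFiltration σ.P E :=
  Classical.choice (σ.exists_hn E)

/-- The maximal phase `φ⁺(E)` in the Harder-Narasimhan filtration of `E ≠ 0`. -/
def phiPlus (σ : PreStabilityCondition v) (E : {E : D // ¬ IsZero E}) : ℝ :=
  (σ.hn E.1).phase ⟨0, (σ.hn E.1).n_pos E.2⟩

/-- The minimal phase `φ⁻(E)` in the Harder-Narasimhan filtration of `E ≠ 0`. -/
def phiMinus (σ : PreStabilityCondition v) (E : {E : D // ¬ IsZero E}) : ℝ :=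
  (σ.hn E.1).phase ⟨(σ.hn E.1).n - 1, Nat.sub_lt ((σ.hn E.1).n_pos E.2) Nat.one_pos⟩

/-- The mass `m(E) = ∑ |Z(A_i)|`, over the Harder-Narasimhan factors `A_i` of `E`. -/
def mass (σ : PreStabilityCondition v) (E : D) : ℝ :=
  ∑ i, ‖σ.Z (v (K₀.of ((σ.hn E).factor i)))‖

end PreStabilityCondition

/-- `Stab_Λ(D)`: pre-stability conditions that satisfy the support property. -/
structure StabilityCondition (v : K₀ D →+ Λ) extends PreStabilityCondition v where
  support : ∃ Q : QuadraticForm ℝ (ℝ ⊗[ℤ] Λ), toPreStabilityCondition.SupportProperty Q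

namespace StabilityCondition

variable {v : K₀ D →+ Λ}

/-- Bridgeland's generalized metric on `Stab_Λ(D)`: the supremum over `E ≠ 0` of
`|φ⁻(E) - φ'⁻(E)|`, `|φ⁺(E) - φ'⁺(E)|` and `|log m(E) - log m'(E)|`. -/
def stabEDist (σ τ : StabilityCondition v) : ℝ≥0∞ :=
  ⨆ E : {E : D // ¬ IsZero E},
    max (edist (σ.phiMinus E) (τ.phiMinus E))
      (max (edist (σ.phiPlus E) (τ.phiPlus E))
        (edist (Real.log (σ.mass E.1)) (Real.log (τ.mass E.1))))

/-- `Stab_Λ(D)` carries the topology of the generalized metric. -/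
instance : PseudoEMetricSpace (StabilityCondition v) where
  edist := stabEDist
  edist_self σ := by
    simp [stabEDist]
  edist_comm σ τ := by
    simp only [stabEDist, edist_comm]
  edist_triangle σ τ ρ := by
    refine iSup_le fun E => ?_
    have h1 := le_iSup (fun E : {E : D // ¬ IsZero E} =>
      max (edist (σ.phiMinus E) (τ.phiMinus E))
      (max (edist (σ.phiPlus E) (τ.phiPlus E))
        (edist (Real.log (σ.mass E.1)) (Real.log (τ.mass E.1))))) E
    have h2 := le_iSup (fun E : {E : D // ¬ IsZero E} =>
      max (edist (τ.phiMinus E) (ρ.phiMinus E))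
      (max (edist (τ.phiPlus E) (ρ.phiPlus E))
        (edist (Real.log (τ.mass E.1)) (Real.log (ρ.mass E.1))))) E
    simp only [max_le_iff] at h1 h2
    refine max_le ?_ (max_le ?_ ?_)
    · exact (edist_triangle _ _ _).trans (add_le_add h1.1 h2.1)
    · exact (edist_triangle _ _ _).trans (add_le_add h1.2.1 h2.2.1)
    · exact (edist_triangle _ _ _).trans (add_le_add h1.2.2 h2.2.2)

/-- The forgetful map `(Z, P) ↦ Z`. -/
def charge (σ : StabilityCondition v) : Λ →ₗ[ℤ] ℂ := σ.Z

/-- The connected component, containing the central charge of `σ`, of the set of central charges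
whose kernel is negative definite with respect to `Q`. -/
def chargeComponent (σ : StabilityCondition v) (Q : QuadraticForm ℝ (ℝ ⊗[ℤ] Λ)) :
    Set (Λ →ₗ[ℤ] ℂ) :=
  connectedComponentIn (negDefCharges Q) σ.charge

/-- The connected component, containing `σ`, of the preimage in `Stab_Λ(D)` of
`σ.chargeComponent Q`. -/
def stabComponent (σ : StabilityCondition v) (Q : QuadraticForm ℝ (ℝ ⊗[ℤ] Λ)) :
    Set (StabilityCondition v) :=
  connectedComponentIn (charge ⁻¹' σ.chargeComponent Q) σ

theorem mapsTo_charge (σ : StabilityCondition v) (Q : QuadraticForm ℝ (ℝ ⊗[ℤ] Λ)) :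
    Set.MapsTo charge (σ.stabComponent Q) (σ.chargeComponent Q) :=
  fun _ h => connectedComponentIn_subset (charge ⁻¹' σ.chargeComponent Q) σ h

end StabilityCondition

end Stab

end BridgelandStab

end

/-!
A central charge is deformed by changing one of its real components at a time, the component
`imRot α` transverse to it being fixed. The hearts `P((α + n, α + n + 1])` then stay the same, and
the new semistable objects are the slope-semistable objects of these hearts. The polygon of the
Harder-Narasimhan filtration of an object bounds the classes of its subobjects. By the support
property only finitely many classes are left, so maximal destabilizing subobjects and
Harder-Narasimhan filtrations exist for the new charge. Phases and masses move little.

The form `Q` stays nonnegative on semistable classes. An object that is semistable for the new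
charge but not for the old one becomes strictly semistable at some time of the straight path between
the charges; there its charge is a sum of two positive multiples `r * c` and `s * c` coming from
semistable factors, and `0 ≤ Q` passes from the factors to the object because `Q` is negative
definite on the kernel of the charge. The factors are smaller in a discrete sense, which makes the
induction terminate.

Moving first the real and then the imaginary part of the charge, every stability condition whose
charge lies in a small box lifts the entire box, with a bound on the distance that depends on the
box only. Since two stability conditions at distance less than `1` with the same charge are equal,
these lifts are unique, so the stability conditions supported by `Q` form a union of sheets over the
box and are open and closed among those with charge in `negDefCharges Q`.
-/
open scoped ZeroObject

noncomputable section

namespace BridgelandStab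

universe w u

section Triangles

variable {D : Type u} [Category.{w} D] [HasShift D ℤ] [Preadditive D]

theorem isZero_shift_iff [∀ n : ℤ, (shiftFunctor D n).Additive] {A : D} {n : ℤ} :
    IsZero (A⟦n⟧) ↔ IsZero A :=
  ⟨fun h => (Functor.map_isZero (shiftFunctor D (-n)) h).of_iso (shiftShiftNeg A n).symm,
    fun h => Functor.map_isZero (shiftFunctor D n) h⟩

variable [HasZeroObject D] [∀ n : ℤ, (shiftFunctor D n).Additive] [Pretriangulated D]

theorem exists_lift {A E B X : D} {a : A ⟶ E} {b : E ⟶ B} {c : B ⟶ A⟦(1 : ℤ)⟧}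
    (hT : Triangle.mk a b c ∈ distTriang D) (f : X ⟶ E) (hf : f ≫ b = 0) :
    ∃ g : X ⟶ A, g ≫ a = f := by
  obtain ⟨g, hg⟩ := Triangle.coyoneda_exact₂ _ hT f hf
  exact ⟨g, hg.symm⟩

theorem exists_desc {A E B X : D} {a : A ⟶ E} {b : E ⟶ B} {c : B ⟶ A⟦(1 : ℤ)⟧}
    (hT : Triangle.mk a b c ∈ distTriang D) (f : E ⟶ X) (hf : a ≫ f = 0) :
    ∃ g : B ⟶ X, b ≫ g = f := by
  obtain ⟨g, hg⟩ := Triangle.yoneda_exact₂ _ hT f hf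
  exact ⟨g, hg.symm⟩

/-- There is a distinguished triangle `A ⟶ E ⟶ B ⟶ A⟦1⟧`. Most arguments about filtrations need
only its three objects, which makes this relation the triangulated analogue of "`E` is an extension
of `B` by `A`". -/
def DistTri (A E B : D) : Prop :=
  ∃ (f : A ⟶ E) (g : E ⟶ B) (h : B ⟶ A⟦(1 : ℤ)⟧), Triangle.mk f g h ∈ distTriang D

namespace DistTri

variable {A E B : D}

theorem rotate (h : DistTri A E B) : DistTri E B (A⟦(1 : ℤ)⟧) := by
  obtain ⟨f, g, k, hT⟩ := h
  exact ⟨_, _, _, rot_of_distTriang _ hT⟩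

theorem invRotate (h : DistTri A E B) : DistTri (B⟦(-1 : ℤ)⟧) A E := by
  obtain ⟨f, g, k, hT⟩ := h
  exact ⟨_, _, _, inv_rot_of_distTriang _ hT⟩

theorem shift (h : DistTri A E B) (n : ℤ) : DistTri (A⟦n⟧) (E⟦n⟧) (B⟦n⟧) := by
  obtain ⟨f, g, k, hT⟩ := h
  exact ⟨_, _, _, Triangle.shift_distinguished _ hT n⟩

theorem of_iso {A' E' B' : D} (h : DistTri A E B) (a : A' ≅ A) (e : E' ≅ E) (b : B' ≅ B) :
    DistTri A' E' B' := by
  obtain ⟨f, g, k, hT⟩ := h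
  refine ⟨a.hom ≫ f ≫ e.inv, e.hom ≫ g ≫ b.inv, b.hom ≫ k ≫ (a.inv)⟦(1 : ℤ)⟧',
    isomorphic_distinguished _ hT _ (Triangle.isoMk _ _ a e b ?_ ?_ ?_)⟩
  · change (a.hom ≫ f ≫ e.inv) ≫ e.hom = a.hom ≫ f
    simp
  · change (e.hom ≫ g ≫ b.inv) ≫ b.hom = e.hom ≫ g
    simp
  · change (b.hom ≫ k ≫ (shiftFunctor D (1 : ℤ)).map a.inv) ≫
      (shiftFunctor D (1 : ℤ)).map a.hom = b.hom ≫ k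
    simp [← Functor.map_comp]

theorem of_shift {n : ℤ} (h : DistTri (A⟦n⟧) (E⟦n⟧) (B⟦n⟧)) : DistTri A E B :=
  (h.shift (-n)).of_iso (shiftShiftNeg A n).symm (shiftShiftNeg E n).symm (shiftShiftNeg B n).symm

theorem of_isZero_right (e : A ≅ E) (hB : IsZero B) : DistTri A E B := by
  have h : DistTri A A (0 : D) := ⟨_, _, _, contractible_distinguished A⟩
  exact h.of_iso (Iso.refl _) e.symm (hB.iso (isZero_zero D))

theorem of_isZero_left (e : E ≅ B) (hA : IsZero A) : DistTri A E B := by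
  have h : DistTri (0 : D) B B := ⟨_, _, _, contractible_distinguished₁ B⟩
  exact h.of_iso (hA.iso (isZero_zero D)) e (Iso.refl _)

theorem nonempty_iso_right (h : DistTri A E B) (hA : IsZero A) : Nonempty (E ≅ B) := by
  obtain ⟨f, g, k, hT⟩ := h
  have : IsIso g := ((Triangle.mk f g k).isZero₁_iff_isIso₂ hT).1 hA
  exact ⟨asIso g⟩

theorem nonempty_iso_left (h : DistTri A E B) (hB : IsZero B) : Nonempty (A ≅ E) := by
  obtain ⟨f, g, k, hT⟩ := h
  have : IsIso f := ((Triangle.mk f g k).isZero₃_iff_isIso₁ hT).1 hB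
  exact ⟨asIso f⟩

theorem hom_to_mid_eq_zero {X : D} (h : DistTri A E B) (hA : ∀ f : X ⟶ A, f = 0)
    (hB : ∀ f : X ⟶ B, f = 0) (f : X ⟶ E) : f = 0 := by
  obtain ⟨a, b, c, hT⟩ := h
  obtain ⟨g, rfl⟩ := exists_lift hT f (hB _)
  rw [hA g, zero_comp]

theorem hom_from_mid_eq_zero {X : D} (h : DistTri A E B) (hA : ∀ f : A ⟶ X, f = 0)
    (hB : ∀ f : B ⟶ X, f = 0) (f : E ⟶ X) : f = 0 := by
  obtain ⟨a, b, c, hT⟩ := h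
  obtain ⟨g, rfl⟩ := exists_desc hT f (hA _)
  rw [hB g, comp_zero]

variable [IsTriangulated D]

theorem comp {A' C : D} (h₁ : DistTri A' A C) (h₂ : DistTri A E B) :
    ∃ X, DistTri A' E X ∧ DistTri C X B := by
  obtain ⟨f, f', f'', hf⟩ := h₁
  obtain ⟨g, g', g'', hg⟩ := h₂
  obtain ⟨X, k, k', hk⟩ := distinguished_cocone_triangle (f ≫ g)
  exact ⟨X, ⟨_, _, _, hk⟩, _, _, _, (Triangulated.someOctahedron rfl hf hg hk).mem⟩

end DistTri

variable [IsTriangulated D]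

theorem exists_distTri_of_comp_eq {S X E S' Y : D} {f : S ⟶ E} {f' : E ⟶ S'}
    {f'' : S' ⟶ S⟦(1 : ℤ)⟧} (hf : Triangle.mk f f' f'' ∈ distTriang D) {x : X ⟶ E} {x' : E ⟶ Y}
    {x'' : Y ⟶ X⟦(1 : ℤ)⟧} (hx : Triangle.mk x x' x'' ∈ distTriang D) (g : S ⟶ X)
    (hg : g ≫ x = f) : ∃ R, DistTri S X R ∧ DistTri R S' Y := by
  obtain ⟨R, g', g'', hT⟩ := distinguished_cocone_triangle g
  exact ⟨R, ⟨_, _, _, hT⟩, _, _, _, (Triangulated.someOctahedron hg hT hx hf).mem⟩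

theorem exists_distTri_fiber_comp {A E B B' B'' : D} {f : A ⟶ E} {g : E ⟶ B}
    {h : B ⟶ A⟦(1 : ℤ)⟧} (h₁ : Triangle.mk f g h ∈ distTriang D) {b' : B' ⟶ B} {b : B ⟶ B''}
    {b'' : B'' ⟶ B'⟦(1 : ℤ)⟧} (h₂ : Triangle.mk b' b b'' ∈ distTriang D) :
    ∃ (E' : D) (i : E' ⟶ E) (j : B'' ⟶ E'⟦(1 : ℤ)⟧), DistTri A E' B' ∧
      Triangle.mk i (g ≫ b) j ∈ distTriang D := by
  obtain ⟨E', i, j, hT⟩ := distinguished_cocone_triangle₁ (g ≫ b)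
  have hcone := (Triangulated.someOctahedron rfl (rot_of_distTriang _ h₁) (rot_of_distTriang _ h₂)
    (rot_of_distTriang _ hT)).mem
  exact ⟨E', i, j, DistTri.of_shift (n := 1) ⟨_, _, _, hcone⟩, hT⟩

theorem DistTri.pullback {A E B B' B'' : D} (h₁ : DistTri A E B) (h₂ : DistTri B' B B'') :
    ∃ E', DistTri A E' B' ∧ DistTri E' E B'' := by
  obtain ⟨f, g, h, h₁⟩ := h₁
  obtain ⟨b', b, b'', h₂⟩ := h₂
  obtain ⟨E', i, j, hE', hT⟩ := exists_distTri_fiber_comp h₁ h₂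
  exact ⟨E', hE', _, _, _, hT⟩

end Triangles

section GrothendieckGroup

variable {D : Type u} [Category.{w} D] [HasZeroObject D] [HasShift D ℤ] [Preadditive D]
  [∀ n : ℤ, (shiftFunctor D n).Additive] [Pretriangulated D]

namespace K₀

theorem of_eq_add_of_distTri {A E B : D} (h : DistTri A E B) : of E = of A + of B := by
  obtain ⟨f, g, k, hT⟩ := h
  have hrel : FreeAbelianGroup.of E - FreeAbelianGroup.of A - FreeAbelianGroup.of B ∈
      triangleRelations D := AddSubgroup.subset_closure ⟨_, hT, rfl⟩
  rw [← QuotientAddGroup.eq_zero_iff, QuotientAddGroup.mk_sub, QuotientAddGroup.mk_sub, sub_sub,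
    sub_eq_zero] at hrel
  exact hrel

theorem of_isZero {X : D} (hX : IsZero X) : of X = 0 := by
  simpa using of_eq_add_of_distTri (DistTri.of_isZero_left (Iso.refl X) hX)

theorem of_iso {A B : D} (e : A ≅ B) : of A = of B := by
  have h := of_eq_add_of_distTri (DistTri.of_isZero_right e (isZero_zero D))
  rw [of_isZero (isZero_zero D), add_zero] at h
  exact h.symm

theorem of_shift (A : D) : of (A⟦(1 : ℤ)⟧) = -of A := by
  have h := of_eq_add_of_distTri
    (DistTri.of_isZero_right (Iso.refl A) (isZero_zero D)).rotate
  rw [of_isZero (isZero_zero D)] at h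
  exact (neg_eq_of_add_eq_zero_right h.symm).symm

end K₀

variable {Λ : Type*} [AddCommGroup Λ] {v : K₀ D →+ Λ}

/-- The class `v(E) ∈ Λ` of an object `E`. -/
def cls (v : K₀ D →+ Λ) (E : D) : Λ := v (K₀.of E)

theorem cls_distTri {A E B : D} (t : DistTri A E B) : cls v E = cls v A + cls v B := by
  rw [cls, K₀.of_eq_add_of_distTri t, map_add, cls, cls]

theorem cls_isZero {E : D} (h : IsZero E) : cls v E = 0 := by
  rw [cls, K₀.of_isZero h, map_zero]

theorem cls_iso {A B : D} (e : A ≅ B) : cls v A = cls v B := by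
  rw [cls, K₀.of_iso e, cls]

theorem cls_shift (A : D) : cls v (A⟦(1 : ℤ)⟧) = -cls v A := by
  rw [cls, K₀.of_shift, map_neg, cls]

theorem cls_neg_shift (E : D) : cls v (E⟦(-1 : ℤ)⟧) = -cls v E := by
  have h := cls_shift (v := v) (E⟦(-1 : ℤ)⟧)
  rwa [cls_iso (shiftNegShift E (1 : ℤ)), eq_neg_iff_add_eq_zero, add_comm,
    ← eq_neg_iff_add_eq_zero] at h

end GrothendieckGroup

section Chains

variable {D : Type u} [Category.{w} D] [HasZeroObject D] [HasShift D ℤ] [Preadditive D]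
  [∀ n : ℤ, (shiftFunctor D n).Additive] [Pretriangulated D] {P : ℝ → ObjectProperty D}

/-- A Harder-Narasimhan filtration of `E`, recorded only by the list of its phases and factors, the
last factor first. In this form filtrations can be cut and concatenated by induction. -/
inductive HNChain (P : ℝ → ObjectProperty D) : List (ℝ × D) → D → Prop
  | nil {E : D} : IsZero E → HNChain P [] E
  | cons {E' E A : D} {φ : ℝ} {l : List (ℝ × D)} : HNChain P l E' → DistTri E' E A → P φ A →
      ¬ IsZero A → (∀ p ∈ l, φ < p.1) → HNChain P ((φ, A) :: l) E

namespace HNChain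

variable {l : List (ℝ × D)} {E : D}

theorem of_iso {F : D} (h : HNChain P l E) (e : E ≅ F) : HNChain P l F := by
  cases h with
  | nil h => exact .nil (h.of_iso e.symm)
  | cons h t hA hA' hl => exact .cons h (t.of_iso (Iso.refl _) e.symm (Iso.refl _)) hA hA' hl

theorem mem (h : HNChain P l E) : ∀ p ∈ l, P p.1 p.2 := by
  induction h with
  | nil => simp
  | cons _ _ hA _ _ ih => simpa using ⟨hA, fun a b h => ih (a, b) h⟩

theorem ne_zero (h : HNChain P l E) : ∀ p ∈ l, ¬ IsZero p.2 := by
  induction h with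
  | nil => simp
  | cons _ _ _ hA' _ ih => simpa using ⟨hA', fun a b h => ih (a, b) h⟩

theorem isZero_of_nil (h : HNChain P [] E) : IsZero E := by
  cases h with
  | nil h => exact h

theorem ext_induction (h : HNChain P l E) (q : D → Prop) (h0 : ∀ E, IsZero E → q E)
    (hext : ∀ A E B, DistTri A E B → q A → q B → q E) (hl : ∀ p ∈ l, q p.2) : q E := by
  induction h with
  | nil h => exact h0 _ h
  | cons _ t _ _ _ ih =>
    exact hext _ _ _ t (ih fun p hp => hl p (List.mem_cons_of_mem _ hp))
      (hl _ List.mem_cons_self)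

theorem cls_eq_sum {Λ : Type*} [AddCommGroup Λ] {v : K₀ D →+ Λ} (h : HNChain P l E) :
    cls v E = (l.map fun p => cls v p.2).sum := by
  induction h with
  | nil h => simpa using cls_isZero h
  | cons _ t _ _ _ ih => simp [cls_distTri t, ih, add_comm]

theorem map_cls_eq_sum {Λ : Type*} [AddCommGroup Λ] {v : K₀ D →+ Λ} {M G : Type*}
    [AddCommMonoid M] [FunLike G Λ M] [AddMonoidHomClass G Λ M] (h : HNChain P l E) (f : G) :
    f (cls v E) = (l.map fun p => f (cls v p.2)).sum := by
  rw [h.cls_eq_sum, map_list_sum, List.map_map]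
  rfl

theorem exists_distTri_filter [IsTriangulated D] (h : HNChain P l E) (a : ℝ) :
    ∃ X Y, DistTri X E Y ∧ HNChain P (l.filter fun p => a < p.1) X ∧
      HNChain P (l.filter fun p => p.1 ≤ a) Y := by
  induction h with
  | @nil E h =>
    exact ⟨E, E, .of_isZero_right (Iso.refl _) h, by simpa using .nil h, by simpa using .nil h⟩
  | @cons E' E A φ l h t hA hA' hl ih =>
    rcases lt_or_ge a φ with hφ | hφ
    · have hgt : ∀ p ∈ (φ, A) :: l, a < p.1 := by
        simpa using ⟨hφ, fun b B hb => hφ.trans (hl _ hb)⟩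
      refine ⟨E, 0, .of_isZero_right (Iso.refl _) (isZero_zero D), ?_, ?_⟩
      · rw [List.filter_eq_self.2 (by simpa using hgt)]
        exact .cons h t hA hA' hl
      · rw [List.filter_eq_nil_iff.2 (by simpa using hgt)]
        exact .nil (isZero_zero D)
    · obtain ⟨X, Y', hT, hX, hY'⟩ := ih
      obtain ⟨Y, hXEY, hY'YA⟩ := hT.comp t
      refine ⟨X, Y, hXEY, ?_, ?_⟩
      · rwa [List.filter_cons_of_neg (by simpa using hφ)]
      · rw [List.filter_cons_of_pos (by simpa using hφ)]
        exact .cons hY' hY'YA hA hA' fun p hp => hl p (List.mem_of_mem_filter hp)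

theorem append [IsTriangulated D] {l₁ l₂ : List (ℝ × D)} {X Y : D} (h₁ : HNChain P l₁ X)
    (h₂ : HNChain P l₂ Y) (t : DistTri X E Y) (hl : ∀ p ∈ l₁, ∀ q ∈ l₂, q.1 < p.1) :
    HNChain P (l₂ ++ l₁) E := by
  induction h₂ generalizing E with
  | nil h =>
    obtain ⟨e⟩ := t.nonempty_iso_left h
    exact h₁.of_iso e
  | cons _ t' hA hA' hl' ih =>
    obtain ⟨E', hE', hE''⟩ := t.pullback t'
    refine .cons (ih hE' fun p hp q hq => hl p hp q (List.mem_cons_of_mem _ hq)) hE'' hA hA' ?_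
    intro p hp
    rcases List.mem_append.1 hp with hp | hp
    · exact hl' p hp
    · exact hl p hp _ List.mem_cons_self

theorem exists_hnFiltration (h : HNChain P l E) :
    ∃ F : HNFiltration P E, ∀ i, (F.phase i, F.factor i) ∈ l := by
  induction h with
  | @nil E h =>
    exact ⟨⟨0, fun _ => E, Fin.elim0, Fin.elim0, fun i => i.elim0, fun i => i.elim0,
      fun i => i.elim0, h, Iso.refl _, fun i => i.elim0, fun i => i.elim0, fun i => i.elim0,
      fun i => i.elim0⟩, fun i => i.elim0⟩
  | @cons E' E A φ l _ t hA hA' hl ih =>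
    obtain ⟨F, hF⟩ := ih
    let obj : Fin (F.n + 2) → D := Fin.snoc F.obj E
    let factor : Fin (F.n + 1) → D := Fin.snoc F.factor A
    let phase : Fin (F.n + 1) → ℝ := Fin.snoc F.phase φ
    have htri : ∀ i : Fin (F.n + 1), DistTri (obj i.castSucc) (obj i.succ) (factor i) := by
      refine Fin.lastCases ?_ fun i => ?_
      · simpa [obj, factor] using t.of_iso F.top (Iso.refl _) (Iso.refl _)
      · simpa [obj, factor, ← Fin.castSucc_succ] using ⟨_, _, _, F.distinguished i⟩
    choose ι π δ hT using htri
    refine ⟨⟨F.n + 1, obj, factor, phase, ι, π, δ, ?_, eqToIso (Fin.snoc_last _ _), hT,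
      ?_, ?_, ?_⟩, ?_⟩
    · simpa [obj] using F.isZero_bot
    · exact Fin.lastCases (by simpa [phase, factor] using hA)
        fun i => by simpa [phase, factor] using F.factor_mem i
    · exact Fin.lastCases (by simpa [factor] using hA')
        fun i => by simpa [factor] using F.factor_ne_zero i
    · intro i j hij
      induction j using Fin.lastCases with
      | last =>
        obtain ⟨i, rfl⟩ := Fin.exists_castSucc_eq.2 hij.ne
        simpa [phase] using hl _ (hF i)
      | cast j =>
        obtain ⟨i, rfl⟩ := Fin.exists_castSucc_eq.2 (hij.trans (Fin.castSucc_lt_last j)).ne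
        simpa [phase] using F.phase_strictAnti (Fin.castSucc_lt_castSucc_iff.1 hij)
    · exact Fin.lastCases (by simp [phase, factor])
        fun i => by simpa [phase, factor] using Or.inr (hF i)

end HNChain

namespace HNFiltration

variable {E : D}

/-- The list of phases and factors of a Harder-Narasimhan filtration, the last factor first. -/
def list (F : HNFiltration P E) : List (ℝ × D) :=
  (List.ofFn fun i => (F.phase i, F.factor i)).reverse

theorem mem_list_iff (F : HNFiltration P E) (p : ℝ × D) :
    p ∈ F.list ↔ ∃ i, (F.phase i, F.factor i) = p := by
  simp [list, List.mem_ofFn]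

theorem hnChain_reverse_ofFn (n : ℕ) (obj : Fin (n + 1) → D) (factor : Fin n → D)
    (phase : Fin n → ℝ) (h0 : IsZero (obj 0))
    (ht : ∀ i : Fin n, DistTri (obj i.castSucc) (obj i.succ) (factor i))
    (hP : ∀ i, P (phase i) (factor i)) (hne : ∀ i, ¬ IsZero (factor i)) (hs : StrictAnti phase) :
    HNChain P (List.ofFn fun i => (phase i, factor i)).reverse (obj (Fin.last n)) := by
  induction n with
  | zero => simpa using .nil h0
  | succ n ih =>
    rw [List.ofFn_succ_last, List.reverse_append]
    refine .cons (ih (fun i => obj i.castSucc) (fun i => factor i.castSucc)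
      (fun i => phase i.castSucc) h0 (fun i => ht i.castSucc) (fun i => hP _) (fun i => hne _)
      (fun i j hij => hs hij)) (ht (Fin.last n)) (hP _) (hne _) ?_
    intro p hp
    obtain ⟨i, rfl⟩ := List.mem_ofFn.1 (List.mem_reverse.1 hp)
    exact hs (Fin.castSucc_lt_last i)

theorem hnChain (F : HNFiltration P E) : HNChain P F.list E :=
  (hnChain_reverse_ofFn F.n F.obj F.factor F.phase F.isZero_bot
    (fun i => ⟨_, _, _, F.distinguished i⟩) F.factor_mem F.factor_ne_zero
    F.phase_strictAnti).of_iso F.top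

end HNFiltration

end Chains

section Slicing

variable {D : Type u} [Category.{w} D] [HasZeroObject D] [HasShift D ℤ] [Preadditive D]
  [∀ n : ℤ, (shiftFunctor D n).Additive] [Pretriangulated D]
  {Λ : Type*} [AddCommGroup Λ] {v : K₀ D →+ Λ}

namespace PreStabilityCondition

/-- The subcategory `P((a, ∞))` of the objects all of whose Harder-Narasimhan phases are greater
than `a`, described by orthogonality: there are no maps to `P φ` for `φ ≤ a`. -/
def PhaseGT (σ : PreStabilityCondition v) (a : ℝ) (E : D) : Prop :=
  ∀ φ ≤ a, ∀ F, σ.P φ F → ∀ f : E ⟶ F, f = 0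

/-- The subcategory `P((-∞, a])` of the objects all of whose Harder-Narasimhan phases are at most
`a`, described by orthogonality: there are no maps from `P φ` for `φ > a`. -/
def PhaseLE (σ : PreStabilityCondition v) (a : ℝ) (E : D) : Prop :=
  ∀ φ, a < φ → ∀ F, σ.P φ F → ∀ f : F ⟶ E, f = 0

variable (σ : PreStabilityCondition v)

theorem exists_hnChain (E : D) : ∃ l, HNChain σ.P l E := ⟨_, (σ.hn E).hnChain⟩

variable {σ}

theorem PhaseGT.of_isZero {a : ℝ} {E : D} (h : IsZero E) : σ.PhaseGT a E :=
  fun _ _ _ _ f => h.eq_of_src f 0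

theorem PhaseLE.of_isZero {a : ℝ} {E : D} (h : IsZero E) : σ.PhaseLE a E :=
  fun _ _ _ _ f => h.eq_of_tgt f 0

theorem PhaseGT.anti {a b : ℝ} {E : D} (h : σ.PhaseGT a E) (hab : b ≤ a) : σ.PhaseGT b E :=
  fun φ hφ => h φ (hφ.trans hab)

theorem PhaseLE.mono {a b : ℝ} {E : D} (h : σ.PhaseLE a E) (hab : a ≤ b) : σ.PhaseLE b E :=
  fun φ hφ => h φ (hab.trans_lt hφ)

theorem PhaseGT.of_mem {a φ : ℝ} {E : D} (h : σ.P φ E) (hφ : a < φ) : σ.PhaseGT a E :=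
  fun _ hψ _ hF f => σ.hom_eq_zero (hψ.trans_lt hφ) h hF f

theorem PhaseLE.of_mem {a φ : ℝ} {E : D} (h : σ.P φ E) (hφ : φ ≤ a) : σ.PhaseLE a E :=
  fun _ hψ _ hF f => σ.hom_eq_zero (hφ.trans_lt hψ) hF h f

theorem PhaseGT.of_hom {a : ℝ} {E : D} (h : ∀ F, σ.PhaseLE a F → ∀ f : E ⟶ F, f = 0) :
    σ.PhaseGT a E :=
  fun _ hφ F hF f => h F (.of_mem hF hφ) f

theorem PhaseLE.of_hom {a : ℝ} {E : D} (h : ∀ F, σ.PhaseGT a F → ∀ f : F ⟶ E, f = 0) :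
    σ.PhaseLE a E :=
  fun _ hφ F hF f => h F (.of_mem hF hφ) f

theorem PhaseGT.ext {a : ℝ} {A E B : D} (t : DistTri A E B) (hA : σ.PhaseGT a A)
    (hB : σ.PhaseGT a B) : σ.PhaseGT a E :=
  fun φ hφ F hF => t.hom_from_mid_eq_zero (hA φ hφ F hF) (hB φ hφ F hF)

theorem PhaseLE.ext {a : ℝ} {A E B : D} (t : DistTri A E B) (hA : σ.PhaseLE a A)
    (hB : σ.PhaseLE a B) : σ.PhaseLE a E :=
  fun φ hφ F hF => t.hom_to_mid_eq_zero (hA φ hφ F hF) (hB φ hφ F hF)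

theorem PhaseGT.of_iso {a : ℝ} {E F : D} (h : σ.PhaseGT a E) (e : E ≅ F) : σ.PhaseGT a F :=
  PhaseGT.ext (DistTri.of_isZero_right e (isZero_zero D)) h (.of_isZero (isZero_zero D))

theorem PhaseLE.of_iso {a : ℝ} {E F : D} (h : σ.PhaseLE a E) (e : E ≅ F) : σ.PhaseLE a F :=
  PhaseLE.ext (DistTri.of_isZero_right e (isZero_zero D)) h (.of_isZero (isZero_zero D))

theorem PhaseGT.of_hnChain {a : ℝ} {E : D} {l : List (ℝ × D)} (h : HNChain σ.P l E)
    (hl : ∀ p ∈ l, a < p.1) : σ.PhaseGT a E :=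
  h.ext_induction _ (fun _ => .of_isZero) (fun _ _ _ => .ext)
    fun p hp => .of_mem (h.mem p hp) (hl p hp)

theorem PhaseLE.of_hnChain {a : ℝ} {E : D} {l : List (ℝ × D)} (h : HNChain σ.P l E)
    (hl : ∀ p ∈ l, p.1 ≤ a) : σ.PhaseLE a E :=
  h.ext_induction _ (fun _ => .of_isZero) (fun _ _ _ => .ext)
    fun p hp => .of_mem (h.mem p hp) (hl p hp)

theorem P_neg_shift {φ : ℝ} {E : D} (h : σ.P φ E) : σ.P (φ - 1) (E⟦(-1 : ℤ)⟧) := by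
  rw [← σ.shift_iff, sub_add_cancel]
  exact σ.iso_closed φ (shiftNegShift E (1 : ℤ)).symm h

theorem phaseGT_shift_iff {a : ℝ} {E : D} : σ.PhaseGT (a + 1) (E⟦(1 : ℤ)⟧) ↔ σ.PhaseGT a E := by
  constructor
  · intro h φ hφ F hF f
    have := h (φ + 1) (by linarith) _ ((σ.shift_iff φ F).2 hF) ((shiftFunctor D (1 : ℤ)).map f)
    exact (shiftFunctor D (1 : ℤ)).map_injective (by simpa using this)
  · intro h φ hφ F hF f
    have e := shiftNegShift F (1 : ℤ)
    obtain ⟨g, hg⟩ := (shiftFunctor D (1 : ℤ)).map_surjective (f ≫ e.inv)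
    rw [h (φ - 1) (by linarith) _ (P_neg_shift hF) g, Functor.map_zero] at hg
    rw [← cancel_mono e.inv, ← hg, zero_comp]

theorem phaseLE_shift_iff {a : ℝ} {E : D} : σ.PhaseLE (a + 1) (E⟦(1 : ℤ)⟧) ↔ σ.PhaseLE a E := by
  constructor
  · intro h φ hφ F hF f
    have := h (φ + 1) (by linarith) _ ((σ.shift_iff φ F).2 hF) ((shiftFunctor D (1 : ℤ)).map f)
    exact (shiftFunctor D (1 : ℤ)).map_injective (by simpa using this)
  · intro h φ hφ F hF f
    have e := shiftNegShift F (1 : ℤ)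
    obtain ⟨g, hg⟩ := (shiftFunctor D (1 : ℤ)).map_surjective (e.hom ≫ f)
    rw [h (φ - 1) (by linarith) _ (P_neg_shift hF) g, Functor.map_zero] at hg
    rw [← cancel_epi e.hom, ← hg, comp_zero]

theorem phaseGT_neg_shift {a : ℝ} {E : D} (h : σ.PhaseGT a E) :
    σ.PhaseGT (a - 1) (E⟦(-1 : ℤ)⟧) := by
  rw [← phaseGT_shift_iff, sub_add_cancel]
  exact h.of_iso (shiftNegShift E (1 : ℤ)).symm

theorem phaseLE_neg_shift {a : ℝ} {E : D} (h : σ.PhaseLE a E) :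
    σ.PhaseLE (a - 1) (E⟦(-1 : ℤ)⟧) := by
  rw [← phaseLE_shift_iff, sub_add_cancel]
  exact h.of_iso (shiftNegShift E (1 : ℤ)).symm

theorem PhaseLE.left {b : ℝ} {X E Y : D} (t : DistTri X E Y) (hE : σ.PhaseLE b E)
    (hY : σ.PhaseLE (b + 1) Y) : σ.PhaseLE b X :=
  PhaseLE.ext t.invRotate (by simpa using phaseLE_neg_shift hY) hE

theorem PhaseGT.right {a : ℝ} {X E Y : D} (t : DistTri X E Y) (hE : σ.PhaseGT a E)
    (hX : σ.PhaseGT (a - 1) X) : σ.PhaseGT a Y :=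
  PhaseGT.ext t.rotate hE (by simpa using phaseGT_shift_iff.2 hX)

variable [IsTriangulated D]

theorem exists_trunc_of_hnChain {E : D} {l : List (ℝ × D)} (hl : HNChain σ.P l E) (a : ℝ) :
    ∃ X Y, DistTri X E Y ∧ HNChain σ.P (l.filter fun p => a < p.1) X ∧
      HNChain σ.P (l.filter fun p => p.1 ≤ a) Y ∧ σ.PhaseGT a X ∧ σ.PhaseLE a Y := by
  obtain ⟨X, Y, t, hX, hY⟩ := hl.exists_distTri_filter a
  exact ⟨X, Y, t, hX, hY, .of_hnChain hX (by simp), .of_hnChain hY (by simp)⟩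

theorem exists_trunc (σ : PreStabilityCondition v) (a : ℝ) (E : D) :
    ∃ X Y, DistTri X E Y ∧ σ.PhaseGT a X ∧ σ.PhaseLE a Y := by
  obtain ⟨l, hl⟩ := σ.exists_hnChain E
  obtain ⟨X, Y, t, -, -, hX, hY⟩ := exists_trunc_of_hnChain hl a
  exact ⟨X, Y, t, hX, hY⟩

theorem PhaseGT.hom_eq_zero {a : ℝ} {E F : D} (hE : σ.PhaseGT a E) (hF : σ.PhaseLE a F)
    (f : E ⟶ F) : f = 0 := by
  obtain ⟨l, hl⟩ := σ.exists_hnChain F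
  obtain ⟨X, Y, hT, hX, hY⟩ := hl.exists_distTri_filter a
  have hEY : ∀ g : E ⟶ Y, g = 0 := by
    refine hY.ext_induction (fun Y => ∀ g : E ⟶ Y, g = 0) (fun _ hZ g => hZ.eq_of_tgt _ _)
      (fun _ _ _ t hA hC => t.hom_to_mid_eq_zero hA hC) fun p hp => ?_
    exact hE p.1 (by simpa using (List.mem_filter.1 hp).2) _ (hY.mem p hp)
  have hXF : ∀ g : X ⟶ F, g = 0 := by
    refine hX.ext_induction (fun X => ∀ g : X ⟶ F, g = 0) (fun _ hZ g => hZ.eq_of_src _ _)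
      (fun _ _ _ t hA hC => t.hom_from_mid_eq_zero hA hC) fun p hp => ?_
    exact hF p.1 (by simpa using (List.mem_filter.1 hp).2) _ (hX.mem p hp)
  obtain ⟨x, y, z, hT⟩ := hT
  obtain ⟨g, rfl⟩ := exists_lift hT f (hEY _)
  rw [hXF x, comp_zero]

theorem PhaseGT.isZero {a : ℝ} {E : D} (h : σ.PhaseGT a E) (h' : σ.PhaseLE a E) : IsZero E :=
  (IsZero.iff_id_eq_zero E).2 (h.hom_eq_zero h' _)

end PreStabilityCondition

theorem HNChain.eq_nil_of_isZero [IsTriangulated D] {σ : PreStabilityCondition v}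
    {l : List (ℝ × D)} {E : D} (h : HNChain σ.P l E) (hE : IsZero E) : l = [] := by
  cases h with
  | nil => rfl
  | @cons E' _ A φ _ h t hA hA' hl =>
    refine absurd ?_ hA'
    have hE' : σ.PhaseGT φ E' := .of_hnChain h hl
    exact (PreStabilityCondition.PhaseGT.right t (.of_isZero hE) (hE'.anti (by linarith))).isZero
      (.of_mem hA le_rfl)

theorem HNChain.phaseLE_iff [IsTriangulated D] {σ : PreStabilityCondition v}
    {l : List (ℝ × D)} {E : D} (h : HNChain σ.P l E) {b : ℝ} :
    σ.PhaseLE b E ↔ ∀ p ∈ l, p.1 ≤ b := by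
  refine ⟨fun hE p hp => ?_, .of_hnChain h⟩
  obtain ⟨X, Y, t, hX, hY⟩ := h.exists_distTri_filter b
  have hY' : σ.PhaseLE b Y := .of_hnChain hY (by simp)
  have hX' : σ.PhaseGT b X := .of_hnChain hX (by simp)
  have hnil := hX.eq_nil_of_isZero (hX'.isZero (.left t hE (hY'.mono (by linarith))))
  simpa using List.filter_eq_nil_iff.1 hnil p hp

theorem HNChain.phaseGT_iff [IsTriangulated D] {σ : PreStabilityCondition v}
    {l : List (ℝ × D)} {E : D} (h : HNChain σ.P l E) {a : ℝ} :
    σ.PhaseGT a E ↔ ∀ p ∈ l, a < p.1 := by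
  refine ⟨fun hE p hp => ?_, .of_hnChain h⟩
  obtain ⟨X, Y, t, hX, hY⟩ := h.exists_distTri_filter a
  have hY' : σ.PhaseLE a Y := .of_hnChain hY (by simp)
  have hX' : σ.PhaseGT a X := .of_hnChain hX (by simp)
  have hnil := hY.eq_nil_of_isZero
    (PreStabilityCondition.PhaseGT.isZero (.right t hE (hX'.anti (by linarith))) hY')
  simpa using List.filter_eq_nil_iff.1 hnil p hp

namespace PreStabilityCondition

theorem mass_eq_sum (σ : PreStabilityCondition v) (E : D) :
    σ.mass E = ((σ.hn E).list.map fun p => ‖σ.Z (cls v p.2)‖).sum := by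
  simp [mass, cls, HNFiltration.list, List.sum_reverse, List.sum_ofFn, List.map_ofFn,
    Function.comp_def]

variable [IsTriangulated D]

theorem phiPlus_le_iff (σ : PreStabilityCondition v) (E : {E : D // ¬ IsZero E}) (b : ℝ) :
    σ.phiPlus E ≤ b ↔ σ.PhaseLE b E.1 := by
  rw [(σ.hn E.1).hnChain.phaseLE_iff]
  constructor
  · intro h p hp
    obtain ⟨i, rfl⟩ := (HNFiltration.mem_list_iff _ _).1 hp
    exact ((σ.hn E.1).phase_strictAnti.antitone (Fin.mk_le_of_le_val (Nat.zero_le _))).trans h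
  · intro h
    exact h _ ((HNFiltration.mem_list_iff _ _).2 ⟨_, rfl⟩)

theorem lt_phiMinus_iff (σ : PreStabilityCondition v) (E : {E : D // ¬ IsZero E}) (a : ℝ) :
    a < σ.phiMinus E ↔ σ.PhaseGT a E.1 := by
  rw [(σ.hn E.1).hnChain.phaseGT_iff]
  constructor
  · intro h p hp
    obtain ⟨i, rfl⟩ := (HNFiltration.mem_list_iff _ _).1 hp
    exact h.trans_le ((σ.hn E.1).phase_strictAnti.antitone
      (Fin.le_def.2 (Nat.le_sub_one_of_lt i.2)))
  · intro h
    exact h _ ((HNFiltration.mem_list_iff _ _).2 ⟨_, rfl⟩)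

end PreStabilityCondition

end Slicing

section Rotation

open Real

/-- The imaginary part of `exp (-iπθ) * x`: the height of `x` above the line through the ray of
phase `θ`. -/
def imRot (θ : ℝ) : ℂ →ₗ[ℝ] ℝ :=
  cos (π * θ) • Complex.imLm - sin (π * θ) • Complex.reLm

/-- The real part of `exp (-iπθ) * x`: the coordinate of `x` along the ray of phase `θ`. -/
def reRot (θ : ℝ) : ℂ →ₗ[ℝ] ℝ :=
  cos (π * θ) • Complex.reLm + sin (π * θ) • Complex.imLm

theorem imRot_apply (θ : ℝ) (x : ℂ) : imRot θ x = cos (π * θ) * x.im - sin (π * θ) * x.re := by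
  simp [imRot]

theorem reRot_apply (θ : ℝ) (x : ℂ) : reRot θ x = cos (π * θ) * x.re + sin (π * θ) * x.im := by
  simp [reRot]

/-- `z` lies on the open ray `ℝ_{>0} exp (iπφ)` of phase `φ`. -/
def OnRay (φ : ℝ) (z : ℂ) : Prop :=
  ∃ r : ℝ, 0 < r ∧ z = r * Complex.exp (Complex.I * Real.pi * φ)

theorem I_mul_pi_mul (φ : ℝ) : Complex.I * π * φ = ((π * φ : ℝ) : ℂ) * Complex.I := by
  push_cast
  ring

theorem re_ray (r φ : ℝ) : ((r : ℂ) * Complex.exp (Complex.I * Real.pi * φ)).re =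
    r * cos (π * φ) := by
  rw [I_mul_pi_mul, Complex.re_ofReal_mul, Complex.exp_ofReal_mul_I_re]

theorem im_ray (r φ : ℝ) : ((r : ℂ) * Complex.exp (Complex.I * Real.pi * φ)).im =
    r * sin (π * φ) := by
  rw [I_mul_pi_mul, Complex.im_ofReal_mul, Complex.exp_ofReal_mul_I_im]

theorem norm_ray {r φ : ℝ} (hr : 0 ≤ r) :
    ‖(r : ℂ) * Complex.exp (Complex.I * Real.pi * φ)‖ = r := by
  rw [I_mul_pi_mul, norm_mul, Complex.norm_exp_ofReal_mul_I, Complex.norm_real, mul_one,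
    Real.norm_of_nonneg hr]

theorem reRot_sq_add_imRot_sq (θ : ℝ) (x : ℂ) : reRot θ x ^ 2 + imRot θ x ^ 2 = ‖x‖ ^ 2 := by
  rw [Complex.sq_norm, Complex.normSq_apply, reRot_apply, imRot_apply]
  linear_combination (x.re ^ 2 + x.im ^ 2) * Real.sin_sq_add_cos_sq (π * θ)

theorem abs_imRot_le (θ : ℝ) (x : ℂ) : |imRot θ x| ≤ ‖x‖ := by
  apply abs_le_of_sq_le_sq _ (norm_nonneg _)
  nlinarith [reRot_sq_add_imRot_sq θ x, sq_nonneg (reRot θ x)]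

theorem abs_reRot_le (θ : ℝ) (x : ℂ) : |reRot θ x| ≤ ‖x‖ := by
  apply abs_le_of_sq_le_sq _ (norm_nonneg _)
  nlinarith [reRot_sq_add_imRot_sq θ x, sq_nonneg (imRot θ x)]

theorem eq_zero_of_reRot_of_imRot {θ : ℝ} {x : ℂ} (h₁ : reRot θ x = 0) (h₂ : imRot θ x = 0) :
    x = 0 := by
  simpa [h₁, h₂] using (reRot_sq_add_imRot_sq θ x).symm

theorem OnRay.norm_pos {φ : ℝ} {z : ℂ} (h : OnRay φ z) : 0 < ‖z‖ := by
  obtain ⟨r, hr, rfl⟩ := h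
  rwa [norm_ray hr.le]

theorem OnRay.ne_zero {φ : ℝ} {z : ℂ} (h : OnRay φ z) : z ≠ 0 := norm_pos_iff.1 h.norm_pos

theorem OnRay.imRot_eq {φ : ℝ} {z : ℂ} (h : OnRay φ z) (θ : ℝ) :
    imRot θ z = ‖z‖ * sin (π * (φ - θ)) := by
  obtain ⟨r, hr, rfl⟩ := h
  rw [norm_ray hr.le, imRot_apply, re_ray, im_ray, mul_sub, Real.sin_sub]
  ring

theorem OnRay.reRot_eq {φ : ℝ} {z : ℂ} (h : OnRay φ z) (θ : ℝ) :
    reRot θ z = ‖z‖ * cos (π * (φ - θ)) := by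
  obtain ⟨r, hr, rfl⟩ := h
  rw [norm_ray hr.le, reRot_apply, re_ray, im_ray, mul_sub, Real.cos_sub]
  ring

theorem onRay_iff {φ : ℝ} {z : ℂ} :
    OnRay φ z ↔ 0 < reRot φ z ∧ imRot φ z = 0 := by
  constructor
  · intro h
    rw [h.reRot_eq, h.imRot_eq]
    simpa using h.ne_zero
  · rintro ⟨hre, him⟩
    rw [imRot_apply] at him
    refine ⟨_, hre, Complex.ext ?_ ?_⟩
    · rw [re_ray, reRot_apply]
      linear_combination (-z.re) * Real.sin_sq_add_cos_sq (π * φ) - sin (π * φ) * him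
    · rw [im_ray, reRot_apply]
      linear_combination (-z.im) * Real.sin_sq_add_cos_sq (π * φ) + cos (π * φ) * him

theorem imRot_add_one (θ : ℝ) (x : ℂ) : imRot (θ + 1) x = -imRot θ x := by
  simp only [imRot_apply, mul_add, mul_one, Real.cos_add_pi, Real.sin_add_pi]
  ring

theorem reRot_add_one (θ : ℝ) (x : ℂ) : reRot (θ + 1) x = -reRot θ x := by
  simp only [reRot_apply, mul_add, mul_one, Real.cos_add_pi, Real.sin_add_pi]
  ring

theorem onRay_neg_iff {φ : ℝ} {z : ℂ} : OnRay (φ + 1) (-z) ↔ OnRay φ z := by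
  simp only [onRay_iff, reRot_add_one, imRot_add_one, map_neg, neg_neg]

theorem OnRay.neg {φ : ℝ} {z : ℂ} (h : OnRay φ z) : OnRay (φ + 1) (-z) :=
  onRay_neg_iff.2 h

theorem OnRay.imRot_nonneg {φ θ : ℝ} {z : ℂ} (h : OnRay φ z) (h1 : θ ≤ φ) (h2 : φ ≤ θ + 1) :
    0 ≤ imRot θ z := by
  rw [h.imRot_eq]
  have hπ := Real.pi_pos
  exact mul_nonneg (norm_nonneg _)
    (Real.sin_nonneg_of_nonneg_of_le_pi (by nlinarith) (by nlinarith))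

theorem OnRay.imRot_pos {φ θ : ℝ} {z : ℂ} (h : OnRay φ z) (h1 : θ < φ) (h2 : φ < θ + 1) :
    0 < imRot θ z := by
  rw [h.imRot_eq]
  have hπ := Real.pi_pos
  exact mul_pos h.norm_pos (Real.sin_pos_of_pos_of_lt_pi (by nlinarith) (by nlinarith))

theorem OnRay.imRot_neg {φ θ : ℝ} {z : ℂ} (h : OnRay φ z) (h1 : θ - 1 < φ) (h2 : φ < θ) :
    imRot θ z < 0 := by
  have := h.neg.imRot_pos (θ := θ) (by linarith) (by linarith)
  rw [map_neg] at this
  linarith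

end Rotation

section MassIntegral

open Real MeasureTheory intervalIntegral

/-- For the charges `p.2` of Harder-Narasimhan factors of phases `p.1`, the height above the line
of phase `θ` of the part of phase greater than `θ`. It is the support function of the
Harder-Narasimhan polygon, so that its integral over `θ` computes the length of the polygon. -/
def height (l : List (ℝ × ℂ)) (θ : ℝ) : ℝ :=
  (l.map fun p => if θ < p.1 then imRot θ p.2 else 0).sum

theorem integral_mul_sin_pi_mul_sub (r β φ : ℝ) :
    ∫ θ in β..φ, r * sin (π * (φ - θ)) = r * (1 - cos (π * (φ - β))) / π := by
  have hderiv : ∀ θ ∈ Set.uIcc β φ, HasDerivAt (fun θ => r * cos (π * (φ - θ)) / π)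
      (r * sin (π * (φ - θ))) θ := by
    intro θ _
    have hlin : HasDerivAt (fun θ => π * (φ - θ)) (π * (-1)) θ :=
      ((hasDerivAt_id θ).const_sub φ).const_mul π
    convert! ((hlin.cos.const_mul r).div_const π) using 1
    field_simp
  rw [integral_eq_sub_of_hasDerivAt hderiv (Continuous.intervalIntegrable (by fun_prop) _ _),
    sub_self, mul_zero, cos_zero]
  ring

theorem OnRay.integral_height_single {β φ : ℝ} {z : ℂ} (h : OnRay φ z) (hβ : β < φ)
    (hφ : φ ≤ β + 1) :
    IntervalIntegrable (fun θ => if θ < φ then imRot θ z else 0) volume β (β + 1) ∧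
    π * ∫ θ in β..(β + 1), (if θ < φ then imRot θ z else 0) = ‖z‖ - reRot β z := by
  have eqOn_left : Set.EqOn (fun θ => if θ < φ then imRot θ z else 0)
      (fun θ => ‖z‖ * sin (π * (φ - θ))) (Set.uIcc β φ) := by
    intro θ hθ
    rw [Set.uIcc_of_le hβ.le] at hθ
    rcases hθ.2.lt_or_eq with hlt | rfl
    · simpa only [if_pos hlt] using h.imRot_eq θ
    · simp
  have eqOn_right : Set.EqOn (fun θ => if θ < φ then imRot θ z else 0)
      (fun _ => (0 : ℝ)) (Set.uIcc φ (β + 1)) := by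
    intro θ hθ
    rw [Set.uIcc_of_le hφ] at hθ
    exact if_neg hθ.1.not_gt
  have int_left : IntervalIntegrable (fun θ => if θ < φ then imRot θ z else 0) volume β φ :=
    .congr (fun θ hθ => (eqOn_left (Set.uIoc_subset_uIcc hθ)).symm)
      (Continuous.intervalIntegrable (by fun_prop) _ _)
  have int_right : IntervalIntegrable (fun θ => if θ < φ then imRot θ z else 0) volume φ (β + 1) :=
    .congr (fun θ hθ => (eqOn_right (Set.uIoc_subset_uIcc hθ)).symm) intervalIntegrable_const
  refine ⟨int_left.trans int_right, ?_⟩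
  rw [← integral_add_adjacent_intervals int_left int_right, integral_congr eqOn_left,
    integral_congr eqOn_right, integral_mul_sin_pi_mul_sub, h.reRot_eq,
    intervalIntegral.integral_zero, add_zero]
  field_simp

theorem integral_height {β : ℝ} (l : List (ℝ × ℂ)) (hray : ∀ p ∈ l, OnRay p.1 p.2)
    (hphase : ∀ p ∈ l, β < p.1 ∧ p.1 ≤ β + 1) :
    IntervalIntegrable (height l) volume β (β + 1) ∧
    π * ∫ θ in β..(β + 1), height l θ =
      (l.map fun p => ‖p.2‖).sum - reRot β (l.map fun p => p.2).sum := by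
  induction l with
  | nil =>
    have : height [] = fun _ => 0 := by ext; simp [height]
    simp [this]
  | cons p l ih =>
    simp only [List.mem_cons, forall_eq_or_imp] at hray hphase
    obtain ⟨int_p, eq_p⟩ := hray.1.integral_height_single hphase.1.1 hphase.1.2
    obtain ⟨int_l, eq_l⟩ := ih hray.2 hphase.2
    have hcons : height (p :: l) = fun θ => (if θ < p.1 then imRot θ p.2 else 0) + height l θ := by
      ext; simp [height]
    rw [hcons]
    refine ⟨int_p.add int_l, ?_⟩
    rw [integral_add int_p int_l, mul_add, eq_p, eq_l, List.map_cons, List.map_cons,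
      List.sum_cons, List.sum_cons, map_add]
    ring

theorem sum_norm_sub_reRot_le {β ε : ℝ} {l₁ l₂ : List (ℝ × ℂ)}
    (hray₁ : ∀ p ∈ l₁, OnRay p.1 p.2) (hphase₁ : ∀ p ∈ l₁, β < p.1 ∧ p.1 ≤ β + 1)
    (hray₂ : ∀ p ∈ l₂, OnRay p.1 p.2) (hphase₂ : ∀ p ∈ l₂, β < p.1 ∧ p.1 ≤ β + 1)
    (h : ∀ θ, β ≤ θ → θ ≤ β + 1 → height l₂ θ ≤ height l₁ θ + ε) :
    (l₂.map fun p => ‖p.2‖).sum - reRot β (l₂.map fun p => p.2).sum ≤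
      (l₁.map fun p => ‖p.2‖).sum - reRot β (l₁.map fun p => p.2).sum + π * ε := by
  obtain ⟨int₁, eq₁⟩ := integral_height l₁ hray₁ hphase₁
  obtain ⟨int₂, eq₂⟩ := integral_height l₂ hray₂ hphase₂
  have hmono := integral_mono_on (by linarith : β ≤ β + 1) int₂ (int₁.add intervalIntegrable_const)
    (fun θ hθ => h θ hθ.1 hθ.2)
  rw [integral_add int₁ intervalIntegrable_const, intervalIntegral.integral_const,
    add_sub_cancel_left, one_smul] at hmono
  rw [← eq₁, ← eq₂, ← mul_add]
  exact mul_le_mul_of_nonneg_left hmono Real.pi_pos.le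

end MassIntegral

section Heart

variable {D : Type u} [Category.{w} D] [HasZeroObject D] [HasShift D ℤ] [Preadditive D]
  [∀ n : ℤ, (shiftFunctor D n).Additive] [Pretriangulated D]
  {Λ : Type*} [AddCommGroup Λ] {v : K₀ D →+ Λ}

namespace PreStabilityCondition

variable {σ : PreStabilityCondition v}

theorem onRay {φ : ℝ} {E : D} (h : σ.P φ E) (hE : ¬ IsZero E) : OnRay φ (σ.Z (cls v E)) :=
  σ.charge_mem_ray h hE

theorem onRay_of_hnChain {E : D} {l : List (ℝ × D)} (h : HNChain σ.P l E) :
    ∀ p ∈ l, OnRay p.1 (σ.Z (cls v p.2)) :=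
  fun p hp => onRay (h.mem p hp) (h.ne_zero p hp)

section Triangulated

variable [IsTriangulated D]

theorem imRot_nonneg {θ : ℝ} {E : D} (hgt : σ.PhaseGT θ E) (hle : σ.PhaseLE (θ + 1) E) :
    0 ≤ imRot θ (σ.Z (cls v E)) := by
  obtain ⟨l, hl⟩ := σ.exists_hnChain E
  rw [hl.map_cls_eq_sum, ← List.sum_map_hom]
  refine List.sum_nonneg (List.forall_mem_map.2 fun p hp => ?_)
  exact (onRay_of_hnChain hl p hp).imRot_nonneg (hl.phaseGT_iff.1 hgt p hp).le
    (hl.phaseLE_iff.1 hle p hp)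

theorem imRot_nonpos {θ : ℝ} {E : D} (hgt : σ.PhaseGT (θ - 1) E) (hle : σ.PhaseLE θ E) :
    imRot θ (σ.Z (cls v E)) ≤ 0 := by
  have hrot := imRot_add_one (θ - 1) (σ.Z (cls v E))
  rw [sub_add_cancel] at hrot
  rw [hrot, neg_nonpos]
  exact imRot_nonneg hgt (by simpa using hle)

theorem imRot_le_of_phaseGT {β θ : ℝ} {X E X' T Y : D} (tX : DistTri X E X')
    (hX : σ.PhaseGT θ X) (hX' : σ.PhaseLE (β + 1) X') (hβ : β ≤ θ) (hθ : θ ≤ β + 1)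
    (tT : DistTri T E Y) (hT : σ.PhaseGT θ T) (hY : σ.PhaseLE θ Y) :
    imRot θ (σ.Z (cls v X)) ≤ imRot θ (σ.Z (cls v T)) := by
  obtain ⟨f, f', f'', hf⟩ := tX
  obtain ⟨t, t', t'', ht⟩ := tT
  obtain ⟨g, hg⟩ := exists_lift ht f (hX.hom_eq_zero hY _)
  obtain ⟨R, hR, hR'⟩ := exists_distTri_of_comp_eq hf ht g hg
  have hRgt : σ.PhaseGT θ R := .right hR hT (hX.anti (by linarith))
  have hRle : σ.PhaseLE (β + 1) R := .left hR' hX' (hY.mono (by linarith))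
  rw [cls_distTri hR, map_add, map_add, le_add_iff_nonneg_right]
  exact imRot_nonneg hRgt (hRle.mono (by linarith))

/- The part of `X` of phase at most `θ` only lowers the height, and the remaining part maps to
`T`. -/
theorem imRot_le_of_distTri {β θ : ℝ} {X E X' T Y : D} (tX : DistTri X E X') (hX : σ.PhaseGT β X)
    (hX' : σ.PhaseLE (β + 1) X') (hβ : β ≤ θ) (hθ : θ ≤ β + 1) (tT : DistTri T E Y)
    (hT : σ.PhaseGT θ T) (hY : σ.PhaseLE θ Y) :
    imRot θ (σ.Z (cls v X)) ≤ imRot θ (σ.Z (cls v T)) := by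
  obtain ⟨A, B, tAB, hA, hB⟩ := σ.exists_trunc θ X
  obtain ⟨X'', tA, tX''⟩ := tAB.comp tX
  have hB' : σ.PhaseGT (θ - 1) B := .right tAB (hX.anti (by linarith)) (hA.anti (by linarith))
  have hAT := imRot_le_of_phaseGT tA hA (.ext tX'' (hB.mono hθ) hX') hβ hθ tT hT hY
  rw [cls_distTri tAB, map_add, map_add]
  linarith [imRot_nonpos hB' hB]

end Triangulated

/-- The heart `P((β, β + 1])` of the t-structure with aisle `P((β, ∞))`. -/
def Heart (σ : PreStabilityCondition v) (β : ℝ) (E : D) : Prop :=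
  σ.PhaseGT β E ∧ σ.PhaseLE (β + 1) E

theorem Heart.of_isZero {β : ℝ} {E : D} (h : IsZero E) : σ.Heart β E :=
  ⟨.of_isZero h, .of_isZero h⟩

theorem Heart.of_iso {β : ℝ} {E F : D} (h : σ.Heart β E) (e : E ≅ F) : σ.Heart β F :=
  ⟨h.1.of_iso e, h.2.of_iso e⟩

theorem Heart.ext {β : ℝ} {A E B : D} (t : DistTri A E B) (hA : σ.Heart β A) (hB : σ.Heart β B) :
    σ.Heart β E :=
  ⟨.ext t hA.1 hB.1, .ext t hA.2 hB.2⟩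

theorem Heart.exists_image [IsTriangulated D] {β : ℝ} {E F : D} (hE : σ.Heart β E)
    (hF : σ.Heart β F) (f : E ⟶ F) :
    ∃ K I C, σ.Heart β K ∧ σ.Heart β I ∧ σ.Heart β C ∧ DistTri K E I ∧ DistTri I F C ∧
      (IsZero I → f = 0) := by
  obtain ⟨C₀, c, c', hc⟩ := distinguished_cocone_triangle f
  have tC₀ : DistTri E F C₀ := ⟨_, _, _, hc⟩
  have hC₀gt : σ.PhaseGT β C₀ := .right tC₀ hF.1 (hE.1.anti (by linarith))
  have hC₀le : σ.PhaseLE (β + 1 + 1) C₀ :=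
    .ext tC₀.rotate (hF.2.mono (by linarith)) (phaseLE_shift_iff.2 hE.2)
  -- In the heart, the kernel of `f` is the shift of `U`, and `C` is the cokernel.
  obtain ⟨U, C, ⟨u, d, e, hU⟩, hUgt, hCle⟩ := σ.exists_trunc (β + 1) C₀
  have tU : DistTri U C₀ C := ⟨_, _, _, hU⟩
  have hUle : σ.PhaseLE (β + 1 + 1) U := .left tU hC₀le (hCle.mono (by linarith))
  have hCgt : σ.PhaseGT β C := .right tU hC₀gt (hUgt.anti (by linarith))
  obtain ⟨I, i, j, tI, hI⟩ := exists_distTri_fiber_comp hc hU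
  refine ⟨U⟦(-1 : ℤ)⟧, I, C,
    ⟨by simpa using phaseGT_neg_shift hUgt, by simpa using phaseLE_neg_shift hUle⟩,
    ⟨.ext tI hE.1 (hUgt.anti (by linarith)), .left ⟨_, _, _, hI⟩ hF.2 (hCle.mono (by linarith))⟩,
    ⟨hCgt, hCle⟩, tI.invRotate, ⟨_, _, _, hI⟩, fun hI0 => ?_⟩
  have : IsIso (c ≫ d) := (Triangle.isZero₁_iff_isIso₂ _ hI).1 hI0
  have hfc : f ≫ c = 0 := comp_distTriang_mor_zero₁₂ _ hc
  rw [← cancel_mono (c ≫ d), zero_comp, ← Category.assoc, hfc, zero_comp]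

end PreStabilityCondition

end Heart

section UpperHalfPlane

open Real

/-- `z` lies in the semi-closed upper half plane: the open upper half plane together with the
negative real axis. Its points are those with argument in `(0, π]`. -/
def Upper (z : ℂ) : Prop := 0 < z.im ∨ (z.im = 0 ∧ z.re < 0)

/-- The signed area of the parallelogram spanned by `x` and `y`. Its sign compares the phases of
`x` and `y` without reference to a branch of the argument. -/
def cross (x y : ℂ) : ℝ := x.re * y.im - x.im * y.re

@[simp] theorem cross_self (x : ℂ) : cross x x = 0 := by simp [cross, mul_comm]

@[simp] theorem cross_zero_left (x : ℂ) : cross 0 x = 0 := by simp [cross]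

@[simp] theorem cross_zero_right (x : ℂ) : cross x 0 = 0 := by simp [cross]

theorem cross_add_left (x y z : ℂ) : cross (x + y) z = cross x z + cross y z := by
  simp [cross]; ring

theorem cross_add_right (x y z : ℂ) : cross x (y + z) = cross x y + cross x z := by
  simp [cross]; ring

theorem cross_swap (x y : ℂ) : cross x y = -cross y x := by
  simp [cross]; ring

theorem Upper.ne_zero {z : ℂ} (h : Upper z) : z ≠ 0 := by
  rintro rfl
  simp [Upper] at h

theorem Upper.im_nonneg {z : ℂ} (h : Upper z) : 0 ≤ z.im := by
  rcases h with h | h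
  · exact h.le
  · exact h.1.ge

theorem Upper.add {x y : ℂ} (hx : Upper x) (hy : Upper y) : Upper (x + y) := by
  rcases hx with hx | hx <;> rcases hy with hy | hy
  · left; simp; linarith
  · left; simp; linarith
  · left; simp; linarith
  · right; simp; constructor <;> linarith

theorem Upper.arg_pos {z : ℂ} (h : Upper z) : 0 < z.arg := by
  refine lt_of_le_of_ne (Complex.arg_nonneg_iff.2 h.im_nonneg) fun harg => ?_
  obtain ⟨hre, him⟩ := Complex.arg_eq_zero_iff.1 harg.symm
  rcases h with h | h
  · exact h.ne' him
  · exact h.2.not_ge hre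

theorem cross_eq (x y : ℂ) : cross x y = ‖x‖ * ‖y‖ * sin (y.arg - x.arg) := by
  rw [Real.sin_sub, show ‖x‖ * ‖y‖ * (sin y.arg * cos x.arg - cos y.arg * sin x.arg) =
    ‖x‖ * cos x.arg * (‖y‖ * sin y.arg) - ‖x‖ * sin x.arg * (‖y‖ * cos y.arg) by ring]
  simp only [Complex.norm_mul_cos_arg, Complex.norm_mul_sin_arg, cross]

theorem Upper.cross_pos_iff {x y : ℂ} (hx : Upper x) (hy : Upper y) :
    0 < cross x y ↔ x.arg < y.arg := by
  have hnorm : 0 < ‖x‖ * ‖y‖ := mul_pos (norm_pos_iff.2 hx.ne_zero) (norm_pos_iff.2 hy.ne_zero)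
  rw [cross_eq, mul_pos_iff_of_pos_left hnorm]
  constructor
  · intro h
    by_contra! hlt
    exact h.not_ge (Real.sin_nonpos_of_nonpos_of_neg_pi_le (by linarith)
      (by linarith [hy.arg_pos, Complex.arg_le_pi x]))
  · intro h
    exact Real.sin_pos_of_pos_of_lt_pi (by linarith) (by linarith [hx.arg_pos, Complex.arg_le_pi y])

theorem Upper.cross_nonneg_iff {x y : ℂ} (hx : Upper x) (hy : Upper y) :
    0 ≤ cross x y ↔ x.arg ≤ y.arg := by
  rw [← not_lt, ← not_lt, ← hy.cross_pos_iff hx, cross_swap]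
  simp

theorem Upper.onRay {z : ℂ} (h : Upper z) : OnRay (z.arg / π) z := by
  refine ⟨‖z‖, norm_pos_iff.2 h.ne_zero, ?_⟩
  have hpi : (π : ℂ) ≠ 0 := Complex.ofReal_ne_zero.2 Real.pi_ne_zero
  conv_lhs => rw [← Complex.norm_mul_exp_arg_mul_I z]
  congr 2
  push_cast
  field_simp

theorem Upper.exists_smul {x y : ℂ} (hx : Upper x) (hy : Upper y) (h : cross x y = 0) :
    ∃ t : ℝ, 0 < t ∧ y = t * x := by
  have harg : x.arg = y.arg := le_antisymm ((hx.cross_nonneg_iff hy).1 h.ge)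
    ((hy.cross_nonneg_iff hx).1 (by rw [cross_swap, h, neg_zero]))
  refine ⟨‖y‖ / ‖x‖, div_pos (norm_pos_iff.2 hy.ne_zero) (norm_pos_iff.2 hx.ne_zero), ?_⟩
  push_cast
  exact ((Complex.arg_eq_arg_iff hx.ne_zero hy.ne_zero).1 harg).symm

theorem Upper.re_le_of_cross_nonneg {x y : ℂ} (hx : Upper x) (h : 0 ≤ cross y x)
    (him : x.im ≤ y.im) {R : ℝ} (hR : 0 ≤ R) (hyR : y.re ≤ R) : x.re ≤ R := by
  by_contra! hlt
  have : 0 < x.re := by linarith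
  have hxim : 0 < x.im := by
    rcases hx with hx | hx
    · exact hx
    · linarith [hx.2]
  unfold cross at h
  nlinarith

end UpperHalfPlane

section AbstractHeart

variable {D : Type u} [Category.{w} D] [HasZeroObject D] [HasShift D ℤ] [Preadditive D]
  [∀ n : ℤ, (shiftFunctor D n).Additive] [Pretriangulated D]
  {Λ : Type*} [AddCommGroup Λ] {v : K₀ D →+ Λ}

/-- `S` is a subobject of `E` with quotient `T` in the extension-closed subcategory `A`. When `A` is
the heart of a t-structure, these are the short exact sequences of the abelian category `A`. -/
structure IsSub (A : D → Prop) (S E T : D) : Prop where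
  tri : DistTri S E T
  left : A S
  right : A T

/-- Slope semistability in `A` with respect to the central charge `w`: no subobject has larger phase
than `E`, which is expressed by the sign of `cross`. -/
def SlopeSemistable (v : K₀ D →+ Λ) (A : D → Prop) (w : Λ → ℂ) (E : D) : Prop :=
  A E ∧ ∀ S T, IsSub A S E T → 0 ≤ cross (w (cls v S)) (w (cls v E))

/-- The classes of subobjects of `E` whose central charge has real part at most `R`. Finiteness of
these sets replaces the chain conditions in the construction of Harder-Narasimhan filtrations. -/
def subClasses (v : K₀ D →+ Λ) (A : D → Prop) (w : Λ → ℂ) (E : D) (R : ℝ) : Set Λ :=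
  {x | ∃ S T, IsSub A S E T ∧ cls v S = x ∧ (w x).re ≤ R}

/-- `w` is a stability function on the extension-closed subcategory `A`: the charges of nonzero
objects of `A` lie in the semi-closed upper half plane. -/
structure IsStabilityFunction (v : K₀ D →+ Λ) (A : D → Prop) (w : Λ →+ ℂ) : Prop where
  of_isZero : ∀ {X}, IsZero X → A X
  ext : ∀ {X Y Z}, DistTri X Y Z → A X → A Z → A Y
  upper : ∀ {E}, A E → ¬ IsZero E → Upper (w (cls v E))

/-- `S` is a maximal destabilizing subobject of `E`: its charge has the largest argument among all
nonzero subobjects, and the largest norm among those with the same argument. -/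
structure IsMaximalDestabilizing (v : K₀ D →+ Λ) (A : D → Prop) (w : Λ →+ ℂ) (S E T : D) :
    Prop where
  isSub : IsSub A S E T
  ne_zero : ¬ IsZero S
  arg_le : ∀ {S' T'}, IsSub A S' E T' → ¬ IsZero S' → (w (cls v S')).arg ≤ (w (cls v S)).arg
  norm_le : ∀ {S' T'}, IsSub A S' E T' → ¬ IsZero S' → (w (cls v S')).arg = (w (cls v S)).arg →
    ‖w (cls v S')‖ ≤ ‖w (cls v S)‖

variable {A : D → Prop} {w : Λ →+ ℂ}

namespace IsStabilityFunction

variable {S E T : D}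

theorem isSub_self (h : IsStabilityFunction v A w) (hE : A E) : IsSub A E E 0 :=
  ⟨.of_isZero_right (Iso.refl _) (isZero_zero D), hE, h.of_isZero (isZero_zero D)⟩

theorem isSub_zero (h : IsStabilityFunction v A w) (hE : A E) : IsSub A 0 E E :=
  ⟨.of_isZero_left (Iso.refl _) (isZero_zero D), h.of_isZero (isZero_zero D), hE⟩

theorem im_le (h : IsStabilityFunction v A w) (hS : IsSub A S E T) :
    (w (cls v S)).im ≤ (w (cls v E)).im := by
  rw [cls_distTri hS.tri, map_add, Complex.add_im, le_add_iff_nonneg_right]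
  by_cases hT : IsZero T
  · simp [cls_isZero hT]
  · exact (h.upper hS.right hT).im_nonneg

theorem exists_isMaximalDestabilizing (h : IsStabilityFunction v A w) {R : ℝ} (hE : A E)
    (hE0 : ¬ IsZero E) (hR : 0 ≤ R) (hER : (w (cls v E)).re ≤ R)
    (hfin : (subClasses v A w E R).Finite) :
    ∃ S T, IsMaximalDestabilizing v A w S E T ∧ (w (cls v S)).re ≤ R := by
  let M : Set Λ := {x | ∃ S T, IsSub A S E T ∧ ¬ IsZero S ∧ cls v S = x ∧ (w x).re ≤ R}
  have hMfin : M.Finite := hfin.subset fun x ⟨S, T, hS, _, hx, hxR⟩ => ⟨S, T, hS, hx, hxR⟩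
  have hEM : cls v E ∈ M := ⟨E, 0, h.isSub_self hE, hE0, rfl, hER⟩
  obtain ⟨x, ⟨S, T, hS, hS0, rfl, hSR⟩, hmax⟩ :=
    Set.exists_max_image M (fun x => toLex ((w x).arg, ‖w x‖)) hMfin ⟨_, hEM⟩
  simp only [Prod.Lex.toLex_le_toLex] at hmax
  have harg_le : ∀ x ∈ M, (w x).arg ≤ (w (cls v S)).arg := fun x hx =>
    (hmax x hx).elim le_of_lt fun hle => hle.1.le
  -- A subobject of larger phase than `E` satisfies the bound on the real part.
  have hmem : ∀ {S' T'}, IsSub A S' E T' → ¬ IsZero S' →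
      (w (cls v S)).arg ≤ (w (cls v S')).arg → cls v S' ∈ M := fun hS' hS'0 harg =>
    ⟨_, _, hS', hS'0, rfl, (h.upper hS'.left hS'0).re_le_of_cross_nonneg
      (((h.upper hE hE0).cross_nonneg_iff (h.upper hS'.left hS'0)).2
        ((harg_le _ hEM).trans harg)) (h.im_le hS') hR hER⟩
  refine ⟨S, T, ⟨hS, hS0, fun hS' hS'0 => ?_, fun hS' hS'0 harg => ?_⟩, hSR⟩
  · by_contra! hlt
    exact hlt.not_ge (harg_le _ (hmem hS' hS'0 hlt.le))
  · rcases hmax _ (hmem hS' hS'0 harg.ge) with hlt | hle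
    · exact absurd harg hlt.ne
    · exact hle.2

variable [IsTriangulated D]

theorem exists_isSub_add (h : IsStabilityFunction v A w) {B C : D} (hS : IsSub A S E T)
    (hS0 : ¬ IsZero S) (hB : IsSub A B T C) :
    ∃ E', IsSub A E' E C ∧ ¬ IsZero E' ∧ cls v E' = cls v S + cls v B := by
  obtain ⟨E', tE, tE'⟩ := hS.tri.pullback hB.tri
  have hcls : cls v E' = cls v S + cls v B := cls_distTri tE
  refine ⟨E', ⟨tE', h.ext tE hS.left hB.left, hB.right⟩, fun hE' => ?_, hcls⟩
  have hsum : w (cls v S) + w (cls v B) = 0 := by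
    rw [← map_add, ← hcls, cls_isZero hE', map_zero]
  by_cases hB0 : IsZero B
  · rw [cls_isZero hB0, map_zero, add_zero] at hsum
    exact (h.upper hS.left hS0).ne_zero hsum
  · exact ((h.upper hS.left hS0).add (h.upper hB.left hB0)).ne_zero hsum

/- Adding the class of `S` maps the classes for `T` into those for `E`, and misses the class `0` of
the zero subobject. -/
theorem ncard_subClasses_lt (h : IsStabilityFunction v A w) {R : ℝ} (hE : A E) (hR : 0 ≤ R)
    (hfin : (subClasses v A w E R).Finite) (hS : IsSub A S E T) (hS0 : ¬ IsZero S) :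
    (subClasses v A w T (R - (w (cls v S)).re)).ncard < (subClasses v A w E R).ncard := by
  rw [← Set.ncard_image_of_injective _ (add_right_injective (cls v S))]
  refine Set.ncard_lt_ncard (Set.ssubset_iff_of_subset ?_ |>.2 ?_) hfin
  · rintro _ ⟨_, ⟨B, C, hB, rfl, hre⟩, rfl⟩
    obtain ⟨E', hE', -, hcls⟩ := h.exists_isSub_add hS hS0 hB
    refine ⟨E', C, hE', hcls, ?_⟩
    rw [map_add, Complex.add_re]
    linarith
  · refine ⟨0, ⟨0, E, h.isSub_zero hE, cls_isZero (isZero_zero D), by simpa using hR⟩, ?_⟩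
    rintro ⟨_, ⟨B, C, hB, rfl, -⟩, hzero⟩
    obtain ⟨E', hE', hE'0, hcls⟩ := h.exists_isSub_add hS hS0 hB
    refine (h.upper hE'.left hE'0).ne_zero ?_
    rw [hcls, ← map_zero w]
    exact congrArg w hzero

end IsStabilityFunction

namespace IsMaximalDestabilizing

variable [IsTriangulated D] {S E T : D}

theorem slopeSemistable (hS : IsMaximalDestabilizing v A w S E T)
    (h : IsStabilityFunction v A w) : SlopeSemistable v A w S := by
  refine ⟨hS.isSub.left, fun S' T' hS' => ?_⟩
  by_cases hS'0 : IsZero S'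
  · simp [cls_isZero hS'0]
  · obtain ⟨X, tX, tX'⟩ := hS'.tri.comp hS.isSub.tri
    exact ((h.upper hS'.left hS'0).cross_nonneg_iff (h.upper hS.isSub.left hS.ne_zero)).2
      (hS.arg_le ⟨tX, hS'.left, h.ext tX' hS'.right hS.isSub.right⟩ hS'0)

theorem arg_lt (hS : IsMaximalDestabilizing v A w S E T) (h : IsStabilityFunction v A w)
    {B C : D} (hB : IsSub A B T C) (hB0 : ¬ IsZero B) :
    (w (cls v B)).arg < (w (cls v S)).arg := by
  by_contra! hge
  obtain ⟨E', hE', hE'0, hcls⟩ := h.exists_isSub_add hS.isSub hS.ne_zero hB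
  have upper_S := h.upper hS.isSub.left hS.ne_zero
  have upper_B := h.upper hB.left hB0
  have upper_E' := h.upper hE'.left hE'0
  have hcross : cross (w (cls v S)) (w (cls v E')) = cross (w (cls v S)) (w (cls v B)) := by
    rw [hcls, map_add, cross_add_right, cross_self, zero_add]
  have harg : (w (cls v E')).arg = (w (cls v S)).arg :=
    le_antisymm (hS.arg_le hE' hE'0) ((upper_S.cross_nonneg_iff upper_E').1
      (hcross ▸ (upper_S.cross_nonneg_iff upper_B).2 hge))
  have hcross0 : cross (w (cls v S)) (w (cls v B)) = 0 := by
    rw [← hcross, cross_eq, harg, sub_self, Real.sin_zero, mul_zero]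
  obtain ⟨t, ht, htB⟩ := upper_S.exists_smul upper_B hcross0
  have hnorm : ‖w (cls v E')‖ = (1 + t) * ‖w (cls v S)‖ := by
    have hE'S : w (cls v E') = ((1 + t : ℝ) : ℂ) * w (cls v S) := by
      rw [hcls, map_add, htB]
      push_cast
      ring
    rw [hE'S, norm_mul, Complex.norm_real, Real.norm_of_nonneg (by linarith)]
  have hle := hS.norm_le hE' hE'0 harg
  nlinarith [norm_pos_iff.2 upper_S.ne_zero]

end IsMaximalDestabilizing

namespace IsStabilityFunction

variable [IsTriangulated D]

/- Split off a maximal destabilizing subobject. The bound of the phases by the phase of a subobject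
is what makes the phases of the quotient smaller than that of the part split off. -/
theorem exists_hnChain_arg_le (h : IsStabilityFunction v A w)
    (hfin : ∀ E, A E → ∀ R, (subClasses v A w E R).Finite) (P : ℝ → ObjectProperty D) (β : ℝ)
    (hP : ∀ E, SlopeSemistable v A w E → ¬ IsZero E → P (β + (w (cls v E)).arg / Real.pi) E)
    (n : ℕ) {E : D} {R : ℝ} (hE : A E) (hR : 0 ≤ R) (hER : (w (cls v E)).re ≤ R)
    (hn : (subClasses v A w E R).ncard = n) :
    ∃ l, HNChain P l E ∧ ∀ p ∈ l, β < p.1 ∧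
      ∃ S T, IsSub A S E T ∧ ¬ IsZero S ∧ p.1 ≤ β + (w (cls v S)).arg / Real.pi := by
  induction n using Nat.strong_induction_on generalizing E R with
  | _ n ih =>
  by_cases hE0 : IsZero E
  · exact ⟨[], .nil hE0, by simp⟩
  obtain ⟨S, T, hS, hSR⟩ := h.exists_isMaximalDestabilizing hE hE0 hR hER (hfin E hE R)
  have hre : (w (cls v E)).re = (w (cls v S)).re + (w (cls v T)).re := by
    rw [cls_distTri hS.isSub.tri, map_add, Complex.add_re]
  obtain ⟨l, hl, hphase⟩ := ih _
    (hn ▸ h.ncard_subClasses_lt hE hR (hfin E hE R) hS.isSub hS.ne_zero)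
    hS.isSub.right (by linarith) (by linarith) rfl
  have hlt : ∀ p ∈ l, p.1 < β + (w (cls v S)).arg / Real.pi := fun p hp => by
    obtain ⟨-, B, C, hB, hB0, hp⟩ := hphase p hp
    have harg := hS.arg_lt h hB hB0
    exact hp.trans_lt (by gcongr)
  have hSchain : HNChain P [(β + (w (cls v S)).arg / Real.pi, S)] S :=
    .cons (.nil (isZero_zero D)) (.of_isZero_left (Iso.refl _) (isZero_zero D))
      (hP S (hS.slopeSemistable h) hS.ne_zero) hS.ne_zero (by simp)
  refine ⟨l ++ [(β + (w (cls v S)).arg / Real.pi, S)], hSchain.append hl hS.isSub.tri ?_, ?_⟩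
  · simpa only [List.mem_singleton, forall_eq] using hlt
  · simp only [List.forall_mem_append, List.mem_singleton, forall_eq]
    refine ⟨fun p hp => ⟨(hphase p hp).1, S, T, hS.isSub, hS.ne_zero, (hlt p hp).le⟩,
      lt_add_of_pos_right β ?_, S, T, hS.isSub, hS.ne_zero, le_rfl⟩
    exact div_pos (h.upper hS.isSub.left hS.ne_zero).arg_pos Real.pi_pos

theorem exists_hnChain (h : IsStabilityFunction v A w)
    (hfin : ∀ E, A E → ∀ R, (subClasses v A w E R).Finite) (P : ℝ → ObjectProperty D) (β : ℝ)
    (hP : ∀ E, SlopeSemistable v A w E → ¬ IsZero E → P (β + (w (cls v E)).arg / Real.pi) E)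
    {E : D} (hE : A E) :
    ∃ l, HNChain P l E ∧ ∀ p ∈ l, β < p.1 ∧ p.1 ≤ β + 1 := by
  obtain ⟨l, hl, hphase⟩ := h.exists_hnChain_arg_le hfin P β hP _ hE
    (le_max_left 0 (w (cls v E)).re) (le_max_right _ _) rfl
  refine ⟨l, hl, fun p hp => ⟨(hphase p hp).1, ?_⟩⟩
  obtain ⟨-, S, T, -, -, hle⟩ := hphase p hp
  linarith [(div_le_one Real.pi_pos).2 (Complex.arg_le_pi (w (cls v S)))]

end IsStabilityFunction

end AbstractHeart

section HeartInduction

variable {D : Type u} [Category.{w} D] [HasZeroObject D] [HasShift D ℤ] [Preadditive D]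
  [∀ n : ℤ, (shiftFunctor D n).Additive] [Pretriangulated D]
  {Λ : Type*} [AddCommGroup Λ] {v : K₀ D →+ Λ}

namespace PreStabilityCondition

theorem exists_phaseGT_phaseLE (σ : PreStabilityCondition v) (α : ℝ) (E : D) :
    ∃ (n : ℤ) (k : ℕ), σ.PhaseGT (α + n) E ∧ σ.PhaseLE (α + n + k) E := by
  obtain ⟨l, hl⟩ := σ.exists_hnChain E
  obtain ⟨M, hM⟩ := (l.finite_toSet.image fun p => |p.1 - α|).bddAbove
  obtain ⟨N, hN⟩ := exists_nat_gt M
  have hbound : ∀ p ∈ l, |p.1 - α| < N :=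
    fun p hp => (hM (Set.mem_image_of_mem _ hp)).trans_lt hN
  refine ⟨-N, 2 * N, .of_hnChain hl fun p hp => ?_, .of_hnChain hl fun p hp => ?_⟩ <;>
  · have := abs_lt.1 (hbound p hp)
    push_cast
    linarith

theorem heart_devissage [IsTriangulated D] (σ : PreStabilityCondition v) (α : ℝ)
    {motive : ℤ → D → Prop} (zero : ∀ n E, IsZero E → motive n E)
    (ext : ∀ (n : ℤ) {X E Y : D}, DistTri X E Y → σ.Heart (α + n) X → σ.PhaseLE (α + n) Y →
      motive n Y → motive (n + 1) E) (E : D) : ∃ n, motive n E := by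
  obtain ⟨n, k, hgt, hle⟩ := σ.exists_phaseGT_phaseLE α E
  refine ⟨n + k, ?_⟩
  induction k generalizing E with
  | zero => exact zero _ E (hgt.isZero (by simpa using hle))
  | succ k ih =>
    obtain ⟨X, Y, t, hX, hY⟩ := σ.exists_trunc (α + n + k) E
    have hXle : σ.PhaseLE (α + n + k + 1) X :=
      .left t (by push_cast at hle; rwa [← add_assoc] at hle) (hY.mono (by linarith))
    have hYgt : σ.PhaseGT (α + n) Y :=
      .right t hgt (hX.anti (by linarith [Nat.cast_nonneg (α := ℝ) k]))
    have e : α + n + k = α + ((n + k : ℤ) : ℝ) := by push_cast; ring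
    have hE := ext (n + k) t (e ▸ ⟨hX, hXle⟩) (e ▸ hY) (ih Y hYgt hY)
    rwa [add_assoc, ← Nat.cast_add_one] at hE

end PreStabilityCondition

end HeartInduction

section Mass

variable {D : Type u} [Category.{w} D] [HasZeroObject D] [HasShift D ℤ] [Preadditive D]
  [∀ n : ℤ, (shiftFunctor D n).Additive] [Pretriangulated D]
  {Λ : Type*} [AddCommGroup Λ] {v : K₀ D →+ Λ}

/-- The mass of a list of Harder-Narasimhan factors: the length of the polygonal path of their
central charges. -/
def massList (v : K₀ D →+ Λ) (Z : Λ →ₗ[ℤ] ℂ) (l : List (ℝ × D)) : ℝ :=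
  (l.map fun p => ‖Z (cls v p.2)‖).sum

theorem massList_nonneg (Z : Λ →ₗ[ℤ] ℂ) (l : List (ℝ × D)) : 0 ≤ massList v Z l :=
  List.sum_nonneg (List.forall_mem_map.2 fun _ _ => norm_nonneg _)

theorem massList_filter_le (Z : Λ →ₗ[ℤ] ℂ) (l : List (ℝ × D)) (p : ℝ × D → Bool) :
    massList v Z (l.filter p) ≤ massList v Z l :=
  (List.filter_sublist.map _).sum_le_sum (List.forall_mem_map.2 fun _ _ => norm_nonneg _)

theorem massList_filter_add (Z : Λ →ₗ[ℤ] ℂ) (l : List (ℝ × D)) (a : ℝ) :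
    massList v Z (l.filter fun p => a < p.1) + massList v Z (l.filter fun p => p.1 ≤ a) =
      massList v Z l := by
  simpa only [massList, not_lt] using
    List.sum_map_filter_add_sum_map_filter_not (fun p : ℝ × D => a < p.1)
      (fun p => ‖Z (cls v p.2)‖) l

theorem HNChain.seminorm_cls_le {P : ℝ → ObjectProperty D} {l : List (ℝ × D)} {E : D}
    (hl : HNChain P l E) (N : AddGroupSeminorm Λ) {Z : Λ →ₗ[ℤ] ℂ} {κ : ℝ}
    (h : ∀ p ∈ l, N (cls v p.2) ≤ κ * ‖Z (cls v p.2)‖) : N (cls v E) ≤ κ * massList v Z l := by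
  calc N (cls v E) = N (l.map fun p => cls v p.2).sum := by rw [hl.cls_eq_sum]
    _ ≤ ((l.map fun p => cls v p.2).map N).sum :=
      List.le_sum_of_subadditive N (map_zero N).le (map_add_le_add N) _
    _ ≤ (l.map fun p => κ * ‖Z (cls v p.2)‖).sum := by
      rw [List.map_map]
      exact List.sum_le_sum h
    _ = κ * massList v Z l := List.sum_map_mul_left _ _ _

/-- The phases and central charges of a list of Harder-Narasimhan factors. -/
def chargeList (v : K₀ D →+ Λ) (Z : Λ →ₗ[ℤ] ℂ) (l : List (ℝ × D)) : List (ℝ × ℂ) :=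
  l.map fun p => (p.1, Z (cls v p.2))

theorem height_chargeList (Z : Λ →ₗ[ℤ] ℂ) {P : ℝ → ObjectProperty D} {l : List (ℝ × D)} {θ : ℝ}
    {X : D} (h : HNChain P (l.filter fun p => θ < p.1) X) :
    height (chargeList v Z l) θ = imRot θ (Z (cls v X)) := by
  rw [height, chargeList, List.map_map]
  exact (List.sum_map_ite (fun p : ℝ × D => θ < p.1) _ _ _).trans
    (by simp [h.map_cls_eq_sum, ← List.sum_map_hom, Function.comp_def])

theorem sum_norm_chargeList (Z : Λ →ₗ[ℤ] ℂ) (l : List (ℝ × D)) :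
    ((chargeList v Z l).map fun p => ‖p.2‖).sum = massList v Z l := by
  simp [chargeList, massList, Function.comp_def]

theorem HNChain.sum_chargeList (Z : Λ →ₗ[ℤ] ℂ) {P : ℝ → ObjectProperty D} {l : List (ℝ × D)}
    {E : D} (h : HNChain P l E) :
    ((chargeList v Z l).map fun p => p.2).sum = Z (cls v E) := by
  simp [chargeList, Function.comp_def, h.map_cls_eq_sum]

namespace PreStabilityCondition

theorem mass_eq_massList (σ : PreStabilityCondition v) (E : D) :
    σ.mass E = massList v σ.Z (σ.hn E).list := σ.mass_eq_sum E

variable {σ τ : PreStabilityCondition v}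

theorem onRay_chargeList {E : D} {l : List (ℝ × D)} (h : HNChain σ.P l E) :
    ∀ p ∈ chargeList v σ.Z l, OnRay p.1 p.2 :=
  List.forall_mem_map.2 (onRay_of_hnChain h)

/-- The hearts `P((α + n, α + n + 1])`, `n ∈ ℤ`, of two pre-stability conditions agree. This is
encoded through the half-lines of phases that start or end in `α + ℤ`. -/
structure SameHearts (σ τ : PreStabilityCondition v) (α : ℝ) : Prop where
  phaseGT_iff : ∀ (n : ℤ) (E : D), σ.PhaseGT (α + n) E ↔ τ.PhaseGT (α + n) E
  phaseLE_iff : ∀ (n : ℤ) (E : D), σ.PhaseLE (α + n) E ↔ τ.PhaseLE (α + n) E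

theorem SameHearts.symm {α : ℝ} (h : SameHearts σ τ α) : SameHearts τ σ α where
  phaseGT_iff n E := (h.phaseGT_iff n E).symm
  phaseLE_iff n E := (h.phaseLE_iff n E).symm

theorem SameHearts.phaseLE_add_one_iff {α : ℝ} (h : SameHearts σ τ α) (n : ℤ) (E : D) :
    σ.PhaseLE (α + n + 1) E ↔ τ.PhaseLE (α + n + 1) E := by
  simpa [← add_assoc] using h.phaseLE_iff (n + 1) E

theorem SameHearts.heart_iff {α : ℝ} (h : SameHearts σ τ α) (n : ℤ) (E : D) :
    σ.Heart (α + n) E ↔ τ.Heart (α + n) E :=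
  and_congr (h.phaseGT_iff n E) (h.phaseLE_add_one_iff n E)

theorem norm_charge_sub_le {κ : ℝ}
    (hZ : ∀ φ F, τ.P φ F → ‖τ.Z (cls v F) - σ.Z (cls v F)‖ ≤ κ * ‖τ.Z (cls v F)‖)
    {E : D} {l : List (ℝ × D)} (hl : HNChain τ.P l E) :
    ‖τ.Z (cls v E) - σ.Z (cls v E)‖ ≤ κ * massList v τ.Z l :=
  hl.seminorm_cls_le ((normAddGroupSeminorm ℂ).comp (τ.Z - σ.Z).toAddMonoidHom)
    fun p hp => hZ p.1 p.2 (hl.mem p hp)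

variable [IsTriangulated D]

theorem Heart.phase_chargeList {β : ℝ} {E : D} {l : List (ℝ × D)} (hE : σ.Heart β E)
    (h : HNChain σ.P l E) (W : Λ →ₗ[ℤ] ℂ) : ∀ p ∈ chargeList v W l, β < p.1 ∧ p.1 ≤ β + 1 :=
  List.forall_mem_map.2 fun q hq => ⟨h.phaseGT_iff.1 hE.1 q hq, h.phaseLE_iff.1 hE.2 q hq⟩

/-- The Harder-Narasimhan polygon of a subobject lies inside the polygon of the object. -/
theorem massList_sub_reRot_le {β : ℝ} {S E T : D} {lS lE : List (ℝ × D)} (hE : σ.Heart β E)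
    (h : IsSub (σ.Heart β) S E T) (hS : HNChain σ.P lS S) (hl : HNChain σ.P lE E) :
    massList v σ.Z lS - reRot β (σ.Z (cls v S)) ≤
      massList v σ.Z lE - reRot β (σ.Z (cls v E)) := by
  have := sum_norm_sub_reRot_le (β := β) (ε := 0) (onRay_chargeList hl) (hE.phase_chargeList hl _)
    (onRay_chargeList hS) (h.left.phase_chargeList hS _) fun θ hβθ hθβ => by
      obtain ⟨X, Y, tS, hX, -, hXgt, hYle⟩ := exists_trunc_of_hnChain hS θ
      obtain ⟨X', Y', tE, hX', -, hX'gt, hY'le⟩ := exists_trunc_of_hnChain hl θ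
      rw [height_chargeList _ hX, height_chargeList _ hX', add_zero]
      obtain ⟨Q, tQ, tQ'⟩ := tS.comp h.tri
      exact imRot_le_of_distTri tQ (hXgt.anti hβθ) (.ext tQ' (hYle.mono hθβ) h.right.2) hβθ hθβ
        tE hX'gt hY'le
  simpa [sum_norm_chargeList, hl.sum_chargeList, hS.sum_chargeList] using this

theorem nonempty_iso_of_trunc {a : ℝ} {X E Y X' Y' : D} (h : DistTri X E Y) (hX : σ.PhaseGT a X)
    (hY : σ.PhaseLE a Y) (h' : DistTri X' E Y') (hX' : σ.PhaseGT a X') (hY' : σ.PhaseLE a Y') :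
    Nonempty (X ≅ X') ∧ Nonempty (Y ≅ Y') := by
  obtain ⟨f, f', f'', hf⟩ := h
  obtain ⟨x, x', x'', hx⟩ := h'
  obtain ⟨g, hg⟩ := exists_lift hx f (hX.hom_eq_zero hY' _)
  obtain ⟨R, hR, hR'⟩ := exists_distTri_of_comp_eq hf hx g hg
  have hR0 : IsZero R := PhaseGT.isZero (.right hR hX' (hX.anti (by linarith)))
    (.left hR' hY (hY'.mono (by linarith)))
  exact ⟨hR.nonempty_iso_left hR0, hR'.nonempty_iso_right hR0⟩

theorem massList_le_of_heart {α κ : ℝ} {n : ℤ} {E : D} {l l' : List (ℝ × D)} (hκ : 0 ≤ κ)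
    (h : SameHearts τ σ α) (hE : σ.Heart (α + n) E)
    (hZ : ∀ φ F, τ.P φ F → ‖τ.Z (cls v F) - σ.Z (cls v F)‖ ≤ κ * ‖τ.Z (cls v F)‖)
    (hl : HNChain σ.P l E) (hl' : HNChain τ.P l' E) :
    massList v τ.Z l' ≤ massList v σ.Z l + (Real.pi + 1) * κ * massList v τ.Z l' := by
  set β : ℝ := α + n
  have hpolygon := sum_norm_sub_reRot_le (β := β) (ε := κ * massList v τ.Z l')
    (onRay_chargeList hl) (hE.phase_chargeList hl _) (onRay_chargeList hl')
    (((h.heart_iff n E).2 hE).phase_chargeList hl' _) fun θ hβθ hθβ => by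
      obtain ⟨X, Y, tτ, hX, -, hXgt, hYle⟩ := exists_trunc_of_hnChain hl' θ
      obtain ⟨X', Y', tσ, hX', -, hX'gt, hY'le⟩ := exists_trunc_of_hnChain hl θ
      rw [height_chargeList _ hX, height_chargeList _ hX']
      have hσ : imRot θ (σ.Z (cls v X)) ≤ imRot θ (σ.Z (cls v X')) :=
        imRot_le_of_distTri tτ ((h.phaseGT_iff n X).1 (hXgt.anti hβθ))
          ((h.phaseLE_add_one_iff n Y).1 (hYle.mono hθβ)) hβθ hθβ tσ hX'gt hY'le
      have hτσ : imRot θ (τ.Z (cls v X) - σ.Z (cls v X)) ≤ κ * massList v τ.Z l' :=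
        ((le_abs_self _).trans (abs_imRot_le θ _)).trans ((norm_charge_sub_le hZ hX).trans
          (mul_le_mul_of_nonneg_left (massList_filter_le _ _ _) hκ))
      rw [map_sub] at hτσ
      linarith
  rw [sum_norm_chargeList, sum_norm_chargeList, hl.sum_chargeList, hl'.sum_chargeList] at hpolygon
  have hre : reRot β (τ.Z (cls v E) - σ.Z (cls v E)) ≤ κ * massList v τ.Z l' :=
    ((le_abs_self _).trans (abs_reRot_le β _)).trans (norm_charge_sub_le hZ hl')
  rw [map_sub] at hre
  linarith

theorem massList_le {α κ : ℝ} (hκ : 0 ≤ κ) (h : SameHearts τ σ α)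
    (hZ : ∀ φ F, τ.P φ F → ‖τ.Z (cls v F) - σ.Z (cls v F)‖ ≤ κ * ‖τ.Z (cls v F)‖)
    {E : D} {l l' : List (ℝ × D)} (hl : HNChain σ.P l E) (hl' : HNChain τ.P l' E) :
    massList v τ.Z l' ≤ massList v σ.Z l + (Real.pi + 1) * κ * massList v τ.Z l' := by
  obtain ⟨-, hbound⟩ := σ.heart_devissage α (E := E)
    (motive := fun _ E => ∀ l l', HNChain σ.P l E → HNChain τ.P l' E →
      massList v τ.Z l' ≤ massList v σ.Z l + (Real.pi + 1) * κ * massList v τ.Z l')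
    (fun _ E hE l l' _ hl' => by
      obtain rfl := hl'.eq_nil_of_isZero hE
      simpa [massList] using massList_nonneg (v := v) σ.Z l)
    (fun n {X₀ E Y₀} t hX₀ hY₀ ih l l' hl hl' => by
      obtain ⟨X, Y, tσ, hX, hY, hXgt, hYle⟩ := exists_trunc_of_hnChain hl (α + n)
      obtain ⟨X', Y', tτ, hX', hY', hX'gt, hY'le⟩ := exists_trunc_of_hnChain hl' (α + n)
      obtain ⟨⟨eX⟩, ⟨eY⟩⟩ := nonempty_iso_of_trunc tσ hXgt hYle t hX₀.1 hY₀
      obtain ⟨⟨eX'⟩, ⟨eY'⟩⟩ := nonempty_iso_of_trunc tτ ((h.phaseGT_iff n X').1 hX'gt)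
        ((h.phaseLE_iff n Y').1 hY'le) t hX₀.1 hY₀
      have hsub := massList_le_of_heart hκ h hX₀ hZ (hX.of_iso eX) (hX'.of_iso eX')
      have hquot := ih _ _ (hY.of_iso eY) (hY'.of_iso eY')
      rw [← massList_filter_add τ.Z l' (α + n), ← massList_filter_add σ.Z l (α + n)]
      linarith)
  exact hbound l l' hl hl'

end PreStabilityCondition

end Mass

section Drift

open Real

theorem imRot_add (β b : ℝ) (x : ℂ) :
    imRot (β + b) x = cos (π * b) * imRot β x - sin (π * b) * reRot β x := by
  simp only [imRot_apply, reRot_apply, mul_add, cos_add, sin_add]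
  ring

/-- Multiplication by `exp (-iπβ)`, which carries the charges of phase in `(β, β + 1]` to the
semi-closed upper half plane. -/
def rotC (β : ℝ) : ℂ →+ ℂ where
  toFun x := ⟨reRot β x, imRot β x⟩
  map_zero' := by apply Complex.ext <;> simp
  map_add' x y := by apply Complex.ext <;> simp

@[simp] theorem rotC_re (β : ℝ) (x : ℂ) : (rotC β x).re = reRot β x := rfl

@[simp] theorem rotC_im (β : ℝ) (x : ℂ) : (rotC β x).im = imRot β x := rfl

theorem cross_rotC (β : ℝ) (x y : ℂ) : cross (rotC β x) (rotC β y) = cross x y := by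
  simp only [cross, rotC_re, rotC_im, imRot_apply, reRot_apply]
  linear_combination (x.re * y.im - x.im * y.re) * sin_sq_add_cos_sq (π * β)

theorem onRay_rotC {β φ : ℝ} {x : ℂ} (h : OnRay φ (rotC β x)) : OnRay (β + φ) x := by
  rw [onRay_iff] at *
  have e1 : reRot (β + φ) x = reRot φ (rotC β x) := by
    rw [reRot_apply φ, rotC_re, rotC_im]
    simp only [imRot_apply, reRot_apply, mul_add, cos_add, sin_add]
    ring
  have e2 : imRot (β + φ) x = imRot φ (rotC β x) := by
    rw [imRot_apply φ, rotC_re, rotC_im]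
    simp only [imRot_apply, reRot_apply, mul_add, cos_add, sin_add]
    ring
  rwa [e1, e2]

theorem Upper.exists_onRay {β : ℝ} {x : ℂ} (h : Upper (rotC β x)) :
    ∃ ψ, β < ψ ∧ ψ ≤ β + 1 ∧ OnRay ψ x := by
  refine ⟨β + (rotC β x).arg / π, ?_, ?_, onRay_rotC h.onRay⟩
  · linarith [div_pos h.arg_pos pi_pos]
  · linarith [(div_le_one pi_pos).2 (Complex.arg_le_pi (rotC β x))]

theorem OnRay.cross_eq {φ : ℝ} {y : ℂ} (h : OnRay φ y) (x : ℂ) :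
    cross x y = -(‖y‖ * imRot φ x) := by
  obtain ⟨r, hr, rfl⟩ := h
  rw [norm_ray hr.le, cross, re_ray, im_ray, imRot_apply]
  ring

theorem OnRay.cross_nonneg_iff {φ : ℝ} {y : ℂ} (h : OnRay φ y) (x : ℂ) :
    0 ≤ cross x y ↔ imRot φ x ≤ 0 := by
  rw [h.cross_eq, ← mul_neg, mul_nonneg_iff_of_pos_left h.norm_pos, neg_nonneg]

theorem imRot_eq_sub_of_imRot_eq {β : ℝ} {z w : ℂ} (h : imRot β w = imRot β z) (ψ : ℝ) :
    imRot ψ w = imRot ψ z - sin (π * (ψ - β)) * reRot β (w - z) := by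
  obtain ⟨b, rfl⟩ : ∃ b, ψ = β + b := ⟨ψ - β, by ring⟩
  rw [imRot_add, imRot_add, h, map_sub, add_sub_cancel_left]
  ring

theorem sin_mul_sin_le_sin {ε s b : ℝ} (hε : 0 ≤ ε) (hε' : ε ≤ 1 / 2) (hεs : ε ≤ s) (hsb : s ≤ b)
    (hb : b ≤ 1) : sin (π * b) * sin (π * ε) ≤ sin (π * s) := by
  have hpi := pi_pos
  have hsinb : 0 ≤ sin (π * b) := sin_nonneg_of_nonneg_of_le_pi (by nlinarith) (by nlinarith)
  have hsinε : 0 ≤ sin (π * ε) := sin_nonneg_of_nonneg_of_le_pi (by nlinarith) (by nlinarith)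
  rcases le_total s (1 / 2) with hs | hs
  · refine (mul_le_of_le_one_left hsinε (sin_le_one _)).trans ?_
    exact sin_le_sin_of_le_of_le_pi_div_two (by nlinarith) (by nlinarith) (by nlinarith)
  · refine (mul_le_of_le_one_right hsinb (sin_le_one _)).trans ?_
    rw [← sin_pi_sub (π * b), ← sin_pi_sub (π * s)]
    exact sin_le_sin_of_le_of_le_pi_div_two (by nlinarith) (by nlinarith) (by nlinarith)

theorem abs_mul_lt_of_mul_le {a d r t η S : ℝ} (ha : 0 ≤ a) (hr : 0 < r) (hS : 0 < S)
    (hd : |d| ≤ η * r) (hη : η < t) (hat : a * t ≤ S) : |a * d| < r * S := by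
  rw [abs_mul, abs_of_nonneg ha]
  rcases ha.eq_or_lt with rfl | ha
  · rw [zero_mul]
    positivity
  · calc a * |d| ≤ a * (η * r) := mul_le_mul_of_nonneg_left hd ha.le
      _ < a * (t * r) := mul_lt_mul_of_pos_left (mul_lt_mul_of_pos_right hη hr) ha
      _ = r * (a * t) := by ring
      _ ≤ r * S := mul_le_mul_of_nonneg_left hat hr.le

theorem OnRay.imRot_neg_of_close {β φ ψ ε η : ℝ} {z w : ℂ} (h : OnRay φ z) (hβ : β < φ)
    (him : imRot β w = imRot β z) (hw : ‖w - z‖ ≤ η * ‖z‖) (hη : η < sin (π * ε)) (hε : 0 < ε)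
    (hε' : ε ≤ 1 / 2) (hψ : ψ ≤ β + 1) (hlt : φ + ε < ψ) : imRot ψ w < 0 := by
  have hpi := pi_pos
  have hclose := abs_mul_lt_of_mul_le (S := sin (π * (ψ - φ))) (a := sin (π * (ψ - β)))
    (sin_nonneg_of_nonneg_of_le_pi (by nlinarith) (by nlinarith)) h.norm_pos
    (sin_pos_of_pos_of_lt_pi (by nlinarith) (by nlinarith))
    ((abs_reRot_le β (w - z)).trans hw) hη
    (sin_mul_sin_le_sin hε.le hε' (by linarith) (by linarith) (by linarith))
  have hz : imRot ψ z = -(‖z‖ * sin (π * (ψ - φ))) := by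
    rw [h.imRot_eq, ← neg_sub ψ φ, mul_neg, sin_neg, mul_neg]
  rw [imRot_eq_sub_of_imRot_eq him, hz]
  linarith [(abs_lt.1 hclose).1]

theorem OnRay.imRot_pos_of_close {β φ ψ ε η : ℝ} {z w : ℂ} (h : OnRay φ z) (hβ : φ ≤ β + 1)
    (him : imRot β w = imRot β z) (hw : ‖w - z‖ ≤ η * ‖z‖) (hη : η < sin (π * ε)) (hε : 0 < ε)
    (hε' : ε ≤ 1 / 2) (hψ : β < ψ) (hlt : ψ < φ - ε) : 0 < imRot ψ w := by
  have hpi := pi_pos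
  have hsin : sin (π * (1 - (ψ - β))) = sin (π * (ψ - β)) := by
    rw [mul_one_sub, sin_pi_sub]
  have hclose := abs_mul_lt_of_mul_le (S := sin (π * (φ - ψ))) (a := sin (π * (ψ - β)))
    (sin_nonneg_of_nonneg_of_le_pi (by nlinarith) (by nlinarith)) h.norm_pos
    (sin_pos_of_pos_of_lt_pi (by nlinarith) (by nlinarith))
    ((abs_reRot_le β (w - z)).trans hw) hη
    (hsin ▸ sin_mul_sin_le_sin hε.le hε' (by linarith) (by linarith) (by linarith))
  rw [imRot_eq_sub_of_imRot_eq him, h.imRot_eq]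
  linarith [(abs_lt.1 hclose).2]

theorem OnRay.upper_of_close {β φ η : ℝ} {z w : ℂ} (h : OnRay φ z) (hβ : β < φ)
    (hβ' : φ ≤ β + 1) (him : imRot β w = imRot β z)
    (hw : ‖w - z‖ ≤ η * ‖z‖) (hη : η < 1) : Upper (rotC β w) := by
  rcases hβ'.lt_or_eq with hlt | rfl
  · left
    rw [rotC_im, him]
    exact h.imRot_pos hβ hlt
  · right
    have hre := (abs_le.1 ((abs_reRot_le β (w - z)).trans hw)).2
    rw [map_sub, h.reRot_eq, add_sub_cancel_left, mul_one, cos_pi] at hre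
    rw [rotC_im, rotC_re, him, h.imRot_eq, add_sub_cancel_left, mul_one, sin_pi, mul_zero]
    exact ⟨rfl, by nlinarith [h.norm_pos]⟩

end Drift

section Base

/-- The largest `β ∈ α + ℤ` with `β < φ`. -/
def base (α φ : ℝ) : ℝ := α + ((⌈φ - α⌉ - 1 : ℤ) : ℝ)

theorem base_lt (α φ : ℝ) : base α φ < φ := by
  have := Int.ceil_lt_add_one (φ - α)
  simp only [base]
  push_cast
  linarith

theorem le_base_add_one (α φ : ℝ) : φ ≤ base α φ + 1 := by
  have := Int.le_ceil (φ - α)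
  simp only [base]
  push_cast
  linarith

theorem base_add_one (α φ : ℝ) : base α (φ + 1) = base α φ + 1 := by
  simp only [base]
  rw [show φ + 1 - α = φ - α + 1 by ring, Int.ceil_add_one]
  push_cast
  ring

theorem base_eq {α φ : ℝ} {n : ℤ} (h1 : α + n < φ) (h2 : φ ≤ α + n + 1) : base α φ = α + n := by
  have : ⌈φ - α⌉ = n + 1 := by
    rw [Int.ceil_eq_iff]
    push_cast
    constructor <;> linarith
  simp [base, this]

theorem le_base {α φ : ℝ} {n : ℤ} (h : α + n < φ) : α + n ≤ base α φ := by
  have : (n : ℝ) < ⌈φ - α⌉ := lt_of_lt_of_le (by linarith) (Int.le_ceil _)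
  have : n ≤ ⌈φ - α⌉ - 1 := by
    have := Int.cast_lt.1 this
    omega
  simp only [base]
  have := (Int.cast_le (R := ℝ)).2 this
  linarith

theorem base_add_one_le {α φ : ℝ} {n : ℤ} (h : φ ≤ α + n) : base α φ + 1 ≤ α + n := by
  have : ⌈φ - α⌉ ≤ n := Int.ceil_le.2 (by linarith)
  have := (Int.cast_le (R := ℝ)).2 this
  simp only [base]
  push_cast
  linarith

theorem base_eq_or_add_one_le {α φ ψ : ℝ} (h : φ < ψ) :
    base α φ = base α ψ ∨ base α φ + 1 ≤ base α ψ := by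
  have h1 : ⌈φ - α⌉ ≤ ⌈ψ - α⌉ := Int.ceil_mono (by linarith)
  rcases h1.eq_or_lt with h1 | h1
  · left; simp [base, h1]
  · right
    have h2 : ⌈φ - α⌉ + 1 ≤ ⌈ψ - α⌉ := h1
    have := (Int.cast_le (R := ℝ)).2 h2
    simp only [base]
    push_cast at this ⊢
    linarith

theorem imRot_add_int (α : ℝ) (n : ℤ) {x y : ℂ} (h : imRot α x = imRot α y) :
    imRot (α + n) x = imRot (α + n) y := by
  have : Real.sin (Real.pi * n) = 0 := by rw [mul_comm]; exact Real.sin_int_mul_pi n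
  rw [imRot_add, imRot_add, this, h]
  ring

end Base

section Deformation

variable {D : Type u} [Category.{w} D] [HasZeroObject D] [HasShift D ℤ] [Preadditive D]
  [∀ n : ℤ, (shiftFunctor D n).Additive] [Pretriangulated D]
  {Λ : Type*} [AddCommGroup Λ] {v : K₀ D →+ Λ}

theorem HNChain.map_cls_induction {P : ℝ → ObjectProperty D} {l : List (ℝ × D)} {E : D}
    (hl : HNChain P l E) (hE : ¬ IsZero E) (W : Λ →ₗ[ℤ] ℂ) {p : ℂ → Prop}
    (add : ∀ x y, p x → p y → p (x + y)) (mem : ∀ q ∈ l, p (W (cls v q.2))) :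
    p (W (cls v E)) := by
  have hne : l ≠ [] := fun h => hE (HNChain.isZero_of_nil (h ▸ hl))
  rw [hl.map_cls_eq_sum]
  exact List.sum_induction_nonempty p add (by simpa using hne) (List.forall_mem_map.2 mem)

/-- `W` is a small deformation of the central charge of `σ`, in the direction of phase `α`: it has
the same component transverse to that direction. The norm `N` witnesses the support property of `σ`
with constant `C`, the deformation has size `δ` relative to `N`, and `ε` bounds the resulting
change of phases. -/
structure Deformation (σ : PreStabilityCondition v) (α : ℝ) (W : Λ →ₗ[ℤ] ℂ)
    (N : AddGroupSeminorm Λ) (C δ ε : ℝ) : Prop where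
  im_eq : ∀ x, imRot α (W x) = imRot α (σ.Z x)
  finite : ∀ R, {x | N x ≤ R}.Finite
  norm_le : ∀ φ E, σ.P φ E → N (cls v E) ≤ C * ‖σ.Z (cls v E)‖
  close : ∀ x, ‖W x - σ.Z x‖ ≤ δ * N x
  C_nonneg : 0 ≤ C
  δ_nonneg : 0 ≤ δ
  ε_pos : 0 < ε
  ε_le : ε ≤ 1 / 4
  lt_sin : δ * C < Real.sin (Real.pi * ε)
  le_fifth : δ * C ≤ 1 / 5

/-- The objects of phase `φ` of the deformed stability condition: the objects of slope `φ` of the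
heart of `σ` with phases in `(α + n, α + n + 1]`, where `n` is the integer with `φ` in this
interval, that are semistable for the slope function given by `W`. -/
def slopeP (σ : PreStabilityCondition v) (α : ℝ) (W : Λ →ₗ[ℤ] ℂ) (φ : ℝ) : ObjectProperty D :=
  fun E => SlopeSemistable v (σ.Heart (base α φ)) W E ∧ (IsZero E ∨ OnRay φ (W (cls v E)))

open PreStabilityCondition

theorem PreStabilityCondition.heart_shift_iff {σ : PreStabilityCondition v} {β : ℝ} {E : D} :
    σ.Heart (β + 1) (E⟦(1 : ℤ)⟧) ↔ σ.Heart β E :=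
  and_congr phaseGT_shift_iff phaseLE_shift_iff

theorem PreStabilityCondition.Heart.neg_shift {σ : PreStabilityCondition v} {β : ℝ} {E : D}
    (h : σ.Heart (β + 1) E) : σ.Heart β (E⟦(-1 : ℤ)⟧) :=
  ⟨by simpa using phaseGT_neg_shift h.1, by simpa using phaseLE_neg_shift h.2⟩

theorem cross_neg_neg (x y : ℂ) : cross (-x) (-y) = cross x y := by
  simp [cross]

theorem slopeSemistable_shift_iff {σ : PreStabilityCondition v} {β : ℝ} {W : Λ →ₗ[ℤ] ℂ} {E : D} :
    SlopeSemistable v (σ.Heart (β + 1)) W (E⟦(1 : ℤ)⟧) ↔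
      SlopeSemistable v (σ.Heart β) W E := by
  refine and_congr heart_shift_iff ⟨fun h S T hS => ?_, fun h S T hS => ?_⟩
  · have := h (S⟦(1 : ℤ)⟧) (T⟦(1 : ℤ)⟧)
      ⟨hS.tri.shift 1, heart_shift_iff.2 hS.left, heart_shift_iff.2 hS.right⟩
    rwa [cls_shift, cls_shift, map_neg, map_neg, cross_neg_neg] at this
  · have := h (S⟦(-1 : ℤ)⟧) (T⟦(-1 : ℤ)⟧)
      ⟨(hS.tri.shift (-1)).of_iso (Iso.refl _) (shiftShiftNeg E 1).symm (Iso.refl _),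
        hS.left.neg_shift, hS.right.neg_shift⟩
    rwa [cls_neg_shift, map_neg, ← cross_neg_neg, neg_neg, ← map_neg, ← cls_shift] at this

theorem SlopeSemistable.of_iso {A : D → Prop} (hA : ∀ X Y, (X ≅ Y) → A X → A Y) {W : Λ → ℂ}
    {E F : D} (h : SlopeSemistable v A W E) (e : E ≅ F) : SlopeSemistable v A W F := by
  refine ⟨hA _ _ e h.1, fun S T hS => ?_⟩
  rw [← cls_iso e]
  exact h.2 S T ⟨hS.tri.of_iso (Iso.refl _) e (Iso.refl _), hS.left, hS.right⟩

theorem slopeP_shift_iff {σ : PreStabilityCondition v} {α : ℝ} {W : Λ →ₗ[ℤ] ℂ} (φ : ℝ) (E : D) :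
    slopeP σ α W (φ + 1) (E⟦(1 : ℤ)⟧) ↔ slopeP σ α W φ E := by
  unfold slopeP
  rw [base_add_one, slopeSemistable_shift_iff, cls_shift, map_neg, onRay_neg_iff, isZero_shift_iff]

namespace Deformation

variable {σ : PreStabilityCondition v} {α : ℝ} {W : Λ →ₗ[ℤ] ℂ} {N : AddGroupSeminorm Λ}
  {C δ ε : ℝ}

theorem close_of_norm_le (h : Deformation σ α W N C δ ε) {x : Λ} {r : ℝ} (hx : N x ≤ C * r) :
    ‖W x - σ.Z x‖ ≤ δ * C * r :=
  calc ‖W x - σ.Z x‖ ≤ δ * N x := h.close x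
    _ ≤ δ * (C * r) := mul_le_mul_of_nonneg_left hx h.δ_nonneg
    _ = δ * C * r := (mul_assoc _ _ _).symm

theorem close_of_mem (h : Deformation σ α W N C δ ε) {φ : ℝ} {E : D} (hE : σ.P φ E) :
    ‖W (cls v E) - σ.Z (cls v E)‖ ≤ δ * C * ‖σ.Z (cls v E)‖ :=
  h.close_of_norm_le (h.norm_le φ E hE)

theorem norm_le_massList (h : Deformation σ α W N C δ ε) {E : D} {l : List (ℝ × D)}
    (hl : HNChain σ.P l E) : N (cls v E) ≤ C * massList v σ.Z l :=
  hl.seminorm_cls_le N fun p hp => h.norm_le p.1 p.2 (hl.mem p hp)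

theorem close_massList (h : Deformation σ α W N C δ ε) {E : D} {l : List (ℝ × D)}
    (hl : HNChain σ.P l E) : ‖W (cls v E) - σ.Z (cls v E)‖ ≤ δ * C * massList v σ.Z l :=
  h.close_of_norm_le (h.norm_le_massList hl)

theorem im_eq_int (h : Deformation σ α W N C δ ε) (n : ℤ) (x : Λ) :
    imRot (α + n) (W x) = imRot (α + n) (σ.Z x) :=
  imRot_add_int α n (h.im_eq x)

variable [IsTriangulated D]

theorem upper (h : Deformation σ α W N C δ ε) (n : ℤ) {E : D} (hE : σ.Heart (α + n) E)
    (h0 : ¬ IsZero E) : Upper (rotC (α + n) (W (cls v E))) := by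
  obtain ⟨l, hl⟩ := σ.exists_hnChain E
  refine hl.map_cls_induction h0 W (p := fun z => Upper (rotC (α + n) z))
    (fun x y hx hy => map_add (rotC (α + n)) x y ▸ hx.add hy) fun p hp => ?_
  exact (onRay_of_hnChain hl p hp).upper_of_close (hl.phaseGT_iff.1 hE.1 p hp)
    (hl.phaseLE_iff.1 hE.2 p hp) (h.im_eq_int n _) (h.close_of_mem (hl.mem p hp))
    (h.le_fifth.trans_lt (by norm_num))

/-- The rotated central charge `exp (-iπ(α + n)) W`. -/
def rotCharge (α : ℝ) (W : Λ →ₗ[ℤ] ℂ) (n : ℤ) : Λ →+ ℂ := (rotC (α + n)).comp W.toAddMonoidHom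

theorem isStabilityFunction (h : Deformation σ α W N C δ ε) (n : ℤ) :
    IsStabilityFunction v (σ.Heart (α + n)) (rotCharge α W n) where
  of_isZero := Heart.of_isZero
  ext := Heart.ext
  upper := h.upper n

-- The mass of a subobject is bounded by its real part up to a constant depending only on `E`, so
-- subobjects of bounded real part have bounded norm.
theorem finite_subClasses (h : Deformation σ α W N C δ ε) (n : ℤ) {E : D}
    (hE : σ.Heart (α + n) E) (R : ℝ) :
    (subClasses v (σ.Heart (α + n)) (rotCharge α W n) E R).Finite := by
  obtain ⟨lE, hlE⟩ := σ.exists_hnChain E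
  let M := massList v σ.Z lE - reRot (α + n) (σ.Z (cls v E))
  refine (h.finite (C * ((R + M) * (5 / 4)))).subset ?_
  rintro _ ⟨S, T, hS, rfl, hre : reRot (α + n) (W (cls v S)) ≤ R⟩
  obtain ⟨l, hl⟩ := σ.exists_hnChain S
  have hmass : massList v σ.Z l - reRot (α + n) (σ.Z (cls v S)) ≤ M :=
    massList_sub_reRot_le hE hS hl hlE
  have hclose := (abs_le.1 ((abs_reRot_le (α + n) _).trans (h.close_massList hl))).1
  rw [map_sub] at hclose
  have hfifth := mul_le_mul_of_nonneg_right h.le_fifth (massList_nonneg (v := v) σ.Z l)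
  exact (h.norm_le_massList hl).trans (mul_le_mul_of_nonneg_left (by linarith) h.C_nonneg)

theorem slopeP_hom_eq_zero (h : Deformation σ α W N C δ ε)
    {φ₁ φ₂ : ℝ} (hφ : φ₂ < φ₁) {E F : D} (hE : slopeP σ α W φ₁ E)
    (hF : slopeP σ α W φ₂ F) (f : E ⟶ F) : f = 0 := by
  obtain ⟨⟨hEheart, hEss⟩, hEray⟩ := hE
  obtain ⟨⟨hFheart, hFss⟩, hFray⟩ := hF
  rcases base_eq_or_add_one_le (α := α) hφ with hb | hb
  · have hφ₂ := base_lt α φ₂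
    have hφ₁ := le_base_add_one α φ₁
    rw [hb] at hFheart hFss hφ₂
    rcases hEray with hE0 | hEray
    · exact hE0.eq_of_src _ _
    rcases hFray with hF0 | hFray
    · exact hF0.eq_of_tgt _ _
    obtain ⟨K, I, Q, hK, hI, hQ, tK, tQ, hf⟩ := hEheart.exists_image hFheart f
    apply hf
    by_contra hI0
    obtain ⟨ψ, hψ, hψ', hIray⟩ := (h.upper _ hI hI0).exists_onRay
    change base α φ₁ < ψ at hψ
    change ψ ≤ base α φ₁ + 1 at hψ'
    have hKneg := (hEray.cross_nonneg_iff _).1 (hEss K I ⟨tK, hK, hI⟩)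
    have hIneg := (hFray.cross_nonneg_iff _).1 (hFss I Q ⟨tQ, hI, hQ⟩)
    have hEzero : imRot φ₁ (W (cls v E)) = 0 := (onRay_iff.1 hEray).2
    rw [cls_distTri tK, map_add, map_add] at hEzero
    have hψφ₁ : φ₁ ≤ ψ := by
      by_contra! hlt
      linarith [hIray.imRot_neg (θ := φ₁) (by linarith) hlt]
    have hψφ₂ : ψ ≤ φ₂ := by
      by_contra! hlt
      linarith [hIray.imRot_pos (θ := φ₂) hlt (by linarith)]
    linarith
  · exact PhaseGT.hom_eq_zero (hEheart.1.anti hb) hFheart.2 f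

theorem slopeP_of_slopeSemistable (h : Deformation σ α W N C δ ε) (n : ℤ) {E : D}
    (hE : SlopeSemistable v (σ.Heart (α + n)) (rotCharge α W n) E) (hE0 : ¬ IsZero E) :
    slopeP σ α W (α + n + (rotCharge α W n (cls v E)).arg / Real.pi) E := by
  have hu : Upper (rotCharge α W n (cls v E)) := h.upper n hE.1 hE0
  have hpos := div_pos hu.arg_pos Real.pi_pos
  have hle := (div_le_one Real.pi_pos).2 (Complex.arg_le_pi (rotCharge α W n (cls v E)))
  refine ⟨?_, Or.inr (onRay_rotC hu.onRay)⟩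
  rw [base_eq (n := n) (by linarith) (by linarith)]
  exact ⟨hE.1, fun S T hS => cross_rotC (α + n) (W _) (W _) ▸ hE.2 S T hS⟩

theorem exists_hnChain (h : Deformation σ α W N C δ ε) (E : D) :
    ∃ l, HNChain (slopeP σ α W) l E := by
  have bounded : ∃ n : ℤ, ∃ l, HNChain (slopeP σ α W) l E ∧ ∀ p ∈ l, p.1 ≤ α + n := by
    refine σ.heart_devissage α
      (motive := fun n E => ∃ l, HNChain (slopeP σ α W) l E ∧ ∀ p ∈ l, p.1 ≤ α + n)
      (fun n E hE => ⟨[], .nil hE, by simp⟩) ?_ E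
    rintro n X E Y t hX - ⟨lY, hlY, hY⟩
    obtain ⟨lX, hlX, hlX'⟩ := (h.isStabilityFunction n).exists_hnChain
      (fun _ => h.finite_subClasses n) (slopeP σ α W) (α + n)
      (fun _ => h.slopeP_of_slopeSemistable n) hX
    refine ⟨lY ++ lX, hlX.append hlY t fun p hp q hq => (hY q hq).trans_lt (hlX' p hp).1,
      fun p hp => ?_⟩
    push_cast
    rcases List.mem_append.1 hp with hp | hp
    · linarith [hY p hp]
    · linarith [(hlX' p hp).2]
  obtain ⟨-, l, hl, -⟩ := bounded
  exact ⟨l, hl⟩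

/-- The pre-stability condition with central charge `W` and the same hearts as `σ`. -/
def deform (h : Deformation σ α W N C δ ε) : PreStabilityCondition v where
  Z := W
  P := slopeP σ α W
  iso_closed φ E F e hE := ⟨hE.1.of_iso (fun X Y e hX => hX.of_iso e) e,
    hE.2.imp (fun h0 => h0.of_iso e.symm) fun hr => by rwa [← cls_iso e]⟩
  zero_mem φ E hE := ⟨⟨.of_isZero hE, fun S T _ => by simp [cls_isZero hE]⟩, Or.inl hE⟩
  shift_iff φ E := slopeP_shift_iff φ E
  hom_eq_zero := fun hφ _ _ hE hF f => h.slopeP_hom_eq_zero hφ hE hF f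
  charge_mem_ray := fun hE hE0 => hE.2.resolve_left hE0
  exists_hn E := (h.exists_hnChain E).choose_spec.exists_hnFiltration.nonempty

end Deformation

end Deformation

section Closeness

theorem OnRay.mul_norm_le_reRot {φ ψ : ℝ} {z : ℂ} (h : OnRay φ z)
    (hφ : φ ∈ Set.Icc (ψ - 1 / 4) (ψ + 1 / 4)) : 7 / 10 * ‖z‖ ≤ reRot ψ z := by
  have hsqrt : (7 / 10 : ℝ) ≤ Real.sqrt 2 / 2 := by
    rw [le_div_iff₀ (by norm_num)]
    exact Real.le_sqrt_of_sq_le (by norm_num)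
  have habs : |Real.pi * (φ - ψ)| ≤ Real.pi / 4 :=
    abs_le.2 ⟨by nlinarith [Real.pi_pos, hφ.1], by nlinarith [Real.pi_pos, hφ.2]⟩
  have hcos : Real.cos (Real.pi / 4) ≤ Real.cos (Real.pi * (φ - ψ)) := by
    rw [← Real.cos_abs (Real.pi * (φ - ψ))]
    exact Real.cos_le_cos_of_nonneg_of_le_pi (abs_nonneg _) (by linarith [Real.pi_pos]) habs
  rw [h.reRot_eq, mul_comm]
  rw [Real.cos_pi_div_four] at hcos
  exact mul_le_mul_of_nonneg_left (hsqrt.trans hcos) (norm_nonneg _)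

variable {D : Type u} [Category.{w} D] [HasZeroObject D] [HasShift D ℤ] [Preadditive D]
  [∀ n : ℤ, (shiftFunctor D n).Additive] [Pretriangulated D]
  {Λ : Type*} [AddCommGroup Λ] {v : K₀ D →+ Λ}

open PreStabilityCondition

theorem PreStabilityCondition.mass_pos (σ : PreStabilityCondition v) {E : D} (hE : ¬ IsZero E) :
    0 < σ.mass E := by
  have hl := (σ.hn E).hnChain
  have hne : (σ.hn E).list ≠ [] := fun h => hE (HNChain.isZero_of_nil (h ▸ hl))
  rw [mass_eq_massList]
  exact List.sum_pos _
    (List.forall_mem_map.2 fun p hp => (onRay_of_hnChain hl p hp).norm_pos) (by simpa using hne)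

namespace Deformation

variable {σ : PreStabilityCondition v} {α : ℝ} {W : Λ →ₗ[ℤ] ℂ} {N : AddGroupSeminorm Λ}
  {C δ ε : ℝ}

theorem ε_le_half (h : Deformation σ α W N C δ ε) : ε ≤ 1 / 2 :=
  h.ε_le.trans (by norm_num)

variable [IsTriangulated D]

theorem imRot_neg_of_phaseLE (h : Deformation σ α W N C δ ε) {ψ a : ℝ} {G : D}
    (hG : σ.PhaseGT (base α ψ) G) (hGa : σ.PhaseLE a G) (ha : a < ψ - ε) (hG0 : ¬ IsZero G) :
    imRot ψ (W (cls v G)) < 0 := by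
  obtain ⟨l, hl⟩ := σ.exists_hnChain G
  refine hl.map_cls_induction hG0 W (p := fun z => imRot ψ z < 0)
    (fun x y hx hy => map_add (imRot ψ) x y ▸ add_neg hx hy) fun p hp => ?_
  exact (onRay_of_hnChain hl p hp).imRot_neg_of_close (hl.phaseGT_iff.1 hG p hp)
    (h.im_eq_int _ _) (h.close_of_mem (hl.mem p hp)) h.lt_sin h.ε_pos h.ε_le_half
    (le_base_add_one α ψ) (by linarith [hl.phaseLE_iff.1 hGa p hp])

theorem imRot_pos_of_phaseGT (h : Deformation σ α W N C δ ε) {ψ a : ℝ} {X : D}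
    (hXa : σ.PhaseGT a X) (hX : σ.PhaseLE (base α ψ + 1) X) (ha : ψ + ε < a) (hX0 : ¬ IsZero X) :
    0 < imRot ψ (W (cls v X)) := by
  obtain ⟨l, hl⟩ := σ.exists_hnChain X
  refine hl.map_cls_induction hX0 W (p := fun z => 0 < imRot ψ z)
    (fun x y hx hy => map_add (imRot ψ) x y ▸ add_pos hx hy) fun p hp => ?_
  exact (onRay_of_hnChain hl p hp).imRot_pos_of_close (hl.phaseLE_iff.1 hX p hp)
    (h.im_eq_int _ _) (h.close_of_mem (hl.mem p hp)) h.lt_sin h.ε_pos h.ε_le_half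
    (base_lt α ψ) (by linarith [hl.phaseGT_iff.1 hXa p hp])

theorem exists_trunc_of_slopeP {ψ a : ℝ} {F : D} (hF : slopeP σ α W ψ F)
    (hray : OnRay ψ (W (cls v F))) (ha : base α ψ ≤ a) (ha' : a ≤ base α ψ + 1) :
    ∃ X G, DistTri X F G ∧ σ.PhaseGT a X ∧ σ.PhaseLE (base α ψ + 1) X ∧
      σ.PhaseGT (base α ψ) G ∧ σ.PhaseLE a G ∧
      imRot ψ (W (cls v X)) ≤ 0 ∧ 0 ≤ imRot ψ (W (cls v G)) := by
  obtain ⟨⟨hF, hFss⟩, -⟩ := hF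
  obtain ⟨X, G, t, hX, hG⟩ := σ.exists_trunc a F
  have hG' : σ.PhaseGT (base α ψ) G := .right t hF.1 (hX.anti (by linarith))
  have hX' : σ.PhaseLE (base α ψ + 1) X := .left t hF.2 (hG.mono (by linarith))
  have hXneg := (hray.cross_nonneg_iff _).1
    (hFss X G ⟨t, ⟨hX.anti ha, hX'⟩, ⟨hG', hG.mono ha'⟩⟩)
  have hFzero : imRot ψ (W (cls v F)) = 0 := (onRay_iff.1 hray).2
  rw [cls_distTri t, map_add, map_add] at hFzero
  exact ⟨X, G, t, hX, hX', hG', hG, hXneg, by linarith⟩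

theorem phaseGT_of_slopeP (h : Deformation σ α W N C δ ε) {ψ a : ℝ} {F : D}
    (hF : slopeP σ α W ψ F) (ha : a < ψ - ε) : σ.PhaseGT a F := by
  rcases hF.2 with hF0 | hray
  · exact .of_isZero hF0
  rcases lt_or_ge a (base α ψ) with hab | hab
  · exact hF.1.1.1.anti hab.le
  obtain ⟨X, G, t, hX, -, hG', hG, -, hGnonneg⟩ := exists_trunc_of_slopeP hF hray hab
    (by linarith [h.ε_pos, le_base_add_one α ψ])
  have hG0 : IsZero G := by
    by_contra hG0
    exact (h.imRot_neg_of_phaseLE hG' hG ha hG0).not_ge hGnonneg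
  obtain ⟨e⟩ := t.nonempty_iso_left hG0
  exact hX.of_iso e

theorem phaseLE_of_slopeP (h : Deformation σ α W N C δ ε) {ψ : ℝ} {F : D}
    (hF : slopeP σ α W ψ F) : σ.PhaseLE (ψ + ε) F := by
  rcases hF.2 with hF0 | hray
  · exact .of_isZero hF0
  suffices H : ∀ a, ψ + ε < a → σ.PhaseLE a F from
    fun φ hφ => H ((φ + (ψ + ε)) / 2) (by linarith) φ (by linarith)
  intro a ha
  rcases le_or_gt (base α ψ + 1) a with hab | hab
  · exact hF.1.1.2.mono hab
  obtain ⟨X, G, t, hX, hX', -, hG, hXnonpos, -⟩ := exists_trunc_of_slopeP hF hray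
    (by linarith [h.ε_pos, base_lt α ψ]) hab.le
  have hX0 : IsZero X := by
    by_contra hX0
    exact (h.imRot_pos_of_phaseGT hX hX' ha hX0).not_ge hXnonpos
  obtain ⟨e⟩ := t.nonempty_iso_right hX0
  exact hG.of_iso e.symm

theorem phase_mem_Icc_of_slopeP (h : Deformation σ α W N C δ ε) {ψ : ℝ} {F : D}
    (hF : slopeP σ α W ψ F) {l : List (ℝ × D)} (hl : HNChain σ.P l F) :
    ∀ p ∈ l, p.1 ∈ Set.Icc (ψ - ε) (ψ + ε) := fun p hp =>
  ⟨le_of_forall_lt fun _ ha => hl.phaseGT_iff.1 (h.phaseGT_of_slopeP hF ha) p hp,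
    hl.phaseLE_iff.1 (h.phaseLE_of_slopeP hF) p hp⟩

-- All phases of the factors are within `1 / 4` of `ψ`, so their charges hardly cancel.
theorem massList_le_two_mul (h : Deformation σ α W N C δ ε) {ψ : ℝ} {F : D}
    (hF : slopeP σ α W ψ F) {l : List (ℝ × D)} (hl : HNChain σ.P l F) :
    massList v σ.Z l ≤ 2 * ‖W (cls v F)‖ := by
  have hfactor : ∀ p ∈ l, 7 / 10 * ‖σ.Z (cls v p.2)‖ ≤ reRot ψ (σ.Z (cls v p.2)) := fun p hp =>
    (onRay_of_hnChain hl p hp).mul_norm_le_reRot (Set.Icc_subset_Icc (by linarith [h.ε_le])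
      (by linarith [h.ε_le]) (h.phase_mem_Icc_of_slopeP hF hl p hp))
  have hmass : 7 / 10 * massList v σ.Z l ≤ ‖σ.Z (cls v F)‖ := by
    refine le_trans ?_ ((le_abs_self _).trans (abs_reRot_le ψ (σ.Z (cls v F))))
    rw [hl.map_cls_eq_sum, ← List.sum_map_hom, massList, ← List.sum_map_mul_left]
    exact List.sum_le_sum hfactor
  have hclose := (norm_sub_norm_le _ _).trans ((norm_sub_rev _ _).trans_le (h.close_massList hl))
  have hfifth := mul_le_mul_of_nonneg_right h.le_fifth (massList_nonneg (v := v) σ.Z l)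
  linarith

theorem norm_le_of_slopeP (h : Deformation σ α W N C δ ε) {ψ : ℝ} {F : D}
    (hF : slopeP σ α W ψ F) : N (cls v F) ≤ C * (2 * ‖W (cls v F)‖) := by
  obtain ⟨l, hl⟩ := σ.exists_hnChain F
  exact (h.norm_le_massList hl).trans
    (mul_le_mul_of_nonneg_left (h.massList_le_two_mul hF hl) h.C_nonneg)

theorem phaseGT_of_deform (h : Deformation σ α W N C δ ε) {b : ℝ} {E : D}
    (hE : h.deform.PhaseGT b E) : σ.PhaseGT (b - ε) E := by
  obtain ⟨l, hl⟩ := h.deform.exists_hnChain E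
  exact hl.ext_induction _ (fun _ => .of_isZero) (fun _ _ _ => .ext)
    fun p hp => h.phaseGT_of_slopeP (hl.mem p hp) (by linarith [hl.phaseGT_iff.1 hE p hp])

theorem phaseLE_of_deform (h : Deformation σ α W N C δ ε) {b : ℝ} {E : D}
    (hE : h.deform.PhaseLE b E) : σ.PhaseLE (b + ε) E := by
  obtain ⟨l, hl⟩ := h.deform.exists_hnChain E
  exact hl.ext_induction _ (fun _ => .of_isZero) (fun _ _ _ => .ext)
    fun p hp => (h.phaseLE_of_slopeP (hl.mem p hp)).mono (by linarith [hl.phaseLE_iff.1 hE p hp])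

theorem phaseGT_deform (h : Deformation σ α W N C δ ε) {b : ℝ} {E : D} (hE : σ.PhaseGT b E) :
    h.deform.PhaseGT (b - ε) E :=
  .of_hom fun F hF f => hE.hom_eq_zero (by simpa using h.phaseLE_of_deform hF) f

theorem phaseLE_deform (h : Deformation σ α W N C δ ε) {b : ℝ} {E : D} (hE : σ.PhaseLE b E) :
    h.deform.PhaseLE (b + ε) E :=
  .of_hom fun F hF f => PhaseGT.hom_eq_zero (by simpa using h.phaseGT_of_deform hF) hE f

theorem sameHearts_deform (h : Deformation σ α W N C δ ε) : SameHearts h.deform σ α := by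
  have phaseGT : ∀ (n : ℤ) (E : D), h.deform.PhaseGT (α + n) E → σ.PhaseGT (α + n) E := by
    intro n E hE
    obtain ⟨l, hl⟩ := h.deform.exists_hnChain E
    exact hl.ext_induction _ (fun _ => .of_isZero) (fun _ _ _ => .ext)
      fun p hp => (hl.mem p hp).1.1.1.anti (le_base (hl.phaseGT_iff.1 hE p hp))
  have phaseLE : ∀ (n : ℤ) (E : D), h.deform.PhaseLE (α + n) E → σ.PhaseLE (α + n) E := by
    intro n E hE
    obtain ⟨l, hl⟩ := h.deform.exists_hnChain E
    exact hl.ext_induction _ (fun _ => .of_isZero) (fun _ _ _ => .ext)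
      fun p hp => (hl.mem p hp).1.1.2.mono (base_add_one_le (hl.phaseLE_iff.1 hE p hp))
  exact ⟨fun n E => ⟨phaseGT n E, fun hE =>
      .of_hom fun F hF f => hE.hom_eq_zero (phaseLE n F hF) f⟩,
    fun n E => ⟨phaseLE n E, fun hE =>
      .of_hom fun F hF f => PhaseGT.hom_eq_zero (phaseGT n F hF) hE f⟩⟩

theorem abs_phiPlus_sub_le (h : Deformation σ α W N C δ ε) (E : {E : D // ¬ IsZero E}) :
    |σ.phiPlus E - h.deform.phiPlus E| ≤ ε := by
  have hle := (h.deform.phiPlus_le_iff E _).2 (h.phaseLE_deform ((σ.phiPlus_le_iff E _).1 le_rfl))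
  have hge := (σ.phiPlus_le_iff E _).2
    (h.phaseLE_of_deform ((h.deform.phiPlus_le_iff E _).1 le_rfl))
  exact abs_le.2 ⟨by linarith, by linarith⟩

theorem abs_phiMinus_sub_le (h : Deformation σ α W N C δ ε) (E : {E : D // ¬ IsZero E}) :
    |σ.phiMinus E - h.deform.phiMinus E| ≤ ε := by
  have hge : h.deform.phiMinus E - ε ≤ σ.phiMinus E := le_of_forall_lt fun a ha => by
    have := (σ.lt_phiMinus_iff E _).2
      (h.phaseGT_of_deform ((h.deform.lt_phiMinus_iff E (a + ε)).1 (by linarith)))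
    linarith
  have hle : σ.phiMinus E - ε ≤ h.deform.phiMinus E := le_of_forall_lt fun a ha => by
    have := (h.deform.lt_phiMinus_iff E _).2
      (h.phaseGT_deform ((σ.lt_phiMinus_iff E (a + ε)).1 (by linarith)))
    linarith
  exact abs_le.2 ⟨by linarith, by linarith⟩

theorem mass_deform_le (h : Deformation σ α W N C δ ε) (E : D) :
    h.deform.mass E ≤ σ.mass E + (Real.pi + 1) * (2 * (δ * C)) * h.deform.mass E := by
  rw [mass_eq_massList, mass_eq_massList]
  have hδC : 0 ≤ δ * C := mul_nonneg h.δ_nonneg h.C_nonneg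
  refine massList_le (by positivity) h.sameHearts_deform (fun φ F hF => ?_) (σ.hn E).hnChain
    (h.deform.hn E).hnChain
  calc ‖W (cls v F) - σ.Z (cls v F)‖ ≤ δ * C * (2 * ‖W (cls v F)‖) :=
        h.close_of_norm_le (h.norm_le_of_slopeP hF)
    _ = 2 * (δ * C) * ‖W (cls v F)‖ := by ring

theorem mass_le_deform (h : Deformation σ α W N C δ ε) (E : D) :
    σ.mass E ≤ h.deform.mass E + (Real.pi + 1) * (δ * C) * σ.mass E := by
  rw [mass_eq_massList, mass_eq_massList]
  refine massList_le (mul_nonneg h.δ_nonneg h.C_nonneg) h.sameHearts_deform.symm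
    (fun φ F hF => ?_) (h.deform.hn E).hnChain (σ.hn E).hnChain
  exact (norm_sub_rev _ _).trans_le (h.close_of_mem hF)

theorem abs_log_mass_sub_le (h : Deformation σ α W N C δ ε) {ρ : ℝ}
    (hρ : 10 * (δ * C) ≤ 1 - Real.exp (-ρ)) {E : D} (hE : ¬ IsZero E) :
    |Real.log (σ.mass E) - Real.log (h.deform.mass E)| ≤ ρ := by
  have hpi := Real.pi_lt_four
  have hσ := σ.mass_pos hE
  have hτ := h.deform.mass_pos hE
  have hδC : 0 ≤ δ * C := mul_nonneg h.δ_nonneg h.C_nonneg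
  have hle : Real.exp (-ρ) * h.deform.mass E ≤ σ.mass E := by
    have : (Real.pi + 1) * (2 * (δ * C)) * h.deform.mass E ≤
        (1 - Real.exp (-ρ)) * h.deform.mass E :=
      mul_le_mul_of_nonneg_right (by nlinarith) hτ.le
    linarith [h.mass_deform_le E]
  have hge : Real.exp (-ρ) * σ.mass E ≤ h.deform.mass E := by
    have : (Real.pi + 1) * (δ * C) * σ.mass E ≤ (1 - Real.exp (-ρ)) * σ.mass E :=
      mul_le_mul_of_nonneg_right (by nlinarith) hσ.le
    linarith [h.mass_le_deform E]
  have log_le := Real.log_le_log (by positivity) hle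
  have log_ge := Real.log_le_log (by positivity) hge
  rw [Real.log_mul (by positivity) hτ.ne', Real.log_exp] at log_le
  rw [Real.log_mul (by positivity) hσ.ne', Real.log_exp] at log_ge
  exact abs_le.2 ⟨by linarith, by linarith⟩

end Deformation

end Closeness

section QuadraticForms

variable {Λ : Type*} [AddCommGroup Λ]

theorem liftBaseChange_one_tmul (Z : Λ →ₗ[ℤ] ℂ) (x : Λ) :
    Z.liftBaseChange ℝ ((1 : ℝ) ⊗ₜ[ℤ] x) = Z x := by
  rw [LinearMap.liftBaseChange_tmul, one_smul]

-- The combination `s • x - r • y` lies in the kernel, and `Q ≤ 0` there bounds the polar form.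
theorem KerNegDef.add_nonneg {Q : QuadraticForm ℝ (ℝ ⊗[ℤ] Λ)} {Z : Λ →ₗ[ℤ] ℂ}
    (h : KerNegDef Q Z) {x y : ℝ ⊗[ℤ] Λ} {c : ℂ} {r s : ℝ} (hr : 0 < r) (hs : 0 < s)
    (hx : Z.liftBaseChange ℝ x = r * c) (hy : Z.liftBaseChange ℝ y = s * c)
    (hQx : 0 ≤ Q x) (hQy : 0 ≤ Q y) : 0 ≤ Q (x + y) := by
  have hker : Z.liftBaseChange ℝ (s • x + (-r) • y) = 0 := by
    rw [map_add, map_smul, map_smul, hx, hy]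
    simp only [Complex.real_smul]
    push_cast
    ring
  have hQker : Q (s • x + (-r) • y) ≤ 0 := by
    by_cases h0 : s • x + (-r) • y = 0
    · rw [h0, QuadraticMap.map_zero]
    · exact (h _ hker h0).le
  have hpolar : 0 ≤ s * r * QuadraticMap.polar Q x y := by
    rw [QuadraticMap.map_add Q, QuadraticMap.map_smul, QuadraticMap.map_smul,
      QuadraticMap.polar_smul_left, QuadraticMap.polar_smul_right] at hQker
    simp only [smul_eq_mul] at hQker
    linarith [mul_nonneg (mul_self_nonneg s) hQx, mul_nonneg (mul_self_nonneg (-r)) hQy]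
  rw [QuadraticMap.map_add Q]
  linarith [nonneg_of_mul_nonneg_right hpolar (mul_pos hs hr)]

/-- The straight path from the central charge `Z` at time `0` to `W` at time `1`. -/
def chargePath (Z W : Λ →ₗ[ℤ] ℂ) (t : ℝ) : Λ →ₗ[ℤ] ℂ := Z + t • (W - Z)

theorem chargePath_apply (Z W : Λ →ₗ[ℤ] ℂ) (t : ℝ) (x : Λ) :
    chargePath Z W t x = Z x + t * (W x - Z x) := by
  simp [chargePath]

@[simp] theorem chargePath_zero (Z W : Λ →ₗ[ℤ] ℂ) : chargePath Z W 0 = Z := by simp [chargePath]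

@[simp] theorem chargePath_one (Z W : Λ →ₗ[ℤ] ℂ) : chargePath Z W 1 = W := by simp [chargePath]

theorem map_chargePath_apply (f : ℂ →ₗ[ℝ] ℝ) (Z W : Λ →ₗ[ℤ] ℂ) (t : ℝ) (x : Λ) :
    f (chargePath Z W t x) = f (Z x) + t * (f (W x) - f (Z x)) := by
  rw [chargePath_apply, map_add, ← Complex.real_smul, map_smul, map_sub, smul_eq_mul]

theorem cross_chargePath {β : ℝ} {Z W : Λ →ₗ[ℤ] ℂ} (h : ∀ x, imRot β (W x) = imRot β (Z x)) (t : ℝ)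
    (x y : Λ) : cross (chargePath Z W t x) (chargePath Z W t y) = cross (Z x) (Z y) +
      t * (cross (W x) (W y) - cross (Z x) (Z y)) := by
  rw [← cross_rotC β (chargePath Z W t x), ← cross_rotC β (Z x), ← cross_rotC β (W x)]
  simp only [cross, rotC_re, rotC_im, map_chargePath_apply, h]
  ring

theorem norm_chargePath_le {Z W : Λ →ₗ[ℤ] ℂ} {s t : ℝ} (hst : s ≤ t) (x : Λ) :
    ‖chargePath Z W s x‖ ≤ ‖chargePath Z W t x‖ + (t - s) * ‖W x - Z x‖ := by
  have hsub : chargePath Z W s x = chargePath Z W t x - ((t - s : ℝ) : ℂ) * (W x - Z x) := by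
    rw [chargePath_apply, chargePath_apply]
    push_cast
    ring
  rw [hsub]
  refine (norm_sub_le _ _).trans_eq ?_
  rw [norm_mul, Complex.norm_real, Real.norm_of_nonneg (sub_nonneg.2 hst)]

end QuadraticForms

section Walls

theorem rotC_ofReal_mul (β r : ℝ) (x : ℂ) : rotC β (r * x) = r * rotC β x := by
  rw [← Complex.real_smul, ← Complex.real_smul]
  apply Complex.ext <;> simp only [rotC_re, rotC_im, map_smul, Complex.smul_re, Complex.smul_im]

theorem rotC_injective (β : ℝ) : Function.Injective (rotC β) :=
  (injective_iff_map_eq_zero _).2 fun _ hx =>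
    eq_zero_of_reRot_of_imRot (congrArg Complex.re hx) (congrArg Complex.im hx)

theorem cross_ofReal_mul_right (x y : ℂ) (r : ℝ) : cross x (r * y) = r * cross x y := by
  simp [cross]
  ring

-- The last time at which one of the finitely many negative functions becomes nonnegative.
theorem exists_affine_eq_zero {ι : Type*} {G : Set ι} {a k : ι → ℝ} {t : ℝ} (ht : 0 ≤ t)
    (hfin : {x ∈ G | a x < 0}.Finite) (hneg : ∃ x ∈ G, a x < 0)
    (hpos : ∀ x ∈ G, 0 ≤ a x + t * k x) :
    ∃ s ∈ Set.Icc 0 t, (∀ x ∈ G, 0 ≤ a x + s * k x) ∧ ∃ x ∈ G, a x < 0 ∧ a x + s * k x = 0 := by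
  have slope_pos : ∀ x ∈ {x ∈ G | a x < 0}, 0 < k x := by
    rintro x ⟨hx, hax⟩
    by_contra! hk
    nlinarith [hpos x hx]
  obtain ⟨x₀, hx₀, hmax⟩ := Set.exists_max_image _ (fun x => -a x / k x) hfin hneg
  have hk₀ := slope_pos x₀ hx₀
  refine ⟨-a x₀ / k x₀, ⟨div_nonneg (by linarith [hx₀.2]) hk₀.le, ?_⟩, fun x hx => ?_,
    x₀, hx₀.1, hx₀.2, ?_⟩
  · rw [div_le_iff₀ hk₀]
    linarith [hpos x₀ hx₀.1]
  · have hs : 0 ≤ -a x₀ / k x₀ := div_nonneg (by linarith [hx₀.2]) hk₀.le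
    rcases lt_or_ge (a x) 0 with hax | hax
    · have hle := hmax x ⟨hx, hax⟩
      rw [div_le_iff₀ (slope_pos x ⟨hx, hax⟩)] at hle
      linarith
    · rcases le_or_gt 0 (k x) with hk | hk
      · nlinarith [mul_nonneg hs hk]
      · have hst : -a x₀ / k x₀ ≤ t := by
          rw [div_le_iff₀ hk₀]
          linarith [hpos x₀ hx₀.1]
        nlinarith [hpos x hx]
  · rw [div_mul_cancel₀ _ hk₀.ne', add_neg_cancel]

variable {D : Type u} [Category.{w} D] [HasZeroObject D] [HasShift D ℤ] [Preadditive D]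
  [∀ n : ℤ, (shiftFunctor D n).Additive] [Pretriangulated D] [IsTriangulated D]
  {Λ : Type*} [AddCommGroup Λ] {v : K₀ D →+ Λ}

theorem IsStabilityFunction.slopeSemistable_of_cross_eq_zero {A : D → Prop} {w : Λ →+ ℂ}
    (h : IsStabilityFunction v A w) {S E T : D} (hE : SlopeSemistable v A w E)
    (hS : IsSub A S E T) (hS0 : ¬ IsZero S) (hT0 : ¬ IsZero T)
    (hcross : cross (w (cls v S)) (w (cls v E)) = 0) :
    ∃ r : ℝ, 0 < r ∧ r < 1 ∧ w (cls v S) = r * w (cls v E) ∧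
      w (cls v T) = (1 - r : ℝ) * w (cls v E) ∧
      SlopeSemistable v A w S ∧ SlopeSemistable v A w T := by
  have hadd : w (cls v E) = w (cls v S) + w (cls v T) := by rw [cls_distTri hS.tri, map_add]
  have upper_S := h.upper hS.left hS0
  have upper_T := h.upper hS.right hT0
  have upper_E : Upper (w (cls v E)) := hadd ▸ upper_S.add upper_T
  have hcrossT : cross (w (cls v T)) (w (cls v E)) = 0 := by
    have hself := cross_self (w (cls v E))
    nth_rewrite 1 [hadd] at hself
    rwa [cross_add_left, hcross, zero_add] at hself
  obtain ⟨r, hr, hrS⟩ := upper_E.exists_smul upper_S (by rw [cross_swap, hcross, neg_zero])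
  obtain ⟨r', hr', hrT⟩ := upper_E.exists_smul upper_T (by rw [cross_swap, hcrossT, neg_zero])
  have hsum : r' = 1 - r := by
    have hmul : ((r + r' : ℝ) : ℂ) * w (cls v E) = ((1 : ℝ) : ℂ) * w (cls v E) := by
      push_cast
      linear_combination -hadd - hrS - hrT
    linarith [Complex.ofReal_injective (mul_right_cancel₀ upper_E.ne_zero hmul)]
  subst hsum
  refine ⟨r, hr, by linarith, hrS, hrT, ⟨hS.left, fun S' T' hS' => ?_⟩,
    ⟨hS.right, fun B B' hB => ?_⟩⟩
  · obtain ⟨X, tX, tX'⟩ := hS'.tri.comp hS.tri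
    rw [hrS, cross_ofReal_mul_right]
    exact mul_nonneg hr.le (hE.2 S' X ⟨tX, hS'.left, h.ext tX' hS'.right hS.right⟩)
  · obtain ⟨E', hE', -, hcls⟩ := h.exists_isSub_add hS hS0 hB
    have hnonneg := hE.2 E' B' hE'
    rw [hcls, map_add, cross_add_left, hcross, zero_add] at hnonneg
    rw [hrT, cross_ofReal_mul_right]
    exact mul_nonneg hr'.le hnonneg

end Walls

section Support

variable {D : Type u} [Category.{w} D] [HasZeroObject D] [HasShift D ℤ] [Preadditive D]
  [∀ n : ℤ, (shiftFunctor D n).Additive] [Pretriangulated D]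
  {Λ : Type*} [AddCommGroup Λ] {v : K₀ D →+ Λ}

open PreStabilityCondition

theorem PreStabilityCondition.mem_of_hnChain {σ : PreStabilityCondition v} {ψ : ℝ} {E : D}
    {l : List (ℝ × D)} (hl : HNChain σ.P l E) (hall : ∀ p ∈ l, p.1 = ψ) : σ.P ψ E := by
  cases hl with
  | nil h => exact σ.zero_mem ψ h
  | @cons _ _ A φ _ h t hA _ hlt =>
    obtain rfl : φ = ψ := hall (φ, A) List.mem_cons_self
    cases h with
    | nil h0 =>
      obtain ⟨e⟩ := t.nonempty_iso_right h0
      exact σ.iso_closed _ e.symm hA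
    | @cons _ _ B χ =>
      exact absurd (hall (χ, B) (by simp)) (hlt (χ, B) List.mem_cons_self).ne'

namespace Deformation

variable {σ : PreStabilityCondition v} {α : ℝ} {W : Λ →ₗ[ℤ] ℂ} {N : AddGroupSeminorm Λ}
  {C δ ε : ℝ}

theorem slopeSemistable_rotCharge_iff {A : D → Prop} {n : ℤ} {E : D} :
    SlopeSemistable v A (rotCharge α W n) E ↔ SlopeSemistable v A W E := by
  simp [SlopeSemistable, rotCharge, cross_rotC]

theorem not_isZero_of_cross_neg {S E T : D} (tri : DistTri S E T)
    (hneg : cross (W (cls v S)) (W (cls v E)) < 0) : ¬ IsZero S ∧ ¬ IsZero T := by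
  refine ⟨fun hS => ?_, fun hT => ?_⟩
  · simp [cls_isZero hS] at hneg
  · have hSE : cls v E = cls v S := by rw [cls_distTri tri, cls_isZero hT, add_zero]
    simp [hSE] at hneg

theorem alongPath (h : Deformation σ α W N C δ ε) {t : ℝ} (ht : t ∈ Set.Icc 0 1) :
    Deformation σ α (chargePath σ.Z W t) N C δ ε where
  im_eq x := by rw [map_chargePath_apply, h.im_eq, sub_self, mul_zero, add_zero]
  finite := h.finite
  norm_le := h.norm_le
  close x := by
    rw [chargePath_apply, add_sub_cancel_left, norm_mul, Complex.norm_real,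
      Real.norm_of_nonneg ht.1]
    exact (mul_le_of_le_one_left (norm_nonneg _) ht.2).trans (h.close x)
  C_nonneg := h.C_nonneg
  δ_nonneg := h.δ_nonneg
  ε_pos := h.ε_pos
  ε_le := h.ε_le
  lt_sin := h.lt_sin
  le_fifth := h.le_fifth

theorem const (h : Deformation σ α W N C δ ε) {ε' : ℝ} (hε' : 0 < ε') (hε'_le : ε' ≤ 1 / 4) :
    Deformation σ α σ.Z N C 0 ε' where
  im_eq _ := rfl
  finite := h.finite
  norm_le := h.norm_le
  close x := by simp
  C_nonneg := h.C_nonneg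
  δ_nonneg := le_rfl
  ε_pos := hε'
  ε_le := hε'_le
  lt_sin := by
    rw [zero_mul]
    exact Real.sin_pos_of_pos_of_lt_pi (by positivity) (by nlinarith [Real.pi_pos])
  le_fifth := by simp

/-- The size of a class `x` at time `t` of the path from `Z` to `W`, weighted so that it is
monotone in `t` for a semistable object. It drops by at least `1` when an object is replaced by a
factor of a strictly semistable filtration, hence serves as the termination measure. -/
def pathSize (Z W : Λ →ₗ[ℤ] ℂ) (C δ t : ℝ) (x : Λ) : ℝ :=
  2 * C * ‖chargePath Z W t x‖ * Real.exp (δ * (2 * C) * t)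

theorem pathSize_add_one_le (h : Deformation σ α W N C δ ε) {t : ℝ} (ht : 0 ≤ t) {x y : Λ}
    (hxy : 2 * C * ‖chargePath σ.Z W t x‖ + 1 ≤ 2 * C * ‖chargePath σ.Z W t y‖) :
    pathSize σ.Z W C δ t x + 1 ≤ pathSize σ.Z W C δ t y := by
  have hexp : 1 ≤ Real.exp (δ * (2 * C) * t) := Real.one_le_exp
    (mul_nonneg (mul_nonneg h.δ_nonneg (mul_nonneg zero_le_two h.C_nonneg)) ht)
  unfold pathSize
  linarith [mul_le_mul_of_nonneg_right hxy (zero_le_one.trans hexp)]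

variable [IsTriangulated D]

theorem exists_slopeP (h : Deformation σ α W N C δ ε) {n : ℤ} {E : D}
    (hE : SlopeSemistable v (σ.Heart (α + n)) W E) (hE0 : ¬ IsZero E) :
    ∃ ψ, slopeP σ α W ψ E :=
  ⟨_, h.slopeP_of_slopeSemistable n (slopeSemistable_rotCharge_iff.2 hE) hE0⟩

-- The constant path is a deformation for every `ε' > 0`, so all phases of `E` coincide.
theorem isSemistable_of_slopeSemistable (h : Deformation σ α W N C δ ε) {n : ℤ} {E : D}
    (hE : SlopeSemistable v (σ.Heart (α + n)) σ.Z E) (hE0 : ¬ IsZero E) : σ.IsSemistable E := by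
  obtain ⟨ψ, hψ⟩ := (h.const (ε' := 1 / 4) (by norm_num) le_rfl).exists_slopeP hE hE0
  obtain ⟨l, hl⟩ := σ.exists_hnChain E
  refine ⟨ψ, mem_of_hnChain hl fun p hp => ?_⟩
  by_contra hne
  have hpos : 0 < |p.1 - ψ| := abs_pos.2 (sub_ne_zero.2 hne)
  have hmem := (h.const (ε' := min (1 / 4) (|p.1 - ψ| / 2)) (by positivity)
    (min_le_left _ _)).phase_mem_Icc_of_slopeP hψ hl p hp
  rw [← Real.closedBall_eq_Icc, mem_closedBall_iff_norm, Real.norm_eq_abs] at hmem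
  exact (half_lt_self hpos).not_ge (hmem.trans (min_le_right _ _))

theorem finite_destabilizing (h : Deformation σ α W N C δ ε) {n : ℤ} {E : D}
    (hE : σ.Heart (α + n) E) :
    {x | (∃ S T, IsSub (σ.Heart (α + n)) S E T ∧ cls v S = x) ∧
      cross (W x) (W (cls v E)) < 0}.Finite := by
  refine (h.finite_subClasses n hE (max 0 (reRot (α + n) (W (cls v E))))).subset ?_
  rintro _ ⟨⟨S, T, hS, rfl⟩, hneg⟩
  have upper_S := h.upper n hS.left (not_isZero_of_cross_neg hS.tri hneg).1
  refine ⟨S, T, hS, rfl, upper_S.re_le_of_cross_nonneg (y := rotC (α + n) (W (cls v E))) ?_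
    ((h.isStabilityFunction n).im_le hS) (le_max_left _ _) (le_max_right _ _)⟩
  rw [cross_rotC, cross_swap]
  linarith

theorem exists_wall (h : Deformation σ α W N C δ ε) {n : ℤ} {E : D} {t : ℝ} (ht : 0 ≤ t)
    (hE : SlopeSemistable v (σ.Heart (α + n)) (chargePath σ.Z W t) E)
    (hE' : ¬ SlopeSemistable v (σ.Heart (α + n)) σ.Z E) :
    ∃ s ∈ Set.Icc 0 t, SlopeSemistable v (σ.Heart (α + n)) (chargePath σ.Z W s) E ∧
      ∃ S T, IsSub (σ.Heart (α + n)) S E T ∧ ¬ IsZero S ∧ ¬ IsZero T ∧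
        cross (chargePath σ.Z W s (cls v S)) (chargePath σ.Z W s (cls v E)) =
          0 := by
  have hneg : ∃ x ∈ {x | ∃ S T, IsSub (σ.Heart (α + n)) S E T ∧ cls v S = x},
      cross (σ.Z x) (σ.Z (cls v E)) < 0 := by
    by_contra! hall
    exact hE' ⟨hE.1, fun S T hS => hall _ ⟨S, T, hS, rfl⟩⟩
  have hZ : Deformation σ α σ.Z N C δ ε := by simpa using h.alongPath ⟨le_rfl, zero_le_one⟩
  have hcross := fun s x => cross_chargePath (h.im_eq_int n) s x (cls v E)
  obtain ⟨s, hs, hsE, _, ⟨S, T, hS, rfl⟩, hSneg, hSzero⟩ :=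
    exists_affine_eq_zero (k := fun x => cross (W x) (W (cls v E)) - cross (σ.Z x) (σ.Z (cls v E)))
      ht (hZ.finite_destabilizing hE.1) hneg (by
        rintro _ ⟨S, T, hS, rfl⟩
        exact hcross t _ ▸ hE.2 S T hS)
  obtain ⟨hS0, hT0⟩ := not_isZero_of_cross_neg hS.tri hSneg
  exact ⟨s, hs, ⟨hE.1, fun S' T' hS' => hcross s _ ▸ hsE _ ⟨S', T', hS', rfl⟩⟩,
    S, T, hS, hS0, hT0, (hcross s _).trans hSzero⟩

theorem one_le_of_slopeSemistable (h : Deformation σ α W N C δ ε) (hN : ∀ x, x ≠ 0 → 1 ≤ N x)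
    {n : ℤ} {F : D} (hF : SlopeSemistable v (σ.Heart (α + n)) W F) (hF0 : ¬ IsZero F) :
    1 ≤ 2 * C * ‖W (cls v F)‖ := by
  obtain ⟨ψ, hψ⟩ := h.exists_slopeP hF hF0
  have hcls : cls v F ≠ 0 := fun hz => (h.upper n hF.1 hF0).ne_zero (by simp [hz])
  linarith [hN _ hcls, h.norm_le_of_slopeP hψ]

theorem pathSize_le (h : Deformation σ α W N C δ ε) {n : ℤ} {E : D} {s t : ℝ} (hst : s ≤ t)
    (ht : t ∈ Set.Icc 0 1)
    (hE : SlopeSemistable v (σ.Heart (α + n)) (chargePath σ.Z W t) E)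
    (hE0 : ¬ IsZero E) :
    pathSize σ.Z W C δ s (cls v E) ≤ pathSize σ.Z W C δ t (cls v E) := by
  set x := cls v E
  obtain ⟨ψ, hψ⟩ := (h.alongPath ht).exists_slopeP hE hE0
  have hclose : ‖W x - σ.Z x‖ ≤ δ * (2 * C) * ‖chargePath σ.Z W t x‖ :=
    (h.close_of_norm_le ((h.alongPath ht).norm_le_of_slopeP hψ)).trans_eq (by ring)
  have hnorm : ‖chargePath σ.Z W s x‖ ≤
      ‖chargePath σ.Z W t x‖ * Real.exp (δ * (2 * C) * (t - s)) :=
    calc ‖chargePath σ.Z W s x‖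
      _ ≤ ‖chargePath σ.Z W t x‖ + (t - s) * ‖W x - σ.Z x‖ := norm_chargePath_le hst x
      _ ≤ ‖chargePath σ.Z W t x‖ +
          (t - s) * (δ * (2 * C) * ‖chargePath σ.Z W t x‖) := by gcongr
      _ = ‖chargePath σ.Z W t x‖ * (δ * (2 * C) * (t - s) + 1) := by ring
      _ ≤ _ := by gcongr; exact Real.add_one_le_exp _
  have hexp : Real.exp (δ * (2 * C) * t) =
      Real.exp (δ * (2 * C) * (t - s)) * Real.exp (δ * (2 * C) * s) := by
    rw [← Real.exp_add]
    ring_nf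
  have hC := h.C_nonneg
  calc pathSize σ.Z W C δ s x
    _ ≤ 2 * C * (‖chargePath σ.Z W t x‖ * Real.exp (δ * (2 * C) * (t - s))) *
        Real.exp (δ * (2 * C) * s) := by unfold pathSize; gcongr
    _ = pathSize σ.Z W C δ t x := by rw [pathSize, hexp]; ring

theorem exists_factors (h : Deformation σ α W N C δ ε) (hN : ∀ x, x ≠ 0 → 1 ≤ N x) {n : ℤ}
    {t : ℝ} (ht : t ∈ Set.Icc 0 1) {E : D}
    (hE : SlopeSemistable v (σ.Heart (α + n)) (chargePath σ.Z W t) E)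
    (hE0 : ¬ IsZero E) (hE' : ¬ SlopeSemistable v (σ.Heart (α + n)) σ.Z E) :
    ∃ s ∈ Set.Icc (0 : ℝ) 1, ∃ r ∈ Set.Ioo (0 : ℝ) 1, ∃ S T,
      DistTri S E T ∧
      chargePath σ.Z W s (cls v S) = r * chargePath σ.Z W s (cls v E) ∧
      chargePath σ.Z W s (cls v T) =
        (1 - r : ℝ) * chargePath σ.Z W s (cls v E) ∧
      ∀ F ∈ ({S, T} : Set D),
        SlopeSemistable v (σ.Heart (α + n)) (chargePath σ.Z W s) F ∧
        pathSize σ.Z W C δ s (cls v F) + 1 ≤ pathSize σ.Z W C δ t (cls v E) := by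
  obtain ⟨s, hs, hEs, S, T, hS, hS0, hT0, hcross⟩ := h.exists_wall ht.1 hE hE'
  have hs1 : s ∈ Set.Icc (0 : ℝ) 1 := ⟨hs.1, hs.2.trans ht.2⟩
  have hd := h.alongPath hs1
  obtain ⟨r, hr, hr1, hrS, hrT, hSs, hTs⟩ :=
    (hd.isStabilityFunction n).slopeSemistable_of_cross_eq_zero
      (slopeSemistable_rotCharge_iff.2 hEs) hS hS0 hT0 ((cross_rotC _ _ _).trans hcross)
  rw [slopeSemistable_rotCharge_iff] at hSs hTs
  replace hrS : chargePath σ.Z W s (cls v S) = r * chargePath σ.Z W s (cls v E) :=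
    rotC_injective (α + n) (hrS.trans (rotC_ofReal_mul _ _ _).symm)
  replace hrT : chargePath σ.Z W s (cls v T) = (1 - r : ℝ) * chargePath σ.Z W s (cls v E) :=
    rotC_injective (α + n) (hrT.trans (rotC_ofReal_mul _ _ _).symm)
  have one_le_S := hd.one_le_of_slopeSemistable hN hSs hS0
  have one_le_T := hd.one_le_of_slopeSemistable hN hTs hT0
  have hnorm : ‖chargePath σ.Z W s (cls v S)‖ + ‖chargePath σ.Z W s (cls v T)‖ =
      ‖chargePath σ.Z W s (cls v E)‖ := by
    rw [hrS, hrT, norm_mul, norm_mul, Complex.norm_real, Complex.norm_real,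
      Real.norm_of_nonneg hr.le, Real.norm_of_nonneg (sub_pos.2 hr1).le]
    ring
  have hdrop : ∀ F, 2 * C * ‖chargePath σ.Z W s (cls v F)‖ + 1 ≤
      2 * C * ‖chargePath σ.Z W s (cls v E)‖ →
      pathSize σ.Z W C δ s (cls v F) + 1 ≤ pathSize σ.Z W C δ t (cls v E) :=
    fun F hF => (h.pathSize_add_one_le hs.1 hF).trans (h.pathSize_le hs.2 ht hE hE0)
  refine ⟨s, hs1, r, ⟨hr, hr1⟩, S, T, hS.tri, hrS, hrT, ?_⟩
  rintro F (rfl | rfl)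
  · exact ⟨hSs, hdrop F (by rw [← hnorm, mul_add]; gcongr)⟩
  · exact ⟨hTs, hdrop F (by rw [← hnorm, mul_add, add_comm]; gcongr)⟩

theorem quadratic_nonneg (h : Deformation σ α W N C δ ε) (hN : ∀ x, x ≠ 0 → 1 ≤ N x)
    {Q : QuadraticForm ℝ (ℝ ⊗[ℤ] Λ)} (hQ : σ.SupportProperty Q)
    (hker : ∀ t ∈ Set.Icc (0 : ℝ) 1, KerNegDef Q (chargePath σ.Z W t)) {n : ℤ} {t : ℝ}
    (ht : t ∈ Set.Icc 0 1) {E : D}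
    (hE : SlopeSemistable v (σ.Heart (α + n)) (chargePath σ.Z W t) E) :
    0 ≤ Q ((1 : ℝ) ⊗ₜ[ℤ] cls v E) := by
  obtain ⟨m, hm⟩ := exists_nat_gt (pathSize σ.Z W C δ t (cls v E))
  induction m generalizing t E with
  | zero =>
    have := h.C_nonneg
    have : 0 ≤ pathSize σ.Z W C δ t (cls v E) := by unfold pathSize; positivity
    exact absurd hm (by simpa using this)
  | succ m ih =>
    by_cases hE0 : IsZero E
    · rw [cls_isZero hE0, TensorProduct.tmul_zero, QuadraticMap.map_zero]
    by_cases hEZ : SlopeSemistable v (σ.Heart (α + n)) σ.Z E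
    · exact hQ.2 E (h.isSemistable_of_slopeSemistable hEZ hE0)
    obtain ⟨s, hs, r, hr, S, T, tri, hS, hT, hfactor⟩ := h.exists_factors hN ht hE hE0 hEZ
    have hQ_factor : ∀ F ∈ ({S, T} : Set D), 0 ≤ Q ((1 : ℝ) ⊗ₜ[ℤ] cls v F) := fun F hF =>
      ih hs (hfactor F hF).1 (by push_cast at hm; linarith [(hfactor F hF).2])
    rw [cls_distTri tri, TensorProduct.tmul_add]
    exact (hker s hs).add_nonneg hr.1 (sub_pos.2 hr.2) ((liftBaseChange_one_tmul _ _).trans hS)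
      ((liftBaseChange_one_tmul _ _).trans hT) (hQ_factor S (by simp)) (hQ_factor T (by simp))

theorem supportProperty (h : Deformation σ α W N C δ ε) (hN : ∀ x, x ≠ 0 → 1 ≤ N x)
    {Q : QuadraticForm ℝ (ℝ ⊗[ℤ] Λ)} (hQ : σ.SupportProperty Q)
    (hker : ∀ t ∈ Set.Icc (0 : ℝ) 1, KerNegDef Q (chargePath σ.Z W t)) :
    h.deform.SupportProperty Q := by
  have one_mem : (1 : ℝ) ∈ Set.Icc 0 1 := ⟨zero_le_one, le_rfl⟩
  have hW := hker 1 one_mem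
  rw [chargePath_one] at hW
  refine ⟨hW, ?_⟩
  rintro E ⟨φ, hE⟩
  refine h.quadratic_nonneg hN hQ hker (n := ⌈φ - α⌉ - 1) one_mem ?_
  rw [chargePath_one]
  exact hE.1

end Deformation

end Support

section LocalInjectivity

variable {D : Type u} [Category.{w} D] [HasZeroObject D] [HasShift D ℤ] [Preadditive D]
  [∀ n : ℤ, (shiftFunctor D n).Additive] [Pretriangulated D]
  {Λ : Type*} [AddCommGroup Λ] {v : K₀ D →+ Λ}

theorem StabilityCondition.edist_le_iff {σ τ : StabilityCondition v} {ε : ℝ} (hε : 0 ≤ ε) :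
    edist σ τ ≤ ENNReal.ofReal ε ↔ ∀ E : {E : D // ¬ IsZero E},
      |σ.phiMinus E - τ.phiMinus E| ≤ ε ∧ |σ.phiPlus E - τ.phiPlus E| ≤ ε ∧
      |Real.log (σ.mass E.1) - Real.log (τ.mass E.1)| ≤ ε := by
  change StabilityCondition.stabEDist σ τ ≤ _ ↔ _
  simp only [StabilityCondition.stabEDist, iSup_le_iff, max_le_iff, edist_dist,
    ENNReal.ofReal_le_ofReal_iff hε, Real.dist_eq]

variable [IsTriangulated D]

namespace PreStabilityCondition

variable {σ τ : PreStabilityCondition v}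

theorem mem_of_phaseGT_of_phaseLE {ψ : ℝ} {E : D} (hgt : ∀ a < ψ, σ.PhaseGT a E)
    (hle : σ.PhaseLE ψ E) : σ.P ψ E := by
  obtain ⟨l, hl⟩ := σ.exists_hnChain E
  exact mem_of_hnChain hl fun p hp => le_antisymm (hl.phaseLE_iff.1 hle p hp)
    (le_of_forall_lt fun a ha => hl.phaseGT_iff.1 (hgt a ha) p hp)

theorem imRot_pos {θ a : ℝ} {E : D} (hgt : σ.PhaseGT θ E) (hle : σ.PhaseLE a E) (ha : a < θ + 1)
    (hE : ¬ IsZero E) : 0 < imRot θ (σ.Z (cls v E)) := by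
  obtain ⟨l, hl⟩ := σ.exists_hnChain E
  exact hl.map_cls_induction hE σ.Z (p := fun z => 0 < imRot θ z)
    (fun x y hx hy => map_add (imRot θ) x y ▸ add_pos hx hy) fun p hp =>
      (onRay_of_hnChain hl p hp).imRot_pos (hl.phaseGT_iff.1 hgt p hp)
        ((hl.phaseLE_iff.1 hle p hp).trans_lt ha)

theorem imRot_neg {θ a : ℝ} {E : D} (hgt : σ.PhaseGT (θ - 1) E) (hle : σ.PhaseLE a E)
    (ha : a < θ) (hE : ¬ IsZero E) : imRot θ (σ.Z (cls v E)) < 0 := by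
  have hrot := imRot_add_one (θ - 1) (σ.Z (cls v E))
  rw [sub_add_cancel] at hrot
  linarith [imRot_pos hgt hle (by linarith) hE]

/-- The phases of all objects with respect to `τ` differ by at most `ε` from those with
respect to `σ`. -/
def PhaseClose (ε : ℝ) (σ τ : PreStabilityCondition v) : Prop :=
  ∀ a E, (σ.PhaseLE a E → τ.PhaseLE (a + ε) E) ∧ (σ.PhaseGT a E → τ.PhaseGT (a - ε) E)

-- The part of `E` of `τ`-phase greater than `φ` has `σ`-phases in `(φ - 1, φ]` and `τ`-phases
-- in `(φ, φ + 1)`; the common central charge would lie in two disjoint half planes.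
theorem PhaseLE.of_phaseClose {ε : ℝ} (hε : ε < 1) (hZ : σ.Z = τ.Z)
    (hστ : PhaseClose ε σ τ) (hτσ : PhaseClose ε τ σ) {φ : ℝ} {E : D} (hE : σ.PhaseLE φ E) :
    τ.PhaseLE φ E := by
  obtain ⟨X, Y, t, hX, hY⟩ := τ.exists_trunc φ E
  have hXσ_gt : σ.PhaseGT (φ - 1) X := ((hτσ φ X).2 hX).anti (by linarith)
  have hXσ_le : σ.PhaseLE φ X := .left t hE (((hτσ φ Y).1 hY).mono (by linarith))
  have hXτ_le : τ.PhaseLE (max φ (φ + ε)) X :=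
    .left t (((hστ φ E).1 hE).mono (le_max_right _ _))
      (hY.mono (by linarith [le_max_left φ (φ + ε)]))
  have X_isZero : IsZero X := by
    by_contra hX0
    have hpos := imRot_pos hX hXτ_le (max_lt (by linarith) (by linarith)) hX0
    exact hpos.not_ge (hZ ▸ imRot_nonpos hXσ_gt hXσ_le)
  exact PhaseLE.ext t (.of_isZero X_isZero) hY

theorem PhaseGT.of_phaseClose {ε : ℝ} (hε : ε < 1) (hZ : σ.Z = τ.Z)
    (hστ : PhaseClose ε σ τ) (hτσ : PhaseClose ε τ σ) {a b : ℝ} (hab : a < b) {E : D}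
    (hE : σ.PhaseGT b E) : τ.PhaseGT a E := by
  wlog hba : b - min 1 (1 - ε) ≤ a generalizing a
  · have hlt : b - min 1 (1 - ε) < b := sub_lt_self b (lt_min one_pos (sub_pos.2 hε))
    exact (this (max_lt hab hlt) (le_max_right a _)).anti (le_max_left a _)
  have hmin := And.intro (min_le_left 1 (1 - ε)) (min_le_right 1 (1 - ε))
  obtain ⟨X, Y, t, hX, hY⟩ := τ.exists_trunc a E
  have hYσ_gt : σ.PhaseGT b Y := .right t hE (((hτσ a X).2 hX).anti (by linarith))
  have hYσ_le : σ.PhaseLE (b + 1) Y := ((hτσ a Y).1 hY).mono (by linarith)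
  have hYτ_gt : τ.PhaseGT (b - 1) Y :=
    .right t (((hστ b E).2 hE).anti (by linarith)) (hX.anti (by linarith))
  have Y_isZero : IsZero Y := by
    by_contra hY0
    exact (imRot_neg hYτ_gt hY hab hY0).not_ge (hZ ▸ imRot_nonneg hYσ_gt hYσ_le)
  exact PhaseGT.ext t hX (.of_isZero Y_isZero)

theorem P_of_phaseClose {ε : ℝ} (hε : ε < 1) (hZ : σ.Z = τ.Z)
    (hστ : PhaseClose ε σ τ) (hτσ : PhaseClose ε τ σ) {φ : ℝ} {E : D} (hE : σ.P φ E) :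
    τ.P φ E := by
  refine mem_of_phaseGT_of_phaseLE (fun a ha => ?_)
    (.of_phaseClose hε hZ hστ hτσ (.of_mem hE le_rfl))
  obtain ⟨b, hab, hb⟩ := exists_between ha
  exact .of_phaseClose hε hZ hστ hτσ hab (.of_mem hE hb)

end PreStabilityCondition

namespace StabilityCondition

open PreStabilityCondition

variable {σ τ : StabilityCondition v}

theorem phaseClose_of_edist_le {ε : ℝ} (hε : 0 ≤ ε) (h : edist σ τ ≤ ENNReal.ofReal ε) :
    PhaseClose ε σ.toPreStabilityCondition τ.toPreStabilityCondition := by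
  rw [edist_le_iff hε] at h
  intro a E
  by_cases hE : IsZero E
  · exact ⟨fun _ => .of_isZero hE, fun _ => .of_isZero hE⟩
  obtain ⟨hminus, hplus, -⟩ := h ⟨E, hE⟩
  rw [abs_le] at hminus hplus
  rw [← phiPlus_le_iff _ ⟨E, hE⟩, ← phiPlus_le_iff _ ⟨E, hE⟩, ← lt_phiMinus_iff _ ⟨E, hE⟩,
    ← lt_phiMinus_iff _ ⟨E, hE⟩]
  constructor <;> intro <;> linarith

theorem eq_of_edist_lt_one (h : edist σ τ < 1) (hZ : σ.charge = τ.charge) : σ = τ := by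
  have hε : (edist σ τ).toReal < 1 := by
    simpa using (ENNReal.toReal_lt_toReal h.ne_top ENNReal.one_ne_top).2 h
  have hle := (ENNReal.ofReal_toReal h.ne_top).ge
  have hστ := phaseClose_of_edist_le ENNReal.toReal_nonneg hle
  have hτσ := phaseClose_of_edist_le ENNReal.toReal_nonneg ((edist_comm τ σ).trans_le hle)
  have hP : σ.P = τ.P := by
    funext φ
    ext E
    exact ⟨P_of_phaseClose hε hZ hστ hτσ, P_of_phaseClose hε hZ.symm hτσ hστ⟩
  obtain ⟨⟨Z, P, _, _, _, _, _, _⟩, _⟩ := σ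
  obtain ⟨⟨Z', P', _, _, _, _, _, _⟩, _⟩ := τ
  obtain rfl : Z = Z' := hZ
  obtain rfl : P = P' := hP
  rfl

end StabilityCondition

end LocalInjectivity

section Continuity

open Filter Topology

theorem OnRay.norm_sub_le {φ ψ : ℝ} {z : ℂ} (h : OnRay ψ z) :
    ‖z - ‖z‖ * Complex.exp (Complex.I * Real.pi * φ)‖ ≤ Real.pi * |ψ - φ| * ‖z‖ := by
  obtain ⟨r, hr, rfl⟩ := h
  rw [norm_ray hr.le, ← mul_sub, norm_mul, Complex.norm_real, Real.norm_of_nonneg hr.le,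
    mul_comm r]
  refine mul_le_mul_of_nonneg_right ?_ hr.le
  have hrotate : Complex.exp (Complex.I * Real.pi * ψ) - Complex.exp (Complex.I * Real.pi * φ) =
      Complex.exp ((Real.pi * φ : ℝ) * Complex.I) *
        (Complex.exp (Complex.I * (Real.pi * (ψ - φ) : ℝ)) - 1) := by
    rw [mul_sub, ← Complex.exp_add, mul_one]
    push_cast
    ring_nf
  rw [hrotate, norm_mul, Complex.norm_exp_ofReal_mul_I, one_mul]
  refine Real.norm_exp_I_mul_ofReal_sub_one_le.trans ?_
  rw [norm_mul, Real.norm_of_nonneg Real.pi_pos.le, Real.norm_eq_abs]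

theorem norm_sum_sub_mul_exp_le {l : List (ℝ × ℂ)} {φ ε : ℝ} (hray : ∀ p ∈ l, OnRay p.1 p.2)
    (hε : ∀ p ∈ l, |p.1 - φ| ≤ ε) :
    ‖(l.map fun p => p.2).sum -
        ((l.map fun p => ‖p.2‖).sum : ℝ) * Complex.exp (Complex.I * Real.pi * φ)‖ ≤
      Real.pi * ε * (l.map fun p => ‖p.2‖).sum := by
  induction l with
  | nil => simp
  | cons p l ih =>
    rw [List.forall_mem_cons] at hray hε
    have hhead : ‖p.2 - ‖p.2‖ * Complex.exp (Complex.I * Real.pi * φ)‖ ≤ Real.pi * ε * ‖p.2‖ :=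
      hray.1.norm_sub_le.trans (by gcongr; exact hε.1)
    rw [List.map_cons, List.map_cons, List.sum_cons, List.sum_cons, Complex.ofReal_add, add_mul,
      add_sub_add_comm, mul_add]
    exact (norm_add_le _ _).trans (add_le_add hhead (ih hray.2 hε.2))

variable {D : Type u} [Category.{w} D] [HasZeroObject D] [HasShift D ℤ] [Preadditive D]
  [∀ n : ℤ, (shiftFunctor D n).Additive] [Pretriangulated D]
  {Λ : Type*} [AddCommGroup Λ] {v : K₀ D →+ Λ}

theorem StabilityCondition.tendsto_edist_toReal (σ : StabilityCondition v) :
    Tendsto (fun τ : StabilityCondition v => (edist σ τ).toReal) (𝓝 σ) (𝓝 0) := by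
  have hedist : Continuous fun τ : StabilityCondition v => edist σ τ := by fun_prop
  rw [← ENNReal.toReal_zero, ← edist_self σ]
  exact (ENNReal.tendsto_toReal (by simp)).comp (hedist.tendsto σ)

theorem StabilityCondition.eventually_abs_sub_le (σ : StabilityCondition v)
    (E : {E : D // ¬ IsZero E}) :
    ∀ᶠ τ in 𝓝 σ, |σ.phiMinus E - τ.phiMinus E| ≤ (edist σ τ).toReal ∧
      |σ.phiPlus E - τ.phiPlus E| ≤ (edist σ τ).toReal ∧
      |Real.log (σ.mass E.1) - Real.log (τ.mass E.1)| ≤ (edist σ τ).toReal := by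
  filter_upwards [Metric.eball_mem_nhds σ (ε := 1) one_pos] with τ hτ
  rw [Metric.mem_eball, edist_comm] at hτ
  exact (edist_le_iff ENNReal.toReal_nonneg).1 (ENNReal.ofReal_toReal hτ.ne_top).ge E

theorem StabilityCondition.tendsto_mass (σ : StabilityCondition v) {E : D} (hE : ¬ IsZero E) :
    Tendsto (fun τ : StabilityCondition v => τ.mass E) (𝓝 σ) (𝓝 (σ.mass E)) := by
  have hlog : Tendsto (fun τ : StabilityCondition v => Real.log (τ.mass E)) (𝓝 σ)
      (𝓝 (Real.log (σ.mass E))) := by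
    rw [tendsto_iff_dist_tendsto_zero]
    refine squeeze_zero' (.of_forall fun _ => dist_nonneg) ?_ σ.tendsto_edist_toReal
    filter_upwards [σ.eventually_abs_sub_le ⟨E, hE⟩] with τ hτ
    rw [dist_comm, Real.dist_eq]
    exact hτ.2.2
  simpa only [Function.comp_def, Real.exp_log (PreStabilityCondition.mass_pos _ hE)] using
    (Real.continuous_exp.tendsto _).comp hlog

@[elab_as_elim]
theorem K₀.induction_on {p : K₀ D → Prop} (k : K₀ D) (of : ∀ E, p (K₀.of E))
    (neg : ∀ E, p (-K₀.of E)) (zero : p 0) (add : ∀ x y, p x → p y → p (x + y)) : p k := by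
  induction k using QuotientAddGroup.induction_on with
  | H k => exact FreeAbelianGroup.induction_on k zero of (fun E _ => neg E) fun x y => add x y

variable [IsTriangulated D]

theorem PreStabilityCondition.norm_Z_sub_mass_le (σ : PreStabilityCondition v)
    (E : {E : D // ¬ IsZero E}) {φ ε : ℝ} (hminus : φ - ε ≤ σ.phiMinus E)
    (hplus : σ.phiPlus E ≤ φ + ε) :
    ‖σ.Z (cls v E.1) - σ.mass E.1 * Complex.exp (Complex.I * Real.pi * φ)‖ ≤
      Real.pi * ε * σ.mass E.1 := by
  have hl := (σ.hn E.1).hnChain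
  have hle := hl.phaseLE_iff.1 ((σ.phiPlus_le_iff E _).1 hplus)
  have hge : ∀ p ∈ (σ.hn E.1).list, φ - ε ≤ p.1 := fun p hp => le_of_forall_lt fun a ha =>
    hl.phaseGT_iff.1 ((σ.lt_phiMinus_iff E a).1 (ha.trans_le hminus)) p hp
  have hphase : ∀ p ∈ chargeList v σ.Z (σ.hn E.1).list, |p.1 - φ| ≤ ε :=
    List.forall_mem_map.2 fun p hp =>
      abs_sub_le_iff.2 ⟨by linarith [hle p hp], by linarith [hge p hp]⟩
  rw [← hl.sum_chargeList, mass_eq_massList, ← sum_norm_chargeList]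
  exact norm_sum_sub_mul_exp_le (onRay_chargeList hl) hphase

namespace PreStabilityCondition

theorem le_phiMinus_of_mem (σ : PreStabilityCondition v) (E : {E : D // ¬ IsZero E}) {φ : ℝ}
    (h : σ.P φ E.1) : φ ≤ σ.phiMinus E :=
  le_of_forall_lt fun _ ha => (σ.lt_phiMinus_iff E _).2 (.of_mem h ha)

theorem phiPlus_le_of_mem (σ : PreStabilityCondition v) (E : {E : D // ¬ IsZero E}) {φ : ℝ}
    (h : σ.P φ E.1) : σ.phiPlus E ≤ φ :=
  (σ.phiPlus_le_iff E _).2 (.of_mem h le_rfl)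

end PreStabilityCondition

namespace StabilityCondition

open PreStabilityCondition

theorem tendsto_Z_of_mem (σ : StabilityCondition v) {φ : ℝ} {E : D} (hE : σ.P φ E)
    (hE0 : ¬ IsZero E) :
    Tendsto (fun τ : StabilityCondition v => τ.Z (cls v E)) (𝓝 σ) (𝓝 (σ.Z (cls v E))) := by
  have hge := le_phiMinus_of_mem _ ⟨E, hE0⟩ hE
  have hle := phiPlus_le_of_mem _ ⟨E, hE0⟩ hE
  set u := Complex.exp (Complex.I * Real.pi * φ)
  have hσ : σ.Z (cls v E) = σ.mass E * u := by
    have hnorm := σ.norm_Z_sub_mass_le ⟨E, hE0⟩ (φ := φ) (ε := 0) (by simpa using hge)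
      (by simpa using hle)
    simpa only [mul_zero, zero_mul, norm_le_zero_iff, sub_eq_zero] using hnorm
  have hmass : Tendsto (fun τ : StabilityCondition v => (τ.mass E : ℂ) * u) (𝓝 σ)
      (𝓝 (σ.mass E * u)) :=
    ((Complex.continuous_ofReal.tendsto _).comp (σ.tendsto_mass hE0)).mul_const _
  have herror : Tendsto (fun τ : StabilityCondition v => τ.Z (cls v E) - τ.mass E * u) (𝓝 σ)
      (𝓝 0) := by
    refine squeeze_zero_norm' (a := fun τ => Real.pi * (edist σ τ).toReal * τ.mass E) ?_ ?_
    · filter_upwards [σ.eventually_abs_sub_le ⟨E, hE0⟩] with τ ⟨hminus, hplus, _⟩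
      rw [abs_le] at hminus hplus
      exact τ.norm_Z_sub_mass_le ⟨E, hE0⟩ (by linarith) (by linarith)
    · simpa using (σ.tendsto_edist_toReal.const_mul Real.pi).mul (σ.tendsto_mass hE0)
  rw [hσ]
  simpa using herror.add hmass

theorem tendsto_Z_cls (σ : StabilityCondition v) (E : D) :
    Tendsto (fun τ : StabilityCondition v => τ.Z (cls v E)) (𝓝 σ) (𝓝 (σ.Z (cls v E))) := by
  obtain ⟨l, hl⟩ := σ.exists_hnChain E
  simp only [hl.map_cls_eq_sum]
  exact tendsto_list_sum l fun p hp => σ.tendsto_Z_of_mem (hl.mem p hp) (hl.ne_zero p hp)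

theorem tendsto_Z (hv : Function.Surjective v) (σ : StabilityCondition v) (x : Λ) :
    Tendsto (fun τ : StabilityCondition v => τ.Z x) (𝓝 σ) (𝓝 (σ.Z x)) := by
  obtain ⟨k, rfl⟩ := hv x
  induction k using K₀.induction_on with
  | of E => exact σ.tendsto_Z_cls E
  | neg E => simpa only [map_neg, cls] using (σ.tendsto_Z_cls E).neg
  | zero => simp
  | add x y hx hy => simpa using hx.add hy

theorem continuous_charge (hv : Function.Surjective v) :
    Continuous (charge : StabilityCondition v → _) := by
  rw [continuous_induced_rng, continuous_pi_iff]
  exact fun x => continuous_iff_continuousAt.2 fun σ => σ.tendsto_Z hv x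

end StabilityCondition

end Continuity

section Coordinates

open Module

theorem continuous_quadraticForm {V : Type*} [NormedAddCommGroup V] [NormedSpace ℝ V]
    [FiniteDimensional ℝ V] (Q : QuadraticForm ℝ V) : Continuous Q := by
  have hQ : (Q : V → ℝ) = fun x => (QuadraticMap.associated Q).toContinuousBilinearMap x x :=
    funext fun x => (QuadraticMap.associated_eq_self_apply ℝ Q x).symm
  rw [hQ]
  fun_prop

-- The minimum of `‖f x‖` over the compact set of unit vectors with `0 ≤ Q x` is positive.
theorem exists_pos_mul_norm_le {V F : Type*} [NormedAddCommGroup V] [NormedSpace ℝ V]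
    [FiniteDimensional ℝ V] [NormedAddCommGroup F] [NormedSpace ℝ F] {Q : QuadraticForm ℝ V}
    {f : V →ₗ[ℝ] F} (h : ∀ x, f x = 0 → x ≠ 0 → Q x < 0) :
    ∃ c > 0, ∀ x, 0 ≤ Q x → c * ‖x‖ ≤ ‖f x‖ := by
  have : ProperSpace V := FiniteDimensional.proper ℝ V
  set K := Metric.sphere (0 : V) 1 ∩ {x | 0 ≤ Q x}
  have hK : IsCompact K := (isCompact_sphere 0 1).inter_right
    (isClosed_le continuous_const (continuous_quadraticForm Q))
  obtain ⟨c, hc, hcK⟩ : ∃ c > 0, ∀ x ∈ K, c ≤ ‖f x‖ := by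
    rcases K.eq_empty_or_nonempty with hempty | hne
    · exact ⟨1, one_pos, by simp [hempty]⟩
    have hcont : ContinuousOn (fun x => ‖f x‖) K :=
      f.continuous_of_finiteDimensional.norm.continuousOn
    obtain ⟨x, hx, hmin⟩ := hK.exists_isMinOn hne hcont
    refine ⟨‖f x‖, norm_pos_iff.2 fun hfx => ?_, fun _ hy => hmin hy⟩
    exact (h x hfx (ne_zero_of_mem_unit_sphere ⟨x, hx.1⟩)).not_ge hx.2
  refine ⟨c, hc, fun x hx => ?_⟩
  rcases eq_or_ne x 0 with rfl | hx0
  · simp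
  have hunit := hcK (‖x‖⁻¹ • x) ⟨by simp [norm_smul, hx0], by
    simp only [Set.mem_ofPred_eq, QuadraticMap.map_smul]
    exact mul_nonneg (mul_self_nonneg _) hx⟩
  rwa [map_smul, norm_smul, norm_inv, norm_norm, ← div_eq_inv_mul,
    le_div_iff₀ (norm_pos_iff.2 hx0)] at hunit

variable {ι Λ : Type*} [Fintype ι] [AddCommGroup Λ] (b : Basis ι ℤ Λ)

/-- The coordinates on `Λ_ℝ` given by a basis of `Λ`, with values in `ℝ^ι` with its `ℓ¹`-norm. -/
def coordEquiv : (ℝ ⊗[ℤ] Λ) ≃ₗ[ℝ] PiLp 1 fun _ : ι => ℝ :=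
  (b.baseChange ℝ).equivFun ≪≫ₗ (WithLp.linearEquiv 1 ℝ (ι → ℝ)).symm

/-- The `ℓ¹`-norm on a lattice with respect to a basis. -/
def coordNorm : AddGroupSeminorm Λ :=
  (normAddGroupSeminorm (PiLp 1 fun _ : ι => ℝ)).comp
    ((coordEquiv b).toAddMonoidHom.comp (TensorProduct.mk ℤ ℝ Λ 1).toAddMonoidHom)

theorem coordNorm_apply (x : Λ) : coordNorm b x = ‖coordEquiv b ((1 : ℝ) ⊗ₜ[ℤ] x)‖ := rfl

theorem coordEquiv_one_tmul (x : Λ) (i : ι) : coordEquiv b ((1 : ℝ) ⊗ₜ[ℤ] x) i = b.repr x i := by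
  simp [coordEquiv]

theorem abs_repr_le_coordNorm (x : Λ) (i : ι) : |(b.repr x i : ℝ)| ≤ coordNorm b x := by
  rw [← coordEquiv_one_tmul, ← Real.norm_eq_abs]
  exact PiLp.norm_apply_le _ i

theorem one_le_coordNorm {x : Λ} (hx : x ≠ 0) : 1 ≤ coordNorm b x := by
  obtain ⟨i, hi⟩ : ∃ i, b.repr x i ≠ 0 := by
    by_contra! h
    exact hx (b.repr.map_eq_zero_iff.1 (Finsupp.ext h))
  refine le_trans ?_ (abs_repr_le_coordNorm b x i)
  exact_mod_cast Int.one_le_abs hi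

theorem finite_coordNorm_le (R : ℝ) : {x | coordNorm b x ≤ R}.Finite := by
  classical
  refine ((Set.finite_Icc (fun _ : ι => -⌈R⌉) fun _ => ⌈R⌉).preimage
    b.equivFun.injective.injOn).subset fun x hx => ?_
  have habs : ∀ i, |b.repr x i| ≤ ⌈R⌉ := fun i => by
    exact_mod_cast (abs_repr_le_coordNorm b x i).trans (hx.trans (Int.le_ceil R))
  exact ⟨fun i => (abs_le.1 (habs i)).1, fun i => (abs_le.1 (habs i)).2⟩

theorem liftBaseChange_eq_sum (Z : Λ →ₗ[ℤ] ℂ) (y : ℝ ⊗[ℤ] Λ) :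
    Z.liftBaseChange ℝ y = ∑ i, (coordEquiv b y i : ℂ) * Z (b i) := by
  conv_lhs => rw [← (b.baseChange ℝ).sum_repr y, map_sum]
  simp [LinearMap.liftBaseChange_tmul, coordEquiv]

theorem norm_liftBaseChange_sub_le {Z W : Λ →ₗ[ℤ] ℂ} {δ : ℝ}
    (h : ∀ i, ‖W (b i) - Z (b i)‖ ≤ δ) (y : ℝ ⊗[ℤ] Λ) :
    ‖W.liftBaseChange ℝ y - Z.liftBaseChange ℝ y‖ ≤ δ * ‖coordEquiv b y‖ := by
  rw [liftBaseChange_eq_sum b, liftBaseChange_eq_sum b, ← Finset.sum_sub_distrib,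
    PiLp.norm_eq_of_L1, Finset.mul_sum]
  refine (norm_sum_le _ _).trans (Finset.sum_le_sum fun i _ => ?_)
  rw [← mul_sub, norm_mul, mul_comm δ, Complex.norm_real]
  exact mul_le_mul_of_nonneg_left (h i) (norm_nonneg _)

theorem norm_sub_le_coordNorm {Z W : Λ →ₗ[ℤ] ℂ} {δ : ℝ}
    (h : ∀ i, ‖W (b i) - Z (b i)‖ ≤ δ) (x : Λ) : ‖W x - Z x‖ ≤ δ * coordNorm b x := by
  simpa only [liftBaseChange_one_tmul, coordNorm_apply] using
    norm_liftBaseChange_sub_le b h ((1 : ℝ) ⊗ₜ[ℤ] x)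

end Coordinates

section Boxes

open Module Filter Topology

variable {ι Λ : Type*} [AddCommGroup Λ] (b : Basis ι ℤ Λ)

/-- The central charges whose real and imaginary parts on the basis are `δ`-close to those of `Z`.
A box contains with any two central charges the one mixed from their real and imaginary parts. -/
def box (Z : Λ →ₗ[ℤ] ℂ) (δ : ℝ) : Set (Λ →ₗ[ℤ] ℂ) :=
  {W | ∀ i, |(W (b i)).re - (Z (b i)).re| < δ ∧ |(W (b i)).im - (Z (b i)).im| < δ}

theorem mem_box_self (Z : Λ →ₗ[ℤ] ℂ) {δ : ℝ} (hδ : 0 < δ) : Z ∈ box b Z δ := by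
  simp [box, hδ]

theorem box_mono (Z : Λ →ₗ[ℤ] ℂ) {δ δ' : ℝ} (h : δ ≤ δ') : box b Z δ ⊆ box b Z δ' :=
  fun _ hW i => ⟨(hW i).1.trans_le h, (hW i).2.trans_le h⟩

theorem norm_sub_le_of_mem_box {Z₀ Z : Λ →ₗ[ℤ] ℂ} {δ : ℝ} (hZ : Z ∈ box b Z₀ δ) (i : ι) :
    ‖Z (b i) - Z₀ (b i)‖ ≤ 2 * δ := by
  refine (Complex.norm_le_abs_re_add_abs_im _).trans ?_
  rw [Complex.sub_re, Complex.sub_im]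
  linarith [(hZ i).1, (hZ i).2]

theorem chargePath_mem_box {Z₀ Z W : Λ →ₗ[ℤ] ℂ} {δ t : ℝ} (hZ : Z ∈ box b Z₀ δ)
    (hW : W ∈ box b Z₀ δ) (ht : t ∈ Set.Icc 0 1) : chargePath Z W t ∈ box b Z₀ δ := by
  have hconvex : ∀ f : ℂ →ₗ[ℝ] ℝ, ∀ i, |f (Z (b i)) - f (Z₀ (b i))| < δ →
      |f (W (b i)) - f (Z₀ (b i))| < δ → |f (chargePath Z W t (b i)) - f (Z₀ (b i))| < δ :=
    fun f i hZ hW => by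
      rw [map_chargePath_apply]
      exact (convex_ball (f (Z₀ (b i))) δ).add_smul_sub_mem hZ hW ht
  exact fun i => ⟨hconvex Complex.reLm i (hZ i).1 (hW i).1,
    hconvex Complex.imLm i (hZ i).2 (hW i).2⟩

theorem continuous_chargePath (Z W : Λ →ₗ[ℤ] ℂ) : Continuous (chargePath Z W) := by
  rw [continuous_induced_rng, continuous_pi_iff]
  intro x
  simp only [Function.comp_def, chargePath_apply]
  fun_prop

theorem isPreconnected_box (Z : Λ →ₗ[ℤ] ℂ) (δ : ℝ) : IsPreconnected (box b Z δ) :=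
  isPreconnected_of_forall_pair fun x hx y hy => ⟨chargePath x y '' Set.Icc 0 1,
    Set.image_subset_iff.2 fun _ => chargePath_mem_box b hx hy, ⟨0, by simp⟩, ⟨1, by simp⟩,
    isPreconnected_Icc.image _ (continuous_chargePath x y).continuousOn⟩

theorem continuous_charge_apply (x : Λ) : Continuous fun Z : Λ →ₗ[ℤ] ℂ => Z x :=
  (continuous_apply x).comp continuous_induced_dom

theorem isOpen_box [Finite ι] (Z : Λ →ₗ[ℤ] ℂ) (δ : ℝ) : IsOpen (box b Z δ) := by
  simp only [box, Set.ofPred_forall]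
  refine isOpen_iInter_of_finite fun i => ?_
  have hcont := continuous_charge_apply (b i)
  exact (isOpen_lt ((Complex.continuous_re.comp hcont).sub continuous_const).abs
    continuous_const).inter
      (isOpen_lt ((Complex.continuous_im.comp hcont).sub continuous_const).abs continuous_const)

theorem box_mem_nhds [Finite ι] (Z : Λ →ₗ[ℤ] ℂ) {δ : ℝ} (hδ : 0 < δ) : box b Z δ ∈ 𝓝 Z :=
  (isOpen_box b Z δ).mem_nhds (mem_box_self b Z hδ)

theorem KerNegDef.of_mul_norm_le [Fintype ι] {Q : QuadraticForm ℝ (ℝ ⊗[ℤ] Λ)} {Z : Λ →ₗ[ℤ] ℂ}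
    {c : ℝ} (hc : 0 < c) (h : ∀ y, 0 ≤ Q y → c * ‖coordEquiv b y‖ ≤ ‖Z.liftBaseChange ℝ y‖) :
    KerNegDef Q Z := by
  intro y hy hy0
  by_contra! hQ
  have hnorm := h y hQ
  rw [hy, norm_zero] at hnorm
  exact hnorm.not_gt (mul_pos hc (norm_pos_iff.2 ((coordEquiv b).map_ne_zero_iff.2 hy0)))

theorem KerNegDef.exists_box [Fintype ι] {Q : QuadraticForm ℝ (ℝ ⊗[ℤ] Λ)} {Z₀ : Λ →ₗ[ℤ] ℂ}
    (h : KerNegDef Q Z₀) : ∃ c > 0, ∀ Z ∈ box b Z₀ c,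
      ∀ y, 0 ≤ Q y → c * ‖coordEquiv b y‖ ≤ ‖Z.liftBaseChange ℝ y‖ := by
  have hcoord : ∀ y, (Z₀.liftBaseChange ℝ ∘ₗ (coordEquiv b).symm.toLinearMap) y = 0 → y ≠ 0 →
      Q.comp (coordEquiv b).symm.toLinearMap y < 0 := fun y hy hy0 =>
    h _ hy ((coordEquiv b).symm.map_ne_zero_iff.2 hy0)
  obtain ⟨c, hc, hcQ⟩ := exists_pos_mul_norm_le hcoord
  refine ⟨c / 4, by positivity, fun Z hZ y hy => ?_⟩
  have hZ₀ : c * ‖coordEquiv b y‖ ≤ ‖Z₀.liftBaseChange ℝ y‖ := by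
    simpa using hcQ (coordEquiv b y) (by simpa using hy)
  have hsub := norm_liftBaseChange_sub_le b (norm_sub_le_of_mem_box b hZ) y
  have htri := norm_sub_norm_le (Z₀.liftBaseChange ℝ y) (Z.liftBaseChange ℝ y)
  rw [norm_sub_rev] at htri
  have : 0 ≤ c * ‖coordEquiv b y‖ := by positivity
  linarith

theorem isOpen_negDefCharges [Module.Free ℤ Λ] [Module.Finite ℤ Λ]
    (Q : QuadraticForm ℝ (ℝ ⊗[ℤ] Λ)) : IsOpen (negDefCharges Q) := by
  have b := Free.chooseBasis ℤ Λ
  refine isOpen_iff_mem_nhds.2 fun Z hZ => ?_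
  obtain ⟨c, hc, h⟩ := KerNegDef.exists_box b hZ
  exact mem_of_superset (box_mem_nhds b Z hc) fun W hW => .of_mul_norm_le b hc (h W hW)

end Boxes

section LocalLift

open Module

variable {D : Type u} [Category.{w} D] [HasZeroObject D] [HasShift D ℤ] [Preadditive D]
  [∀ n : ℤ, (shiftFunctor D n).Additive] [Pretriangulated D]
  {ι Λ : Type*} [AddCommGroup Λ] {v : K₀ D →+ Λ} (b : Basis ι ℤ Λ)
  {Q : QuadraticForm ℝ (ℝ ⊗[ℤ] Λ)} {Z₀ : Λ →ₗ[ℤ] ℂ}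

theorem exists_deformation_constant {ε : ℝ} (hε : 0 < ε) (hε' : ε ≤ 1 / 4) :
    ∃ κ > 0, κ < Real.sin (Real.pi * ε) ∧ κ ≤ 1 / 5 ∧ 10 * κ ≤ 1 - Real.exp (-ε) := by
  have hsin : 0 < Real.sin (Real.pi * ε) :=
    Real.sin_pos_of_pos_of_lt_pi (by positivity) (by nlinarith [Real.pi_pos])
  have hexp : 0 < (1 - Real.exp (-ε)) / 10 := by
    have : Real.exp (-ε) < 1 := Real.exp_lt_one_iff.2 (neg_lt_zero.2 hε)
    linarith
  have hfifth : (0 : ℝ) < 1 / 5 := by norm_num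
  obtain ⟨κ, hκ, hκmin⟩ := exists_between (lt_min hsin (lt_min hfifth hexp))
  obtain ⟨hκsin, hκfifth, hκexp⟩ := by simpa only [lt_min_iff] using hκmin
  exact ⟨κ, hκ, hκsin, hκfifth.le, by linarith⟩

/-- The central charge with the real part of `W` and the imaginary part of `Z`. It is reached from
`Z` and leads to `W` along paths with constant imaginary part and constant real part. -/
def mixCharge (W Z : Λ →ₗ[ℤ] ℂ) : Λ →ₗ[ℤ] ℂ :=
  AddMonoidHom.toIntLinearMap
    { toFun := fun x => ⟨(W x).re, (Z x).im⟩
      map_zero' := by simp [Complex.ext_iff]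
      map_add' := by simp [Complex.ext_iff] }

theorem mixCharge_re (W Z : Λ →ₗ[ℤ] ℂ) (x : Λ) : (mixCharge W Z x).re = (W x).re := rfl

theorem mixCharge_im (W Z : Λ →ₗ[ℤ] ℂ) (x : Λ) : (mixCharge W Z x).im = (Z x).im := rfl

theorem mixCharge_mem_box {W Z : Λ →ₗ[ℤ] ℂ} {δ : ℝ} (hW : W ∈ box b Z₀ δ)
    (hZ : Z ∈ box b Z₀ δ) : mixCharge W Z ∈ box b Z₀ δ :=
  fun i => ⟨(hW i).1, (hZ i).2⟩

theorem imRot_zero_mixCharge (W Z : Λ →ₗ[ℤ] ℂ) (x : Λ) :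
    imRot 0 (mixCharge W Z x) = imRot 0 (Z x) := by
  simp [imRot_apply, mixCharge_im]

theorem imRot_half_mixCharge (W Z : Λ →ₗ[ℤ] ℂ) (x : Λ) :
    imRot (1 / 2) (W x) = imRot (1 / 2) (mixCharge W Z x) := by
  have hcos : Real.cos (Real.pi * (1 / 2)) = 0 := by rw [mul_one_div, Real.cos_pi_div_two]
  simp only [imRot_apply, hcos, mixCharge_re, zero_mul]

theorem norm_sub_le_of_mem_box_of_mem_box {Z W : Λ →ₗ[ℤ] ℂ} {δ : ℝ} (hZ : Z ∈ box b Z₀ δ)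
    (hW : W ∈ box b Z₀ δ) (i : ι) : ‖W (b i) - Z (b i)‖ ≤ 4 * δ := by
  have hZ := norm_sub_le_of_mem_box b hZ i
  have hW := norm_sub_le_of_mem_box b hW i
  have := norm_sub_le_norm_sub_add_norm_sub (W (b i)) (Z₀ (b i)) (Z (b i))
  rw [norm_sub_rev (Z₀ _)] at this
  linarith

theorem Deformation.of_mem_box [Fintype ι] {σ : PreStabilityCondition v} {W : Λ →ₗ[ℤ] ℂ}
    {α c δ ε : ℝ} (hW : W ∈ box b Z₀ δ) (hσ : σ.Z ∈ box b Z₀ δ)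
    (him : ∀ x, imRot α (W x) = imRot α (σ.Z x)) (hc : 0 < c)
    (hnorm : ∀ φ E, σ.P φ E → c * coordNorm b (cls v E) ≤ ‖σ.Z (cls v E)‖)
    (hδ : 0 ≤ δ) (hε : 0 < ε) (hε' : ε ≤ 1 / 4) (hsin : 4 * δ * c⁻¹ < Real.sin (Real.pi * ε))
    (hfifth : 4 * δ * c⁻¹ ≤ 1 / 5) : Deformation σ α W (coordNorm b) c⁻¹ (4 * δ) ε where
  im_eq := him
  finite := finite_coordNorm_le b
  norm_le φ E hE := by
    rw [← div_eq_inv_mul, le_div_iff₀' hc]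
    exact hnorm φ E hE
  close := norm_sub_le_coordNorm b (norm_sub_le_of_mem_box_of_mem_box b hσ hW)
  C_nonneg := inv_nonneg.2 hc.le
  δ_nonneg := by positivity
  ε_pos := hε
  ε_le := hε'
  lt_sin := hsin
  le_fifth := hfifth

namespace StabilityCondition

variable [IsTriangulated D] [Finite ι]

theorem exists_deform_of_imRot_eq (hZ₀ : KerNegDef Q Z₀) {ε : ℝ} (hε : 0 < ε) :
    ∃ δ > 0, (∀ Z ∈ box b Z₀ δ, KerNegDef Q Z) ∧ ∀ σ : StabilityCondition v,
      σ.SupportProperty Q → σ.charge ∈ box b Z₀ δ → ∀ W ∈ box b Z₀ δ, ∀ α,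
        (∀ x, imRot α (W x) = imRot α (σ.charge x)) →
          ∃ τ : StabilityCondition v, τ.SupportProperty Q ∧ τ.charge = W ∧
            edist σ τ ≤ ENNReal.ofReal ε := by
  cases nonempty_fintype ι
  obtain ⟨c, hc, hbox⟩ := hZ₀.exists_box b
  set ε' := min ε (1 / 4)
  have hε' : 0 < ε' := lt_min hε (by norm_num)
  obtain ⟨κ, hκ, hκsin, hκfifth, hκexp⟩ := exists_deformation_constant hε' (min_le_right _ _)
  set δ := min c (κ * c / 4)
  have hδ : 0 < δ := lt_min hc (by positivity)
  have hδκ : 4 * δ * c⁻¹ ≤ κ := by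
    have : δ ≤ κ * c / 4 := min_le_right _ _
    rw [← div_eq_mul_inv, div_le_iff₀ hc]
    linarith
  have hmono := box_mono b Z₀ (min_le_left c (κ * c / 4))
  have hker : ∀ Z ∈ box b Z₀ δ, KerNegDef Q Z := fun Z hZ =>
    .of_mul_norm_le b hc (hbox Z (hmono hZ))
  refine ⟨δ, hδ, hker, fun σ hσ hσZ W hW α him => ?_⟩
  have hnorm : ∀ φ E, σ.P φ E → c * coordNorm b (cls v E) ≤ ‖σ.Z (cls v E)‖ := fun φ E hE => by
    simpa only [liftBaseChange_one_tmul] using! hbox _ (hmono hσZ) _ (hσ.2 E ⟨φ, hE⟩)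
  have h := Deformation.of_mem_box b hW hσZ him hc hnorm hδ.le hε' (min_le_right _ _)
    (hδκ.trans_lt hκsin) (hδκ.trans hκfifth)
  have hsupp : h.deform.SupportProperty Q := h.supportProperty (fun x => one_le_coordNorm b) hσ
    fun t ht => hker _ (chargePath_mem_box b hσZ hW ht)
  let τ : StabilityCondition v := ⟨h.deform, Q, hsupp⟩
  have hedist : edist σ τ ≤ ENNReal.ofReal ε' := (edist_le_iff hε'.le).2 fun E =>
    ⟨h.abs_phiMinus_sub_le E, h.abs_phiPlus_sub_le E, h.abs_log_mass_sub_le (by linarith) E.2⟩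
  exact ⟨τ, hsupp, rfl, hedist.trans (ENNReal.ofReal_le_ofReal (min_le_left _ _))⟩

theorem exists_deform (hZ₀ : KerNegDef Q Z₀) {ε : ℝ} (hε : 0 < ε) :
    ∃ δ > 0, (∀ Z ∈ box b Z₀ δ, KerNegDef Q Z) ∧ ∀ σ : StabilityCondition v,
      σ.SupportProperty Q → σ.charge ∈ box b Z₀ δ → ∀ W ∈ box b Z₀ δ,
        ∃ τ : StabilityCondition v, τ.SupportProperty Q ∧ τ.charge = W ∧
          edist σ τ ≤ ENNReal.ofReal ε := by
  obtain ⟨δ, hδ, hker, hdeform⟩ := exists_deform_of_imRot_eq (v := v) b hZ₀ (half_pos hε)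
  refine ⟨δ, hδ, hker, fun σ hσ hσZ W hW => ?_⟩
  have hmix := mixCharge_mem_box b hW hσZ
  obtain ⟨ρ, hρ, hρZ, hσρ⟩ := hdeform σ hσ hσZ _ hmix 0 (imRot_zero_mixCharge W σ.charge)
  obtain ⟨τ, hτ, hτW, hρτ⟩ := hdeform ρ hρ (hρZ ▸ hmix) W hW (1 / 2)
    (hρZ ▸ imRot_half_mixCharge W σ.charge)
  refine ⟨τ, hτ, hτW, (edist_triangle σ ρ τ).trans ((add_le_add hσρ hρτ).trans_eq ?_)⟩
  rw [← ENNReal.ofReal_add (half_pos hε).le (half_pos hε).le, add_halves]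

end StabilityCondition

end LocalLift

section Covering

open Filter Topology Uniformity SetRel

variable {X B : Type*} [TopologicalSpace B]

/-- Local sections of `f` over `W` through the points of `T` over `W`, with values in `T`: the
section through `x` is `ℓ x`, and it depends on `x` in a locally constant way. -/
structure IsSectionFamily [TopologicalSpace X] (f : X → B) (T : Set X) (W : Set B)
    (ℓ : X → B → X) : Prop where
  continuousOn : ∀ x ∈ T, f x ∈ W → ContinuousOn (ℓ x) W
  apply_self : ∀ x ∈ T, f x ∈ W → ℓ x (f x) = x
  mem : ∀ x ∈ T, f x ∈ W → ∀ w ∈ W, ℓ x w ∈ T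
  map_apply : ∀ x ∈ T, f x ∈ W → ∀ w ∈ W, f (ℓ x w) = w
  apply_apply : ∀ x ∈ T, f x ∈ W → ∀ w ∈ W, ∀ w' ∈ W, ℓ (ℓ x w) w' = ℓ x w'
  eventually_eq : ∀ x ∈ T, f x ∈ W → ∀ w ∈ W, ∀ᶠ x' in 𝓝 x, x' ∈ T → f x' ∈ W → ℓ x' w = ℓ x w

namespace IsSectionFamily

variable [TopologicalSpace X] {f : X → B} {T : Set X} {W : Set B} {ℓ : X → B → X}

theorem map_mem_connectedComponentIn (h : IsSectionFamily f T W ℓ) (hW : IsPreconnected W)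
    {U : Set B} (hWU : W ⊆ U) {x₀ x : X} (hx : x ∈ connectedComponentIn (f ⁻¹' U) x₀)
    (hxT : x ∈ T) (hxW : f x ∈ W) {w : B} (hw : w ∈ W) :
    ℓ x w ∈ connectedComponentIn (f ⁻¹' U) x₀ := by
  rw [connectedComponentIn_eq hx]
  refine (hW.image (ℓ x) (h.continuousOn x hxT hxW)).subset_connectedComponentIn
    ⟨f x, hxW, h.apply_self x hxT hxW⟩ ?_ ⟨w, hw, rfl⟩
  rintro _ ⟨w, hw, rfl⟩
  rw [Set.mem_preimage, h.map_apply x hxT hxW w hw]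
  exact hWU hw

theorem restrict_connectedComponentIn (h : IsSectionFamily f T W ℓ) (hW : IsPreconnected W)
    {U : Set B} (hWU : W ⊆ U) {x₀ : X} (hT : connectedComponentIn (f ⁻¹' U) x₀ ⊆ T) :
    IsSectionFamily f (connectedComponentIn (f ⁻¹' U) x₀) W ℓ where
  continuousOn x hx := h.continuousOn x (hT hx)
  apply_self x hx := h.apply_self x (hT hx)
  mem _ hx hxW _ hw := h.map_mem_connectedComponentIn hW hWU hx (hT hx) hxW hw
  map_apply x hx := h.map_apply x (hT hx)
  apply_apply x hx := h.apply_apply x (hT hx)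
  eventually_eq x hx hxW w hw :=
    (h.eventually_eq x (hT hx) hxW w hw).mono fun _ hx' hxT => hx' (hT hxT)

theorem mem_image_iff (h : IsSectionFamily f T W ℓ) {u w : B} (hu : u ∈ W) (hw : w ∈ W) :
    u ∈ f '' T ↔ w ∈ f '' T := by
  have himage : ∀ u ∈ W, ∀ w ∈ W, u ∈ f '' T → w ∈ f '' T := by
    rintro _ hxW w hw ⟨x, hx, rfl⟩
    exact ⟨ℓ x w, h.mem x hx hxW w hw, h.map_apply x hx hxW w hw⟩
  exact ⟨himage u hu w hw, himage w hw u hu⟩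

variable {U : Set B} (hm : Set.MapsTo f T U)

/-- The point over `w` on the section through `x`. -/
def transport (h : IsSectionFamily f T W ℓ) {w : U} (hw : w.1 ∈ W)
    (x : hm.restrict f T U ⁻¹' (Subtype.val ⁻¹' W)) : hm.restrict f T U ⁻¹' {w} :=
  ⟨⟨ℓ x w, h.mem x x.1.2 x.2 w hw⟩, Subtype.ext (h.map_apply x x.1.2 x.2 w hw)⟩

theorem continuous_transport (h : IsSectionFamily f T W ℓ) {w : U} (hw : w.1 ∈ W) :
    Continuous (h.transport hm hw) := by
  refine IsLocallyConstant.continuous ((IsLocallyConstant.iff_eventually_eq _).2 fun x => ?_)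
  have hval : Continuous fun x : hm.restrict f T U ⁻¹' (Subtype.val ⁻¹' W) => x.1.1 :=
    continuous_subtype_val.comp continuous_subtype_val
  filter_upwards [hval.continuousAt (h.eventually_eq x x.1.2 x.2 w hw)] with y hy
  exact Subtype.ext (Subtype.ext (hy y.1.2 y.2))

theorem discreteTopology_fiber (h : IsSectionFamily f T W ℓ) {w : U} (hw : w.1 ∈ W) :
    DiscreteTopology (hm.restrict f T U ⁻¹' {w}) := by
  have hval : Continuous fun x : hm.restrict f T U ⁻¹' {w} => x.1.1 :=
    continuous_subtype_val.comp continuous_subtype_val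
  have hfib : ∀ x : hm.restrict f T U ⁻¹' {w}, f x = w := fun x => congrArg Subtype.val x.2
  have hself : ∀ x : hm.restrict f T U ⁻¹' {w}, ℓ x w = x := fun x => by
    rw [← hfib x, h.apply_self x x.1.2 (hfib x ▸ hw)]
  refine discreteTopology_iff_singleton_mem_nhds.2 fun y => ?_
  filter_upwards [hval.continuousAt (h.eventually_eq y y.1.2 (hfib y ▸ hw) w hw)] with z hz
  have heq : ℓ z w = ℓ y w := hz z.1.2 (hfib z ▸ hw)
  rw [hself, hself] at heq
  exact Subtype.ext (Subtype.ext heq)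

/-- The trivialization of `f` over `W` whose sheets are the sections of the family. -/
def homeomorph (h : IsSectionFamily f T W ℓ) (hf : Continuous f) {w : U} (hw : w.1 ∈ W) :
    hm.restrict f T U ⁻¹' (Subtype.val ⁻¹' W) ≃ₜ
      (Subtype.val ⁻¹' W : Set U) × (hm.restrict f T U ⁻¹' {w}) :=
  have hfib : ∀ y : hm.restrict f T U ⁻¹' {w}, f y = w := fun y => congrArg Subtype.val y.2
  have hfibW : ∀ y : hm.restrict f T U ⁻¹' {w}, f y ∈ W := fun y => hfib y ▸ hw
  have hmap : ∀ p : (Subtype.val ⁻¹' W : Set U) × (hm.restrict f T U ⁻¹' {w}),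
      f (ℓ p.2 p.1) = p.1 := fun p => h.map_apply p.2 p.2.1.2 (hfibW p.2) p.1 p.1.2
  { toFun x := (⟨hm.restrict f T U x, x.2⟩, h.transport hm hw x)
    invFun p := ⟨⟨ℓ p.2 p.1, h.mem p.2 p.2.1.2 (hfibW p.2) p.1 p.1.2⟩,
      show f (ℓ p.2 p.1) ∈ W from (hmap p).symm ▸ p.1.2⟩
    left_inv x := Subtype.ext <| Subtype.ext <|
      (h.apply_apply x x.1.2 x.2 w hw _ x.2).trans (h.apply_self x x.1.2 x.2)
    right_inv p := by
      refine Prod.ext (Subtype.ext (Subtype.ext (hmap p))) (Subtype.ext (Subtype.ext ?_))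
      refine (h.apply_apply p.2 p.2.1.2 (hfibW p.2) p.1 p.1.2 w hw).trans ?_
      rw [← hfib p.2]
      exact h.apply_self p.2 p.2.1.2 (hfibW p.2)
    continuous_toFun := (((hf.restrict hm).comp continuous_subtype_val).subtype_mk _).prodMk
      (h.continuous_transport hm hw)
    continuous_invFun := by
      have := h.discreteTopology_fiber hm hw
      refine continuous_prod_of_discrete_right.2 fun y => .subtype_mk (.subtype_mk ?_ _) _
      exact (h.continuousOn y y.1.2 (hfibW y)).comp_continuous
        (continuous_subtype_val.comp continuous_subtype_val) fun x => x.2 }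

theorem isEvenlyCovered (h : IsSectionFamily f T W ℓ) (hf : Continuous f) (hW : IsOpen W) {w : U}
    (hw : w.1 ∈ W) : IsEvenlyCovered (hm.restrict f T U) w (hm.restrict f T U ⁻¹' {w}) :=
  have hWU : IsOpen (Subtype.val ⁻¹' W : Set U) := hW.preimage continuous_subtype_val
  ⟨h.discreteTopology_fiber hm hw, Subtype.val ⁻¹' W, hw, hWU, hWU.preimage (hf.restrict hm),
    h.homeomorph hm hf hw, fun _ => rfl⟩

end IsSectionFamily

/-- A continuous map `f` that is injective on all sufficiently small subsets of `X`, and such that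
for every `R` each point of `V` has a connected neighbourhood `W` whose points lift to points of `S`
that are `R`-close to any given point of `S` over `W`. -/
structure UniformLifting [UniformSpace X] (f : X → B) (S : Set X) (V : Set B) : Prop where
  continuous : Continuous f
  mapsTo : Set.MapsTo f S V
  exists_injective : ∃ R ∈ 𝓤 X, ∀ x y, (x, y) ∈ R → f x = f y → x = y
  exists_lift : ∀ z ∈ V, ∀ R ∈ 𝓤 X, ∃ W, IsOpen W ∧ z ∈ W ∧ W ⊆ V ∧ IsPreconnected W ∧
    ∀ x ∈ S, f x ∈ W → ∀ w ∈ W, ∃ y ∈ S, f y = w ∧ (x, y) ∈ R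

namespace UniformLifting

variable [UniformSpace X] {f : X → B} {S : Set X} {V : Set B}

theorem exists_symm_injective (h : UniformLifting f S V) :
    ∃ R ∈ 𝓤 X, SetRel.IsSymm R ∧ ∀ x y, (x, y) ∈ R ○ (R ○ R) → f x = f y → x = y := by
  obtain ⟨R₀, hR₀, hinj⟩ := h.exists_injective
  obtain ⟨R, hR, hsymm, hsub⟩ := comp_comp_symm_mem_uniformity_sets hR₀
  exact ⟨R, hR, hsymm, fun x y hxy => hinj x y (hsub (comp_assoc R R R ▸ hxy))⟩

theorem eventually_mem_iff (h : UniformLifting f S V) {x : X} (hx : f x ∈ V) :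
    ∀ᶠ y in 𝓝 x, x ∈ S ↔ y ∈ S := by
  obtain ⟨R, hR, hsymm, hinj⟩ := h.exists_symm_injective
  obtain ⟨W, hW, hxW, -, -, hlift⟩ := h.exists_lift (f x) hx R hR
  have hmem : ∀ y ∈ S, f y ∈ W → ∀ z, f z ∈ W → (y, z) ∈ R → z ∈ S := by
    intro y hy hyW z hzW hyz
    obtain ⟨z', hz', hfz, hyz'⟩ := hlift y hy hyW (f z) hzW
    have hzz : (z, z') ∈ R ○ (R ○ R) := ⟨z, refl_mem_uniformity hR, y, hsymm.symm _ _ hyz, hyz'⟩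
    rwa [hinj z z' hzz hfz.symm]
  filter_upwards [h.continuous.continuousAt (hW.mem_nhds hxW), mem_nhds_left x hR] with y hyW hxy
  exact ⟨fun hxS => hmem x hxS hxW y hyW hxy, fun hyS => hmem y hyS hyW x hxW (hsymm.symm _ _ hxy)⟩

theorem subset_of_isPreconnected (h : UniformLifting f S V) {T : Set X} (hT : IsPreconnected T)
    (hTV : T ⊆ f ⁻¹' V) {x : X} (hx : x ∈ T) (hxS : x ∈ S) : T ⊆ S := fun _ hy =>
  (hT.induction₂ (fun x y => x ∈ S ↔ y ∈ S)
    (fun _ hx => (h.eventually_mem_iff (hTV hx)).filter_mono nhdsWithin_le_nhds)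
    (fun _ _ _ _ _ _ => Iff.trans) (fun _ _ _ _ => Iff.symm) hx hy).1 hxS

theorem exists_isSectionFamily (h : UniformLifting f S V) {u : B} (hu : u ∈ V) :
    ∃ W, IsOpen W ∧ u ∈ W ∧ W ⊆ V ∧ IsPreconnected W ∧ ∃ ℓ, IsSectionFamily f S W ℓ := by
  obtain ⟨R, hR, hsymm, hinj⟩ := h.exists_symm_injective
  obtain ⟨W, hW, huW, hWV, hconn, hlift⟩ := h.exists_lift u hu R hR
  choose! ℓ hS hf hℓ using hlift
  have huniq : ∀ x ∈ S, f x ∈ W → ∀ w ∈ W, ∀ y, f y = w → (x, y) ∈ R ○ R → y = ℓ x w :=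
    fun x hx hxW w hw y hy ⟨z, hxz, hzy⟩ => (hinj _ _
      ⟨x, hsymm.symm _ _ (hℓ x hx hxW w hw), z, hxz, hzy⟩ ((hf x hx hxW w hw).trans hy.symm)).symm
  refine ⟨W, hW, huW, hWV, hconn, ℓ, ?_, ?_, hS, hf, ?_, ?_⟩
  · intro x hx hxW w hw
    refine (Uniform.continuousAt_iff'_right.2 fun R' hR' => ?_).continuousWithinAt
    obtain ⟨W', hW', hwW', -, -, hlift'⟩ := h.exists_lift w (hWV hw) _ (inter_mem hR hR')
    rw [Filter.mem_map]
    filter_upwards [hW'.mem_nhds hwW', hW.mem_nhds hw] with w' hw' hw'W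
    obtain ⟨y, -, hfy, hyR, hyR'⟩ :=
      hlift' (ℓ x w) (hS x hx hxW w hw) (by rwa [hf x hx hxW w hw]) w' hw'
    rwa [Set.mem_preimage, ← huniq x hx hxW w' hw'W y hfy ⟨_, hℓ x hx hxW w hw, hyR⟩]
  · exact fun x hx hxW => (huniq x hx hxW (f x) hxW x rfl
      ⟨x, refl_mem_uniformity hR, refl_mem_uniformity hR⟩).symm
  · intro x hx hxW w hw w' hw'
    have hxw : f (ℓ x w) ∈ W := by rwa [hf x hx hxW w hw]
    exact (huniq _ (hS x hx hxW w hw) hxw w' hw' _ (hf x hx hxW w' hw')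
      ⟨x, hsymm.symm _ _ (hℓ x hx hxW w hw), hℓ x hx hxW w' hw'⟩).symm
  · intro x hx hxW w hw
    filter_upwards [mem_nhds_left x hR] with y hxy hy hyW
    exact huniq x hx hxW w hw _ (hf y hy hyW w hw) ⟨y, hxy, hℓ y hy hyW w hw⟩

section Components

variable {x₀ : X}

theorem connectedComponentIn_preimage_subset (h : UniformLifting f S V) (hx₀ : x₀ ∈ S) :
    connectedComponentIn (f ⁻¹' connectedComponentIn V (f x₀)) x₀ ⊆ S :=
  h.subset_of_isPreconnected isPreconnected_connectedComponentIn
    ((connectedComponentIn_subset _ _).trans (Set.preimage_mono (connectedComponentIn_subset _ _)))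
    (mem_connectedComponentIn (mem_connectedComponentIn (h.mapsTo hx₀))) hx₀

theorem exists_isSectionFamily_connectedComponentIn (h : UniformLifting f S V) (hx₀ : x₀ ∈ S)
    {u : B} (hu : u ∈ connectedComponentIn V (f x₀)) :
    ∃ W, IsOpen W ∧ u ∈ W ∧ ∃ ℓ,
      IsSectionFamily f (connectedComponentIn (f ⁻¹' connectedComponentIn V (f x₀)) x₀) W ℓ := by
  obtain ⟨W, hW, huW, hWV, hconn, ℓ, hℓ⟩ :=
    h.exists_isSectionFamily (connectedComponentIn_subset _ _ hu)
  have hWU : W ⊆ connectedComponentIn V (f x₀) :=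
    connectedComponentIn_eq hu ▸ hconn.subset_connectedComponentIn huW hWV
  exact ⟨W, hW, huW, ℓ,
    hℓ.restrict_connectedComponentIn hconn hWU (h.connectedComponentIn_preimage_subset hx₀)⟩

variable (hm : Set.MapsTo f (connectedComponentIn (f ⁻¹' connectedComponentIn V (f x₀)) x₀)
  (connectedComponentIn V (f x₀)))

theorem isCoveringMap (h : UniformLifting f S V) (hx₀ : x₀ ∈ S) :
    IsCoveringMap (hm.restrict f _ _) := by
  rintro ⟨u, hu⟩
  obtain ⟨W, hW, huW, ℓ, hℓ⟩ := h.exists_isSectionFamily_connectedComponentIn hx₀ hu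
  exact hℓ.isEvenlyCovered hm h.continuous hW huW

theorem surjective (h : UniformLifting f S V) (hx₀ : x₀ ∈ S) :
    Function.Surjective (hm.restrict f _ _) := by
  set 𝒰 := connectedComponentIn (f ⁻¹' connectedComponentIn V (f x₀)) x₀
  have hfx₀ : f x₀ ∈ connectedComponentIn V (f x₀) := mem_connectedComponentIn (h.mapsTo hx₀)
  have himage : f x₀ ∈ f '' 𝒰 := ⟨x₀, mem_connectedComponentIn hfx₀, rfl⟩
  rintro ⟨u, hu⟩
  obtain ⟨x, hx, rfl⟩ : u ∈ f '' 𝒰 := by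
    refine (isPreconnected_connectedComponentIn.induction₂ (fun u w => u ∈ f '' 𝒰 ↔ w ∈ f '' 𝒰)
      (fun u hu => ?_) (fun _ _ _ _ _ _ => Iff.trans) (fun _ _ _ _ => Iff.symm) hfx₀ hu).1 himage
    obtain ⟨W, hW, huW, ℓ, hℓ⟩ := h.exists_isSectionFamily_connectedComponentIn hx₀ hu
    filter_upwards [mem_nhdsWithin_of_mem_nhds (hW.mem_nhds huW)] with w hw
    exact hℓ.mem_image_iff huW hw
  exact ⟨⟨x, hx⟩, rfl⟩

end Components

end UniformLifting

end Covering

section Charge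

variable {D : Type u} [Category.{w} D] [HasZeroObject D] [HasShift D ℤ] [Preadditive D]
  [∀ n : ℤ, (shiftFunctor D n).Additive] [Pretriangulated D] [IsTriangulated D]
  {Λ : Type*} [AddCommGroup Λ] [Module.Free ℤ Λ] [Module.Finite ℤ Λ] {v : K₀ D →+ Λ}

theorem StabilityCondition.uniformLifting_charge (hv : Function.Surjective v)
    (Q : QuadraticForm ℝ (ℝ ⊗[ℤ] Λ)) :
    UniformLifting (charge : StabilityCondition v → _) {σ | σ.SupportProperty Q}
      (negDefCharges Q) where
  continuous := continuous_charge hv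
  mapsTo _ hσ := hσ.1
  exists_injective := ⟨_, edist_mem_uniformity one_pos, fun _ _ => eq_of_edist_lt_one⟩
  exists_lift Z hZ R hR := by
    obtain ⟨ε, hε, hεR⟩ := mem_uniformity_edist.1 hR
    obtain ⟨ε', hε', hε'ε⟩ : ∃ ε' : ℝ, 0 < ε' ∧ ENNReal.ofReal ε' < ε := by
      obtain ⟨ε', -, hε', hε'ε⟩ := ENNReal.lt_iff_exists_real_btwn.1 hε
      exact ⟨ε', ENNReal.ofReal_pos.1 hε', hε'ε⟩
    have b := Module.Free.chooseBasis ℤ Λ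
    obtain ⟨δ, hδ, hker, hdeform⟩ := exists_deform (v := v) b hZ hε'
    refine ⟨box b Z δ, isOpen_box b Z δ, mem_box_self b Z hδ, hker, isPreconnected_box b Z δ, ?_⟩
    intro σ hσ hσZ W hW
    obtain ⟨τ, hτ, hτW, hστ⟩ := hdeform σ hσ hσZ W hW
    exact ⟨τ, hτ, hτW, hεR (hστ.trans_lt hε'ε)⟩

end Charge

end BridgelandStab

end

open BridgelandStab in
theorem mainTheorem8
    {D : Type*} [Category D] [HasZeroObject D] [HasShift D ℤ] [Preadditive D]
    [∀ n : ℤ, (shiftFunctor D n).Additive] [Pretriangulated D] [IsTriangulated D]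
    {Λ : Type*} [AddCommGroup Λ] [Module.Free ℤ Λ] [Module.Finite ℤ Λ]
    (v : K₀ D →+ Λ) (hv : Function.Surjective v)
    (σ : StabilityCondition v) (Q : QuadraticForm ℝ (ℝ ⊗[ℤ] Λ))
    (hσ : σ.SupportProperty Q) :
    IsOpen (negDefCharges Q) ∧
    (IsCoveringMap ((σ.mapsTo_charge Q).restrict StabilityCondition.charge
        (σ.stabComponent Q) (σ.chargeComponent Q)) ∧
      Function.Surjective ((σ.mapsTo_charge Q).restrict StabilityCondition.charge
        (σ.stabComponent Q) (σ.chargeComponent Q))) ∧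
    ∀ τ ∈ σ.stabComponent Q, τ.SupportProperty Q := by
  have h := StabilityCondition.uniformLifting_charge hv Q
  exact ⟨isOpen_negDefCharges Q,
    ⟨h.isCoveringMap (σ.mapsTo_charge Q) hσ, h.surjective (σ.mapsTo_charge Q) hσ⟩,
    h.connectedComponentIn_preimage_subset hσ⟩
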